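/- \textbf{Primitives.} Agents arrive at a queue. When its length is $k\in\mathbb Z_+$, agents arrive at Poisson rate $\lambda_k\ge 0$ and the maximal service rate is $\mu_k$, where $\lambda_0>0$, $\mu_0=0$, $\mu_k>0$ for $k\ge1$, and $(\mu_k)$ is nondecreasing and bounded. An agent gets $V-Ct$ if she is served after spending time $t$ in the queue, pays $Ct$ if she is removed after time $t$ without service, and gets $0$ if she does not join; the provider earns $R$ per agent served ($V,C,R>0$). The process $(\lambda,\mu)$ is \emph{regular} if $\mu_k-\mu_{k-1}$ is nonincreasing in $k\ge1$ and $\lambda_k-\lambda_{k-1}\le\mu_k-\mu_{k-1}$ for all $k\ge2$. \textbf{Policies.} The position $\ell\in\{1,\dots,k\}$ of an agent in a queue of length $k$ is her rank by order of arrival. The designer chooses: (a) entry probabilities $x_k\in[0,1]$, removal rates $y_{k,\ell}\ge0$, and probabilities $z_{k,\ell}\ge0$ with $\sum_{\ell=1}^k z_{k,\ell}\le1$ that the agent in position $\ell$ of a queue of length $k$ is removed when another agent joins; (b) service rates $q_{k,\ell}\ge0$ with $\sum_{\ell\in S}q_{k,\ell}\le\mu_{|S|}$ for all $S\subseteq\{1,\dots,k\}$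 and $\sum_{\ell=1}^kq_{k,\ell}=\mu_k$ for all $k$; (c) a probability distribution $p$ on $\mathbb Z_+$ that satisfies the balance equation $$\lambda_kx_k\Bigl(1-\sum_{\ell}z_{k,\ell}\Bigr)p_k=\Bigl(\mu_{k+1}+\sum_\ell y_{k+1,\ell}\Bigr)p_{k+1}\quad\text{for all }k;\tag{B}$$ (d) an information rule $I=(I^t)_{t\ge0}$, where $I^t$ is a probability distribution on beliefs (probability distributions on pairs $(k,\ell)$) whose mean is the distribution, in the steady state $p$, of (queue length, position) of an agent conditional on her having joined and being still in the queue after time $t$ (Bayes' rule). For an agent at $(k,\ell)$, let $\sigma_{k,\ell}$ be the probability that she will eventually be served and $\tau_{k,\ell}\in[0,\infty]$ the expected time that she will still spend in the queue, both under $(x,y,z,q)$. Obedience requires $$\sum_{k,\ell}\gamma_{k,\ell}\,(V\sigma_{k,\ell}-C\tau_{k,\ell})\ge0\quad\text{for all }t\ge0\text{ and all }\gamma\in\operatorname{supp}(I^t).\tag{IC}$$ (If nobody ever joins, there is no constraint on $I$.) \textbf{The problem $[P]$.} For a given $\alpha\in[0,1]$, maximize $$W(p)=(1-\alpha)R\sum_{k\ge1}p_k\mu_k+\alpha\sum_{k\ge1}p_k(\mu_kV-kC)$$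 over all choices of $(p,x,y,z,q,I)$ as in (a)--(d) that satisfy (IC). \textbf{Theorem.} If $(\lambda,\mu)$ is regular, then $[P]$ has an optimal solution $(p,x,y,z,q,I)$ such that (i) $(x,y,z)$ is a cutoff policy: there is $K\in\mathbb Z_+\cup\{\infty\}$ such that $x_k=1$ for $k\le K-2$, $x_{K-1}\in(0,1]$ (if $1\le K<\infty$), $x_k=0$ for $k\ge K$, and $y_{k,\ell}=z_{k,\ell}=0$ for all $k,\ell$; (ii) $q$ is first-come-first-served: $q_{k,\ell}=\mu_\ell-\mu_{\ell-1}$ for $1\le\ell\le k$; (iii) $I$ is the no-information rule: for every $t$, $I^t$ is concentrated on the single belief given by the conditional distribution in (d), i.e. agents learn nothing beyond the recommendations to join and to stay (no requirement if nobody ever joins). -/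

import Mathlib

open MeasureTheory
open scoped ENNReal NNReal

noncomputable section

namespace QueueDesign

/-- A primitive process: Poisson arrival rates `lam k` and maximal service rates `mu k`, both
depending on the current queue length `k`, with the standing assumptions of the model. -/
structure PrimitiveProcess where
  lam : ℕ → ℝ
  mu : ℕ → ℝ
  lam_nonneg : ∀ k, 0 ≤ lam k
  lam_zero_pos : 0 < lam 0
  mu_zero : mu 0 = 0
  mu_pos : ∀ k, 1 ≤ k → 0 < mu k
  mu_mono : Monotone mu
  mu_bounded : ∃ B, ∀ k, mu k ≤ B

/-- The service process is regular: `μ_k - μ_{k-1}` (`k ≥ 1`) is nonincreasing in `k`. -/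
def PrimitiveProcess.ServiceRegular (P : PrimitiveProcess) : Prop :=
  ∀ k, P.mu (k + 2) - P.mu (k + 1) ≤ P.mu (k + 1) - P.mu k

/-- The primitive process is regular: the service process is regular, and
`λ_k - λ_{k-1} ≤ μ_k - μ_{k-1}` for each `k ≥ 2`. -/
def PrimitiveProcess.IsRegular (P : PrimitiveProcess) : Prop :=
  P.ServiceRegular ∧
    ∀ k, 2 ≤ k → P.lam k - P.lam (k - 1) ≤ P.mu k - P.mu (k - 1)

/-- Payoff parameters: net surplus `V` from service, waiting cost `C` per unit of time, profit `R`
per agent served, and the weight `α` of the agents in the objective. -/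
structure Payoffs where
  V : ℝ
  C : ℝ
  R : ℝ
  α : ℝ
  V_pos : 0 < V
  C_pos : 0 < C
  R_pos : 0 < R
  α_nonneg : 0 ≤ α
  α_le_one : α ≤ 1

/-- An entry/exit rule `(x, y, z)` together with a queueing rule `q`. Positions are numbered from
`1`, so that only the entries `y k ℓ`, `z k ℓ`, `q k ℓ` with `1 ≤ ℓ ≤ k` matter. -/
structure Policy where
  /-- probability that an agent who arrives at a queue of length `k` is asked to join -/
  x : ℕ → ℝ
  /-- rate at which the agent in position `ℓ` is removed from a queue of length `k` -/
  y : ℕ → ℕ → ℝ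
  /-- probability that the agent in position `ℓ` of a queue of length `k` is removed when another
  agent joins -/
  z : ℕ → ℕ → ℝ
  /-- rate at which the agent in position `ℓ` of a queue of length `k` is served -/
  q : ℕ → ℕ → ℝ

/-- Total removal rate `∑_ℓ y_{k,ℓ}`. -/
def Policy.ySum (π : Policy) (k : ℕ) : ℝ := ∑ ℓ ∈ Finset.Icc 1 k, π.y k ℓ

/-- Total removal probability upon a new entry, `∑_ℓ z_{k,ℓ}`. -/
def Policy.zSum (π : Policy) (k : ℕ) : ℝ := ∑ ℓ ∈ Finset.Icc 1 k, π.z k ℓ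

/-- Feasibility of the entry/exit rule. At most one agent is removed upon a new entry, so the
probabilities `z_{k,ℓ}` add up to at most one. -/
structure Policy.EntryExitFeasible (π : Policy) : Prop where
  x_mem : ∀ k, π.x k ∈ Set.Icc (0 : ℝ) 1
  y_nonneg : ∀ k, ∀ ℓ ∈ Finset.Icc 1 k, 0 ≤ π.y k ℓ
  z_nonneg : ∀ k, ∀ ℓ ∈ Finset.Icc 1 k, 0 ≤ π.z k ℓ
  z_sum_le : ∀ k, π.zSum k ≤ 1

/-- Feasible, work-conserving queueing rules. -/
structure Policy.QueueingFeasible (P : PrimitiveProcess) (π : Policy) : Prop where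
  q_nonneg : ∀ k, ∀ ℓ ∈ Finset.Icc 1 k, 0 ≤ π.q k ℓ
  capacity : ∀ k, ∀ S ⊆ Finset.Icc 1 k, ∑ ℓ ∈ S, π.q k ℓ ≤ P.mu S.card
  work_conserving : ∀ k, ∑ ℓ ∈ Finset.Icc 1 k, π.q k ℓ = P.mu k

/-- `p` is a probability distribution on queue lengths that satisfies the balance equation. -/
structure IsInvariant (P : PrimitiveProcess) (π : Policy) (p : ℕ → ℝ) : Prop where
  nonneg : ∀ k, 0 ≤ p k
  hasSum_one : HasSum p 1
  balance : ∀ k, P.lam k * π.x k * (1 - π.zSum k) * p k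
    = (P.mu (k + 1) + π.ySum (k + 1)) * p (k + 1)

/-! ### The process followed by an agent who has joined the queue -/

/-- The situation of an agent who has joined: in position `ℓ` of a queue of length `k` (herself
included), or gone, after having been served or removed. -/
inductive AgentState where
  | inQueue (k ℓ : ℕ)
  | served
  | removed

open Classical in
/-- Indicator of `a = b`. -/
def ind {α : Type} (a b : α) : ℝ≥0∞ := if a = b then 1 else 0

/-- New situation of the agent in position `ℓ` after the agent in position `j` has left, when the
queue length is then `k'`; `out` says where the agent goes if she is the one who leaves. -/
def afterLeave (k' ℓ j : ℕ) (out : AgentState) : AgentState :=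
  if j = ℓ then out else if j < ℓ then .inQueue k' (ℓ - 1) else .inQueue k' ℓ

/-- Rates of the events that take the agent from situation `a` to situation `b`: entries without
removal, entries with removal of the agent in position `j`, services and removals of the agent in
position `j`. (An event may leave `a` unchanged; this does not affect the law of the process.) -/
def jumpRate (P : PrimitiveProcess) (π : Policy) : AgentState → AgentState → ℝ≥0∞
  | .inQueue k ℓ, b =>
      ENNReal.ofReal (P.lam k * π.x k * (1 - π.zSum k)) * ind (.inQueue (k + 1) ℓ) b
      + ∑ j ∈ Finset.Icc 1 k,
          (ENNReal.ofReal (P.lam k * π.x k * π.z k j) * ind (afterLeave k ℓ j .removed) b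
          + ENNReal.ofReal (π.q k j) * ind (afterLeave (k - 1) ℓ j .served) b
          + ENNReal.ofReal (π.y k j) * ind (afterLeave (k - 1) ℓ j .removed) b)
  | .served, _ => 0
  | .removed, _ => 0

/-- Total rate of the events in situation `a`. -/
def exitRate (P : PrimitiveProcess) (π : Policy) (a : AgentState) : ℝ :=
  (∑' b, jumpRate P π a b).toReal

/-- Probability that an agent in situation `a` is in situation `b` after time `t ≥ 0`, and that
exactly `n` events have occurred meanwhile. -/
def transProbN (P : PrimitiveProcess) (π : Policy) : ℕ → ℝ → AgentState → AgentState → ℝ≥0∞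
  | 0, t, a, b => ENNReal.ofReal (Real.exp (-(exitRate P π a * t))) * ind a b
  | n + 1, t, a, b =>
      ∫⁻ u in Set.Ioc 0 t, ENNReal.ofReal (Real.exp (-(exitRate P π a * u)))
        * ∑' c, jumpRate P π a c * transProbN P π n (t - u) c b

/-- Transition probabilities of the continuous-time Markov chain with the given rates (the minimal
transition function of Feller). -/
def transProb (P : PrimitiveProcess) (π : Policy) (t : ℝ) (a b : AgentState) : ℝ≥0∞ :=
  ∑' n, transProbN P π n t a b

/-- `σ_{k,ℓ}`: probability that the agent will eventually be served. -/
def serviceProb (P : PrimitiveProcess) (π : Policy) (k ℓ : ℕ) : ℝ≥0∞ :=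
  ⨆ t : ℝ≥0, transProb P π t (.inQueue k ℓ) .served

/-- `τ_{k,ℓ} ∈ [0,∞]`: expected time that the agent will still spend in the queue, that is the
integral over `t ≥ 0` of the probability of being in the queue after a further time `t`. -/
def waitTime (P : PrimitiveProcess) (π : Policy) (k ℓ : ℕ) : ℝ≥0∞ :=
  ∫⁻ t in Set.Ioi (0 : ℝ), ∑' s : ℕ × ℕ, transProb P π t (.inQueue k ℓ) (.inQueue s.1 s.2)

/-! ### Beliefs and information -/

/-- Beliefs about (queue length, position). The topology and the σ-algebra are those of the
coordinates; on probability vectors this is the topology of weak convergence. -/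
abbrev Belief : Type := {γ : ℕ × ℕ → ℝ≥0∞ // ∑' s, γ s = 1}

/-- Steady-state rate at which agents join the queue and start at (length, position) `s`. If the
length was `i`, they start at `(i + 1, i + 1)`, or at `(i, i)` if another agent is removed. -/
def entryFlow (P : PrimitiveProcess) (π : Policy) (p : ℕ → ℝ) (s : ℕ × ℕ) : ℝ≥0∞ :=
  ∑' i : ℕ, (ENNReal.ofReal (p i * P.lam i * π.x i * (1 - π.zSum i)) * ind (i + 1, i + 1) s
    + ENNReal.ofReal (p i * P.lam i * π.x i * π.zSum i) * ind (i, i) s)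

/-- Steady-state rate of agents who are at (length, position) `s` when they have spent time `t`
in the queue. -/
def stayFlow (P : PrimitiveProcess) (π : Policy) (p : ℕ → ℝ) (t : ℝ) (s : ℕ × ℕ) : ℝ≥0∞ :=
  ∑' s₀ : ℕ × ℕ,
    entryFlow P π p s₀ * transProb P π t (.inQueue s₀.1 s₀.2) (.inQueue s.1 s.2)

/-- Steady-state rate of agents who reach time `t` in the queue. -/
def stayMass (P : PrimitiveProcess) (π : Policy) (p : ℕ → ℝ) (t : ℝ) : ℝ≥0∞ :=
  ∑' s, stayFlow P π p t s

/-- Distribution of (length, position) conditional on having spent time `t` in the queue: what an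
agent believes, by Bayes' rule, who is told nothing but to join and to stay. -/
def bayesBelief (P : PrimitiveProcess) (π : Policy) (p : ℕ → ℝ) (t : ℝ) (s : ℕ × ℕ) : ℝ≥0∞ :=
  stayFlow P π p t s / stayMass P π p t

/-- An information rule: for every time `t` spent in the queue, a distribution of beliefs. -/
abbrev InfoRule : Type := ℝ≥0 → ProbabilityMeasure Belief

/-- Feasible information rules: the beliefs at time `t` are posteriors, by Bayes' rule, from some
signal about the situation at time `t`; i.e. they average to the distribution of the situation
conditional on having spent time `t` in the queue. Nothing is required if there is no such agent. -/
def InfoFeasible (P : PrimitiveProcess) (π : Policy) (p : ℕ → ℝ) (I : InfoRule) : Prop :=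
  ∀ t : ℝ≥0, 0 < stayMass P π p t →
    ∀ s, ∫⁻ γ : Belief, γ.1 s ∂(I t : Measure Belief) = bayesBelief P π p t s

/-- The no-information rule: at every `t` the belief is degenerate on the Bayes update. -/
def IsNoInformation (P : PrimitiveProcess) (π : Policy) (p : ℕ → ℝ) (I : InfoRule) : Prop :=
  ∀ t : ℝ≥0, 0 < stayMass P π p t →
    ∃ γ : Belief, (∀ s, γ.1 s = bayesBelief P π p t s) ∧
      (I t : Measure Belief) = Measure.dirac γ

/-- The obedience constraint `∑ γ_{k,ℓ} (V σ_{k,ℓ} - C τ_{k,ℓ}) ≥ 0`, for every `t ≥ 0` and every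
belief `γ` in the support of `I t`. As `σ` is bounded, the sum is well defined in `[-∞, ∞)`, and
it is nonnegative iff the inequality below holds in `[0, ∞]`. -/
def IncentiveCompatible (P : PrimitiveProcess) (w : Payoffs) (π : Policy) (p : ℕ → ℝ)
    (I : InfoRule) : Prop :=
  ∀ t : ℝ≥0, 0 < stayMass P π p t → ∀ γ ∈ (I t : Measure Belief).support,
    ENNReal.ofReal w.C * ∑' s : ℕ × ℕ, γ.1 s * waitTime P π s.1 s.2
      ≤ ENNReal.ofReal w.V * ∑' s : ℕ × ℕ, γ.1 s * serviceProb P π s.1 s.2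

/-! ### The designer's problem -/

/-- A choice of the designer: a distribution `p` of the queue length, an entry/exit rule and a
queueing rule, and an information rule. -/
structure Design where
  p : ℕ → ℝ
  π : Policy
  I : InfoRule

/-- The feasible choices. -/
structure IsFeasible (P : PrimitiveProcess) (w : Payoffs) (d : Design) : Prop where
  entryExit : d.π.EntryExitFeasible
  queueing : d.π.QueueingFeasible P
  invariant : IsInvariant P d.π d.p
  info : InfoFeasible P d.π d.p d.I
  obedience : IncentiveCompatible P w d.π d.p d.I

/-- Flow of services `∑ p_k μ_k`. -/
def serviceFlow (P : PrimitiveProcess) (p : ℕ → ℝ) : ℝ≥0∞ :=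
  ∑' k, ENNReal.ofReal (p k * P.mu k)

/-- Mean queue length `∑ p_k k`, possibly infinite. -/
def meanLength (p : ℕ → ℝ) : ℝ≥0∞ := ∑' k : ℕ, ENNReal.ofReal (p k * k)

/-- The objective `(1-α) R ∑ p_k μ_k + α ∑ p_k (μ_k V - k C)`, with value `-∞` for an infinite mean
queue length if `α > 0`. -/
def objective (P : PrimitiveProcess) (w : Payoffs) (p : ℕ → ℝ) : EReal :=
  (((1 - w.α) * w.R : ℝ) : EReal) * (serviceFlow P p : EReal)
    + (w.α : EReal) *
      ((w.V : EReal) * (serviceFlow P p : EReal) - (w.C : EReal) * (meanLength p : EReal))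

/-- The design attains the supremum of the objective over all feasible designs. -/
def IsOptimal (P : PrimitiveProcess) (w : Payoffs) (d : Design) : Prop :=
  IsFeasible P w d ∧ ∀ d', IsFeasible P w d' → objective P w d'.p ≤ objective P w d.p

/-- Cutoff policies, with cutoff `K` in `{0, 1, …, ∞}`. -/
def Policy.IsCutoff (π : Policy) : Prop :=
  (∃ K : ℕ∞, (∀ k : ℕ, (k : ℕ∞) + 1 < K → π.x k = 1) ∧
      (∀ k : ℕ, (k : ℕ∞) + 1 = K → 0 < π.x k ∧ π.x k ≤ 1) ∧
      (∀ k : ℕ, K ≤ (k : ℕ∞) → π.x k = 0)) ∧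
    ∀ k ℓ, π.y k ℓ = 0 ∧ π.z k ℓ = 0

/-- First come, first served: `q_{k,ℓ} = μ_ℓ - μ_{ℓ-1}`. -/
def Policy.IsFCFS (P : PrimitiveProcess) (π : Policy) : Prop :=
  ∀ k, ∀ ℓ ∈ Finset.Icc 1 k, π.q k ℓ = P.mu ℓ - P.mu (ℓ - 1)

end QueueDesign

end

namespace QueueDesign

open Filter Topology

/-! ### Rates and their row sums -/

/-! The payoff depends on a design only through the law `p` of the queue length. The proof bounds it
by a relaxed problem in `p` alone and then exhibits a design of the required form that attains the
bound.

Relaxation. Forgetting the removals turns balance into the inequality μ_{k+1} p_{k+1} ≤ λ_k p_k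
(`IsAttainable`). Of obedience only its average over beliefs at time 0 is kept. Whichever positions
are served or removed, the measure that puts mass p_k on each position of a queue of length k
balances the entry flow. Hence the time spent at length k by all entrants adds up to k p_k, which is
Little's law (`tsum_entryFlow_mul_waitTime`), and the averaged constraint becomes C ∑ k p_k ≤ V ∑
μ_k p_k (`IsFeasible.meanLength_le`).

Solution of the relaxed problem. The ratio of an attainable `p` to the weights under full entry is
nonincreasing. Subtracting from `p` a cutoff law with the same service flow leaves a signed measure
with sign pattern +, -, + (up to one index), and concavity of μ shows that the cutoff law has the
smaller mean (`mean_nonneg_of_crossing`, `IsAttainable.cutMean_id_le`). A shorter queue at equal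
service flow helps both the payoff and the constraint. Such a cutoff exists by the intermediate
value theorem, unless `p` is already the law under full entry (`IsAttainable.exists_cutMean_eq`). A
best cutoff, possibly infinite, exists by compactness and a limit at infinity
(`exists_optimal_cutoff`).

Attainment. Under first come, first served the position of an agent is a Markov chain by itself. At
position ℓ the remaining wait is at most ℓ/μ_ℓ, which is nondecreasing in ℓ by concavity, and
service is certain. At entry, obedience follows from the relaxed constraint. For later times,
balance transposes the one-step operator of the position chain into an operator on densities with
respect to the entry flow, and regularity makes the latter preserve decreasing densities
(`antitone_dualStep`). Time in the queue therefore shifts weight to the front, where cost is low,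
and a rearrangement inequality (`tsum_mul_le_of_antitone`) carries obedience from time 0 to every
`t` (`tsum_stayFlow_mul_waitTime_le`). -/

lemma tsum_ind_mul {β : Type} (a : β) (g : β → ℝ≥0∞) : ∑' b, ind a b * g b = g a := by
  rw [tsum_eq_single a]
  · simp [ind]
  · intro b hb
    simp [ind, hb.symm]

lemma tsum_mul_ind {β : Type} (b : β) (g : β → ℝ≥0∞) : ∑' a, g a * ind a b = g b := by
  rw [tsum_eq_single b]
  · simp [ind]
  · intro a ha
    simp [ind, ha]

/-- The generator applied to a test function, event by event. Every later computation with rates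
goes through this form. -/
lemma tsum_jumpRate_mul (P : PrimitiveProcess) (π : Policy) (k ℓ : ℕ) (g : AgentState → ℝ≥0∞) :
    ∑' b, jumpRate P π (.inQueue k ℓ) b * g b
      = ENNReal.ofReal (P.lam k * π.x k * (1 - π.zSum k)) * g (.inQueue (k + 1) ℓ)
      + ∑ j ∈ Finset.Icc 1 k,
          (ENNReal.ofReal (P.lam k * π.x k * π.z k j) * g (afterLeave k ℓ j .removed)
          + ENNReal.ofReal (π.q k j) * g (afterLeave (k - 1) ℓ j .served)
          + ENNReal.ofReal (π.y k j) * g (afterLeave (k - 1) ℓ j .removed)) := by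
  simp only [jumpRate, add_mul, Finset.sum_mul]
  rw [ENNReal.tsum_add, Summable.tsum_finsetSum (fun _ _ => ENNReal.summable)]
  simp only [ENNReal.tsum_add, mul_assoc, ENNReal.tsum_mul_left, tsum_ind_mul]

/-- Total rate of the events in situation `a`, as an extended nonnegative number. -/
noncomputable def totalRate (P : PrimitiveProcess) (π : Policy) (a : AgentState) : ℝ≥0∞ :=
  ∑' b, jumpRate P π a b

lemma totalRate_inQueue (P : PrimitiveProcess) (π : Policy) (k ℓ : ℕ) :
    totalRate P π (.inQueue k ℓ)
      = ENNReal.ofReal (P.lam k * π.x k * (1 - π.zSum k))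
      + ∑ j ∈ Finset.Icc 1 k,
          (ENNReal.ofReal (P.lam k * π.x k * π.z k j) + ENNReal.ofReal (π.q k j)
          + ENNReal.ofReal (π.y k j)) := by
  simpa [totalRate] using tsum_jumpRate_mul P π k ℓ (fun _ => 1)

lemma totalRate_ne_top (P : PrimitiveProcess) (π : Policy) (a : AgentState) :
    totalRate P π a ≠ ⊤ := by
  cases a with
  | inQueue k ℓ =>
    rw [totalRate_inQueue]
    simp [ENNReal.sum_eq_top]
  | served => simp [totalRate, jumpRate]
  | removed => simp [totalRate, jumpRate]

lemma exitRate_nonneg (P : PrimitiveProcess) (π : Policy) (a : AgentState) :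
    0 ≤ exitRate P π a := ENNReal.toReal_nonneg

lemma ofReal_exitRate (P : PrimitiveProcess) (π : Policy) (a : AgentState) :
    ENNReal.ofReal (exitRate P π a) = totalRate P π a :=
  ENNReal.ofReal_toReal (totalRate_ne_top P π a)

/-- The situation of an agent in the queue, as a function of the pair (length, position). -/
def queued (s : ℕ × ℕ) : AgentState := .inQueue s.1 s.2

lemma queued_injective : Function.Injective queued := by
  rintro ⟨a, b⟩ ⟨c, d⟩ h
  simpa [queued] using h

lemma tsum_eq_tsum_queued {g : AgentState → ℝ≥0∞} (hs : g .served = 0) (hr : g .removed = 0) :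
    ∑' a, g a = ∑' s, g (queued s) := by
  refine (queued_injective.tsum_eq ?_).symm
  intro a ha
  cases a with
  | inQueue k ℓ => exact ⟨(k, ℓ), rfl⟩
  | served => exact absurd hs ha
  | removed => exact absurd hr ha

/-- Agent situations as an option type over pairs. -/
def agentStateCode : AgentState → (ℕ × ℕ) ⊕ Bool
  | .inQueue k ℓ => .inl (k, ℓ)
  | .served => .inr true
  | .removed => .inr false

instance : Countable AgentState := by
  refine Function.Injective.countable (f := agentStateCode) ?_
  intro a b h
  cases a <;> cases b <;> simp_all [agentStateCode]

/-! ### Measurability in time -/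

lemma measurable_setLIntegral_Ioc_convolution {f g : ℝ → ℝ≥0∞} (hf : Measurable f)
    (hg : Measurable g) : Measurable fun t => ∫⁻ u in Set.Ioc 0 t, f u * g (t - u) := by
  have h : ∀ t : ℝ, ∫⁻ u in Set.Ioc 0 t, f u * g (t - u)
      = ∫⁻ u, {q : ℝ × ℝ | 0 < q.2 ∧ q.2 ≤ q.1}.indicator
          (fun q => f q.2 * g (q.1 - q.2)) (t, u) := by
    intro t
    rw [← lintegral_indicator measurableSet_Ioc]
    rfl
  simp_rw [h]
  refine Measurable.lintegral_prod_right' (f := {q : ℝ × ℝ | 0 < q.2 ∧ q.2 ≤ q.1}.indicator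
          (fun q => f q.2 * g (q.1 - q.2))) ?_
  refine Measurable.indicator (by fun_prop) ?_
  exact (measurableSet_lt measurable_const measurable_snd).inter
    (measurableSet_le measurable_snd measurable_fst)

lemma measurable_expFactor (x : ℝ) :
    Measurable fun u : ℝ => ENNReal.ofReal (Real.exp (-(x * u))) := by fun_prop

lemma measurable_transProbN (P : PrimitiveProcess) (π : Policy) (n : ℕ) (a b : AgentState) :
    Measurable fun t => transProbN P π n t a b := by
  induction n generalizing a with
  | zero =>
    simp only [transProbN]
    fun_prop
  | succ n ih =>
    simp only [transProbN]
    refine measurable_setLIntegral_Ioc_convolution (measurable_expFactor _)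
      (g := fun t => ∑' c, jumpRate P π a c * transProbN P π n t c b) ?_
    exact Measurable.tsum fun c => (ih c).const_mul _

/-! ### Integration over time -/

lemma lintegral_expFactor {x : ℝ} (hx : 0 ≤ x) :
    ∫⁻ u in Set.Ioi (0 : ℝ), ENNReal.ofReal (Real.exp (-(x * u))) = (ENNReal.ofReal x)⁻¹ := by
  rcases hx.eq_or_lt with rfl | hx
  · simp
  · have h1 := integral_exp_mul_Ioi (a := -x) (by linarith) 0
    have h2 := integrableOn_exp_mul_Ioi (a := -x) (by linarith) 0
    rw [← ENNReal.ofReal_inv_of_pos hx]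
    simp only [neg_mul, mul_zero, Real.exp_zero] at h1 h2
    rw [← ofReal_integral_eq_lintegral_ofReal h2 (by filter_upwards with u; positivity), h1]
    congr 1
    field_simp

lemma lintegral_Ioi_convolution {f g : ℝ → ℝ≥0∞} (hf : Measurable f) (hg : Measurable g) :
    ∫⁻ t in Set.Ioi (0 : ℝ), ∫⁻ u in Set.Ioc 0 t, f u * g (t - u)
      = (∫⁻ u in Set.Ioi (0 : ℝ), f u) * ∫⁻ t in Set.Ioi (0 : ℝ), g t := by
  -- Cutting `g` to [0, ∞) lets `u` range over all of (0, ∞), so that Tonelli and translation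
  -- invariance apply. For t ≤ 0 both sides vanish.
  have h : ∀ t : ℝ, (Set.Ioi (0 : ℝ)).indicator
      (fun t => ∫⁻ u in Set.Ioc 0 t, f u * g (t - u)) t
      = ∫⁻ u in Set.Ioi (0 : ℝ), f u * (Set.Ici (0 : ℝ)).indicator g (t - u) := by
    intro t
    rw [← lintegral_indicator measurableSet_Ioi]
    by_cases ht : 0 < t
    · rw [Set.indicator_of_mem (by exact ht), ← lintegral_indicator measurableSet_Ioc]
      congr 1 with u
      by_cases hu : 0 < u <;> by_cases hut : u ≤ t <;> simp [Set.indicator, hu, hut]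
    · rw [Set.indicator_of_notMem (by exact ht)]
      symm
      rw [lintegral_eq_zero_iff' (by
        refine AEMeasurable.indicator ?_ measurableSet_Ioi
        exact (hf.mul ((hg.indicator measurableSet_Ici).comp
          (measurable_const.sub measurable_id))).aemeasurable)]
      filter_upwards with u
      by_cases hu : 0 < u
      · have : ¬ u ≤ t := by linarith
        simp [Set.indicator, this]
      · simp [Set.indicator, hu]
  rw [← lintegral_indicator measurableSet_Ioi, lintegral_congr h, lintegral_lintegral_swap]
  · have h2 : ∀ u : ℝ, ∫⁻ t, f u * (Set.Ici (0 : ℝ)).indicator g (t - u)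
        = f u * ∫⁻ t in Set.Ioi (0 : ℝ), g t := by
      intro u
      have hm : Measurable fun t : ℝ => (Set.Ici (0 : ℝ)).indicator g (t - u) :=
        (hg.indicator measurableSet_Ici).comp (measurable_id.sub measurable_const)
      rw [lintegral_const_mul _ hm]
      congr 1
      rw [lintegral_sub_right_eq_self ((Set.Ici (0 : ℝ)).indicator g) u,
        lintegral_indicator measurableSet_Ici]
      exact setLIntegral_congr Ioi_ae_eq_Ici.symm
    simp_rw [h2]
    rw [lintegral_mul_const _ hf]
  · refine Measurable.aemeasurable ?_
    exact (hf.comp measurable_snd).mul ((hg.indicator measurableSet_Ici).comp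
      (measurable_fst.sub measurable_snd))

/-- Expected time spent in situation `b` after exactly `n` events. -/
noncomputable def greenN (P : PrimitiveProcess) (π : Policy) (n : ℕ) (a b : AgentState) : ℝ≥0∞ :=
  ∫⁻ t in Set.Ioi (0 : ℝ), transProbN P π n t a b

/-- Valid for absorbing situations too: a zero rate has inverse `⊤`, the infinite time spent there.
-/
lemma greenN_zero (P : PrimitiveProcess) (π : Policy) (a b : AgentState) :
    greenN P π 0 a b = (totalRate P π a)⁻¹ * ind a b := by
  simp only [greenN, transProbN]
  rw [lintegral_mul_const _ (measurable_expFactor _), lintegral_expFactor (exitRate_nonneg P π a),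
    ofReal_exitRate]

lemma greenN_succ (P : PrimitiveProcess) (π : Policy) (n : ℕ) (a b : AgentState) :
    greenN P π (n + 1) a b
      = (totalRate P π a)⁻¹ * ∑' c, jumpRate P π a c * greenN P π n c b := by
  simp only [greenN, transProbN]
  rw [lintegral_Ioi_convolution (measurable_expFactor _)
    (g := fun t => ∑' c, jumpRate P π a c * transProbN P π n t c b)
    (Measurable.tsum fun c => (measurable_transProbN P π n c b).const_mul _),
    lintegral_expFactor (exitRate_nonneg P π a), ofReal_exitRate,
    lintegral_tsum fun c => ((measurable_transProbN P π n c b).const_mul _).aemeasurable]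
  simp_rw [lintegral_const_mul _ (measurable_transProbN P π n _ b)]

lemma waitTime_eq (P : PrimitiveProcess) (π : Policy) (k ℓ : ℕ) :
    waitTime P π k ℓ = ∑' n, ∑' s, greenN P π n (.inQueue k ℓ) (queued s) := by
  simp only [waitTime, transProb, greenN]
  rw [lintegral_tsum fun s => (Measurable.tsum fun n =>
    measurable_transProbN P π n _ _).aemeasurable, ENNReal.tsum_comm]
  refine tsum_congr fun s => ?_
  rw [lintegral_tsum fun n => (measurable_transProbN P π n _ _).aemeasurable]
  rfl

/-! ### Absorbed situations -/

lemma transProbN_served_queued (P : PrimitiveProcess) (π : Policy) (n : ℕ) (t : ℝ) (s : ℕ × ℕ) :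
    transProbN P π n t .served (queued s) = 0 := by
  cases n <;> simp [transProbN, jumpRate, ind, queued]

lemma transProbN_removed_queued (P : PrimitiveProcess) (π : Policy) (n : ℕ) (t : ℝ) (s : ℕ × ℕ) :
    transProbN P π n t .removed (queued s) = 0 := by
  cases n <;> simp [transProbN, jumpRate, ind, queued]

lemma transProb_zero (P : PrimitiveProcess) (π : Policy) (a b : AgentState) :
    transProb P π 0 a b = ind a b := by
  rw [transProb, tsum_eq_single 0]
  · simp [transProbN]
  · intro n hn
    obtain ⟨m, rfl⟩ := Nat.exists_eq_succ_of_ne_zero hn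
    simp [transProbN]


/-! ### Expected occupation of the agents who enter with a given flow -/

lemma greenN_succ_queued (P : PrimitiveProcess) (π : Policy) (n : ℕ) (a : AgentState)
    (b : ℕ × ℕ) :
    greenN P π (n + 1) a (queued b) = (totalRate P π a)⁻¹ *
      ∑' c, jumpRate P π a (queued c) * greenN P π n (queued c) (queued b) := by
  rw [greenN_succ, tsum_eq_tsum_queued] <;>
    simp [greenN, transProbN_served_queued, transProbN_removed_queued]

/-- `greenN` is defined by splitting off the first event; here the last one is split off. This
forward form is what lets an entry flow be pushed through the chain. -/
lemma greenN_succ_right (P : PrimitiveProcess) (π : Policy) (n : ℕ) (a b : ℕ × ℕ) :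
    greenN P π (n + 1) (queued a) (queued b)
      = (∑' c, greenN P π n (queued a) (queued c) * jumpRate P π (queued c) (queued b))
        * (totalRate P π (queued b))⁻¹ := by
  induction n generalizing a with
  | zero =>
    rw [greenN_succ_queued]
    simp only [greenN_zero]
    have h1 : ∀ c, jumpRate P π (queued a) (queued c)
          * ((totalRate P π (queued c))⁻¹ * ind (queued c) (queued b))
        = (jumpRate P π (queued a) (queued c) * (totalRate P π (queued c))⁻¹) * ind c b := by
      intro c
      simp [ind, queued_injective.eq_iff]
    have h2 : ∀ c, (totalRate P π (queued a))⁻¹ * ind (queued a) (queued c)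
          * jumpRate P π (queued c) (queued b)
        = ind a c * ((totalRate P π (queued a))⁻¹ * jumpRate P π (queued c) (queued b)) := by
      intro c
      simp only [ind, queued_injective.eq_iff]
      ring_nf
    simp_rw [h1, h2, tsum_mul_ind, tsum_ind_mul]
    ring
  | succ n ih =>
    rw [greenN_succ_queued]
    simp_rw [ih, greenN_succ_queued P π n (queued a), ← ENNReal.tsum_mul_left,
      ← ENNReal.tsum_mul_right, ← ENNReal.tsum_mul_left]
    rw [ENNReal.tsum_comm]
    refine tsum_congr fun c => tsum_congr fun d => ?_
    ring

/-- Occupation of situation `b` after exactly `n` events, for agents who enter with flow `e`. -/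
noncomputable def occupationN (P : PrimitiveProcess) (π : Policy) (e : ℕ × ℕ → ℝ≥0∞) (n : ℕ)
    (b : ℕ × ℕ) : ℝ≥0∞ :=
  ∑' s, e s * greenN P π n (queued s) (queued b)

/-- Occupation of situation `b` by agents who enter with flow `e`. -/
noncomputable def occupation (P : PrimitiveProcess) (π : Policy) (e : ℕ × ℕ → ℝ≥0∞)
    (b : ℕ × ℕ) : ℝ≥0∞ :=
  ∑' n, occupationN P π e n b

lemma occupationN_zero (P : PrimitiveProcess) (π : Policy) (e : ℕ × ℕ → ℝ≥0∞) (b : ℕ × ℕ) :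
    occupationN P π e 0 b = e b * (totalRate P π (queued b))⁻¹ := by
  have h : ∀ s, e s * greenN P π 0 (queued s) (queued b)
      = (e s * (totalRate P π (queued s))⁻¹) * ind s b := by
    intro s
    rw [greenN_zero]
    simp [ind, queued_injective.eq_iff]
  simp_rw [occupationN, h, tsum_mul_ind]

lemma occupationN_succ (P : PrimitiveProcess) (π : Policy) (e : ℕ × ℕ → ℝ≥0∞) (n : ℕ)
    (b : ℕ × ℕ) :
    occupationN P π e (n + 1) b
      = (∑' c, occupationN P π e n c * jumpRate P π (queued c) (queued b))
        * (totalRate P π (queued b))⁻¹ := by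
  simp_rw [occupationN, greenN_succ_right, ← ENNReal.tsum_mul_right, ← ENNReal.tsum_mul_left]
  rw [ENNReal.tsum_comm]
  refine tsum_congr fun c => tsum_congr fun d => ?_
  ring

lemma occupation_eq (P : PrimitiveProcess) (π : Policy) (e : ℕ × ℕ → ℝ≥0∞) (b : ℕ × ℕ) :
    occupation P π e b
      = (e b + ∑' c, occupation P π e c * jumpRate P π (queued c) (queued b))
        * (totalRate P π (queued b))⁻¹ := by
  rw [occupation, tsum_eq_zero_add' ENNReal.summable, occupationN_zero, add_mul]
  simp_rw [occupationN_succ, ENNReal.tsum_mul_right]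
  congr 2
  rw [ENNReal.tsum_comm]
  simp_rw [ENNReal.tsum_mul_right]
  rfl

/-- The occupation measure is the limit of the iteration of the forward equation from 0, hence its
least supersolution: each partial sum stays below `m` by monotonicity. -/
lemma occupation_le (P : PrimitiveProcess) (π : Policy) (e m : ℕ × ℕ → ℝ≥0∞)
    (h : ∀ b, (e b + ∑' c, m c * jumpRate P π (queued c) (queued b))
        * (totalRate P π (queued b))⁻¹ ≤ m b) (b : ℕ × ℕ) :
    occupation P π e b ≤ m b := by
  rw [occupation, ENNReal.tsum_eq_iSup_nat]
  refine iSup_le fun N => ?_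
  induction N generalizing b with
  | zero => simp
  | succ N ih =>
    rw [Finset.sum_range_succ']
    simp_rw [occupationN_zero, occupationN_succ]
    rw [← Finset.sum_mul, ← add_mul, add_comm]
    refine le_trans ?_ (h b)
    gcongr
    rw [← Summable.tsum_finsetSum (fun _ _ => ENNReal.summable)]
    refine ENNReal.tsum_le_tsum fun c => ?_
    rw [← Finset.sum_mul]
    gcongr
    exact ih c

lemma tsum_mul_waitTime (P : PrimitiveProcess) (π : Policy) (e : ℕ × ℕ → ℝ≥0∞) :
    ∑' s, e s * waitTime P π s.1 s.2 = ∑' b, occupation P π e b := by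
  simp_rw [waitTime_eq, occupation, occupationN, ← ENNReal.tsum_mul_left]
  rw [ENNReal.tsum_comm]
  conv_rhs => rw [ENNReal.tsum_comm]
  refine tsum_congr fun n => ?_
  rw [ENNReal.tsum_comm]
  rfl

/-- Probability of being served with the `n`-th event. -/
noncomputable def servedN (P : PrimitiveProcess) (π : Policy) : ℕ → AgentState → ℝ≥0∞
  | 0, a => ind a .served
  | n + 1, a => (totalRate P π a)⁻¹ * ∑' c, jumpRate P π a c * servedN P π n c

/-- `servedN` belongs to the embedded jump chain, which ignores the clock. Dropping the deadline `t`
can only increase the probability. -/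
lemma transProbN_served_le (P : PrimitiveProcess) (π : Policy) (n : ℕ) (t : ℝ) (ht : 0 ≤ t)
    (a : AgentState) :
    transProbN P π n t a .served ≤ servedN P π n a := by
  induction n generalizing a t with
  | zero =>
    simp only [transProbN, servedN]
    refine mul_le_of_le_one_left (by positivity) ?_
    rw [ENNReal.ofReal_le_one, Real.exp_le_one_iff]
    have := mul_nonneg (exitRate_nonneg P π a) ht
    linarith
  | succ n ih =>
    simp only [transProbN, servedN]
    rw [← ofReal_exitRate, ← lintegral_expFactor (exitRate_nonneg P π a),
      ← lintegral_mul_const _ (measurable_expFactor _)]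
    calc _ ≤ ∫⁻ u in Set.Ioc 0 t, ENNReal.ofReal (Real.exp (-(exitRate P π a * u))) *
          ∑' c, jumpRate P π a c * servedN P π n c := by
          refine setLIntegral_mono' measurableSet_Ioc fun u hu => ?_
          gcongr with c
          exact ih _ (by linarith [hu.2]) c
      _ ≤ _ := lintegral_mono_set Set.Ioc_subset_Ioi_self

lemma servedN_succ_queued (P : PrimitiveProcess) (π : Policy) (n : ℕ) (s : ℕ × ℕ) :
    servedN P π (n + 1) (queued s)
      = ∑' b, greenN P π n (queued s) (queued b) * jumpRate P π (queued b) .served := by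
  have hr : ∀ n, servedN P π n .removed = 0 := by
    intro n
    cases n <;> simp [servedN, ind, jumpRate]
  have hs : ∀ n, servedN P π (n + 1) .served = 0 := by
    intro n
    simp [servedN, jumpRate]
  induction n generalizing s with
  | zero =>
    simp only [servedN, tsum_mul_ind, greenN_zero]
    have h : ∀ b, (totalRate P π (queued s))⁻¹ * ind (queued s) (queued b)
        * jumpRate P π (queued b) .served
        = ind s b * ((totalRate P π (queued s))⁻¹ * jumpRate P π (queued b) .served) := by
      intro b
      simp only [ind, queued_injective.eq_iff]
      ring_nf
    simp_rw [h, tsum_ind_mul]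
  | succ n ih =>
    rw [servedN, tsum_eq_tsum_queued (by simp [hs]) (by simp [hr])]
    simp_rw [ih, greenN_succ_queued, ← ENNReal.tsum_mul_left, ← ENNReal.tsum_mul_right]
    rw [ENNReal.tsum_comm]
    refine tsum_congr fun c => tsum_congr fun d => ?_
    ring

/-- Being served means leaving some situation by a service event, and the expected number of such
events is occupation times rate. Only this direction is needed, since the constraint to be derived
has services on its larger side. -/
lemma tsum_mul_serviceProb_le (P : PrimitiveProcess) (π : Policy) (e : ℕ × ℕ → ℝ≥0∞) :
    ∑' s, e s * serviceProb P π s.1 s.2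
      ≤ ∑' b, occupation P π e b * jumpRate P π (queued b) .served := by
  have h : ∀ s : ℕ × ℕ, serviceProb P π s.1 s.2
      ≤ ∑' n, ∑' b, greenN P π n (queued s) (queued b) * jumpRate P π (queued b) .served := by
    intro s
    refine iSup_le fun t => ?_
    rw [transProb]
    refine (ENNReal.tsum_le_tsum fun n => transProbN_served_le P π n t t.2 _).trans ?_
    rw [tsum_eq_zero_add' ENNReal.summable]
    have h0 : servedN P π 0 (.inQueue s.1 s.2) = 0 := by simp [servedN, ind]
    rw [h0, zero_add]
    exact (tsum_congr fun n => servedN_succ_queued P π n s).le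
  refine (ENNReal.tsum_le_tsum fun s => mul_le_mul_right (h s) (e s)).trans ?_
  simp_rw [occupation, occupationN, ← ENNReal.tsum_mul_right, ← ENNReal.tsum_mul_left]
  rw [ENNReal.tsum_comm]
  conv_rhs => rw [ENNReal.tsum_comm]
  refine le_of_eq (tsum_congr fun n => ?_)
  rw [ENNReal.tsum_comm]
  refine tsum_congr fun c => tsum_congr fun d => ?_
  ring

/-! ### Column sums of the rates -/

/-- Whoever leaves, position ℓ is inherited from exactly one source: ℓ itself if the leaver stood
behind it, ℓ + 1 otherwise. The column sum thus does not depend on the leaver `j`, which is why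
Little's law below does not depend on the queueing discipline. -/
lemma sum_ind_afterLeave (k k' ℓ j : ℕ) (hj : j ∈ Finset.Icc 1 k) (out : AgentState)
    (hout : ∀ s, out ≠ queued s) (m : ℕ) :
    ∑ i ∈ Finset.Icc 1 k, ind (afterLeave k' i j out) (.inQueue m ℓ)
      = if k' = m ∧ 1 ≤ ℓ ∧ ℓ + 1 ≤ k then 1 else 0 := by
  have ho : out ≠ .inQueue m ℓ := hout (m, ℓ)
  rw [Finset.mem_Icc] at hj
  have key : ∀ i ∈ Finset.Icc 1 k, ind (afterLeave k' i j out) (.inQueue m ℓ)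
      = if i = (if ℓ < j then ℓ else ℓ + 1) then (if k' = m ∧ 1 ≤ ℓ then 1 else 0) else 0 := by
    intro i hi
    rw [Finset.mem_Icc] at hi
    have : (afterLeave k' i j out = .inQueue m ℓ) ↔
        (i = (if ℓ < j then ℓ else ℓ + 1) ∧ k' = m ∧ 1 ≤ ℓ) := by
      unfold afterLeave
      split_ifs with h1 h2 h3 h3 <;> simp only [ho, AgentState.inQueue.injEq, false_iff] <;> omega
    simp only [ind, this]
    split_ifs <;> first | rfl | (exfalso; tauto)
  rw [Finset.sum_congr rfl key, Finset.sum_ite_eq' ]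
  simp only [Finset.mem_Icc]
  split_ifs <;> first | rfl | (exfalso; omega)

/-- Rate of entries without removal. -/
noncomputable def upRate (P : PrimitiveProcess) (π : Policy) (k : ℕ) : ℝ≥0∞ :=
  ENNReal.ofReal (P.lam k * π.x k * (1 - π.zSum k))

/-- Rate of entries with removal of another agent. -/
noncomputable def swapRate (P : PrimitiveProcess) (π : Policy) (k : ℕ) : ℝ≥0∞ :=
  ∑ j ∈ Finset.Icc 1 k, ENNReal.ofReal (P.lam k * π.x k * π.z k j)

/-- Rate of services and removals. -/
noncomputable def downRate (π : Policy) (k : ℕ) : ℝ≥0∞ :=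
  ∑ j ∈ Finset.Icc 1 k, (ENNReal.ofReal (π.q k j) + ENNReal.ofReal (π.y k j))

lemma totalRate_queued (P : PrimitiveProcess) (π : Policy) (s : ℕ × ℕ) :
    totalRate P π (queued s) = upRate P π s.1 + swapRate P π s.1 + downRate π s.1 := by
  rw [queued, totalRate_inQueue, upRate, swapRate, downRate, add_assoc, ← Finset.sum_add_distrib]
  simp only [add_assoc]

lemma sum_jumpRate_queued (P : PrimitiveProcess) (π : Policy) (k m ℓ : ℕ) :
    ∑ i ∈ Finset.Icc 1 k, jumpRate P π (.inQueue k i) (.inQueue m ℓ)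
      = upRate P π k * (if k + 1 = m ∧ 1 ≤ ℓ ∧ ℓ ≤ k then 1 else 0)
        + swapRate P π k * (if k = m ∧ 1 ≤ ℓ ∧ ℓ + 1 ≤ k then 1 else 0)
        + downRate π k * (if k - 1 = m ∧ 1 ≤ ℓ ∧ ℓ + 1 ≤ k then 1 else 0) := by
  simp only [jumpRate]
  rw [Finset.sum_add_distrib, ← Finset.mul_sum, Finset.sum_comm, add_assoc]
  congr 1
  · rw [upRate]
    congr 1
    have : ∀ i, ind (AgentState.inQueue (k + 1) i) (.inQueue m ℓ)
        = if i = ℓ then (if k + 1 = m then (1 : ℝ≥0∞) else 0) else 0 := by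
      intro i
      simp only [ind, AgentState.inQueue.injEq]
      split_ifs <;> first | rfl | (exfalso; tauto)
    simp_rw [this, Finset.sum_ite_eq', Finset.mem_Icc]
    split_ifs <;> first | rfl | (exfalso; tauto)
  · rw [swapRate, downRate, Finset.sum_mul, Finset.sum_mul, ← Finset.sum_add_distrib]
    refine Finset.sum_congr rfl fun j hj => ?_
    rw [Finset.sum_add_distrib, Finset.sum_add_distrib, ← Finset.mul_sum, ← Finset.mul_sum,
      ← Finset.mul_sum,
      sum_ind_afterLeave k k ℓ j hj .removed (by simp [queued]),
      sum_ind_afterLeave k (k - 1) ℓ j hj .removed (by simp [queued]),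
      sum_ind_afterLeave k (k - 1) ℓ j hj .served (by simp [queued])]
    ring

open Classical in
/-- The measure on pairs (length, position) with mass `w k` at every position of a queue of
length `k`. -/
noncomputable def spread (w : ℕ → ℝ≥0∞) (s : ℕ × ℕ) : ℝ≥0∞ :=
  if s.2 ∈ Finset.Icc 1 s.1 then w s.1 else 0

lemma tsum_spread_mul (w : ℕ → ℝ≥0∞) (g : ℕ × ℕ → ℝ≥0∞) :
    ∑' s, spread w s * g s = ∑' k, w k * ∑ i ∈ Finset.Icc 1 k, g (k, i) := by
  rw [ENNReal.tsum_prod']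
  refine tsum_congr fun k => ?_
  rw [tsum_eq_sum (s := Finset.Icc 1 k), Finset.mul_sum]
  · refine Finset.sum_congr rfl fun i hi => ?_
    simp only [spread, hi, if_true]
  · intro i hi
    simp only [spread, hi, if_false, zero_mul]

/-- The last position m + 1 receives nothing from entries or swaps, because the newcomer takes it.
That gap is what `entryFlow` fills. -/
lemma tsum_spread_mul_jumpRate (P : PrimitiveProcess) (π : Policy) (w : ℕ → ℝ≥0∞) (m ℓ : ℕ)
    (hℓ : ℓ ∈ Finset.Icc 1 (m + 1)) :
    ∑' c, spread w c * jumpRate P π (queued c) (queued (m + 1, ℓ))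
      = (if ℓ ≤ m then w m * upRate P π m + w (m + 1) * swapRate P π (m + 1) else 0)
        + w (m + 2) * downRate π (m + 2) := by
  rw [Finset.mem_Icc] at hℓ
  rw [tsum_spread_mul]
  simp only [queued, sum_jumpRate_queued]
  rw [tsum_eq_sum (s := {m, m + 1, m + 2})]
  · rw [Finset.sum_insert (by simp), Finset.sum_insert (by simp), Finset.sum_singleton]
    rw [if_neg (show ¬ (m = m + 1 ∧ 1 ≤ ℓ ∧ ℓ + 1 ≤ m) by omega),
      if_neg (show ¬ (m - 1 = m + 1 ∧ 1 ≤ ℓ ∧ ℓ + 1 ≤ m) by omega),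
      if_neg (show ¬ (m + 1 + 1 = m + 1 ∧ 1 ≤ ℓ ∧ ℓ ≤ m + 1) by omega),
      if_neg (show ¬ (m + 1 - 1 = m + 1 ∧ 1 ≤ ℓ ∧ ℓ + 1 ≤ m + 1) by omega),
      if_neg (show ¬ (m + 2 + 1 = m + 1 ∧ 1 ≤ ℓ ∧ ℓ ≤ m + 2) by omega),
      if_neg (show ¬ (m + 2 = m + 1 ∧ 1 ≤ ℓ ∧ ℓ + 1 ≤ m + 2) by omega),
      if_pos (show m + 2 - 1 = m + 1 ∧ 1 ≤ ℓ ∧ ℓ + 1 ≤ m + 2 by omega)]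
    by_cases hm : ℓ ≤ m
    · rw [if_pos (show m + 1 = m + 1 ∧ 1 ≤ ℓ ∧ ℓ ≤ m by omega),
        if_pos (show m + 1 = m + 1 ∧ 1 ≤ ℓ ∧ ℓ + 1 ≤ m + 1 by omega), if_pos hm]
      ring
    · rw [if_neg (show ¬ (m + 1 = m + 1 ∧ 1 ≤ ℓ ∧ ℓ ≤ m) by omega),
        if_neg (show ¬ (m + 1 = m + 1 ∧ 1 ≤ ℓ ∧ ℓ + 1 ≤ m + 1) by omega), if_neg hm]
      ring
  · intro k hk
    simp only [Finset.mem_insert, Finset.mem_singleton, not_or] at hk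
    have e1 : ¬ (k + 1 = m + 1 ∧ 1 ≤ ℓ ∧ ℓ ≤ k) := by omega
    have e2 : ¬ (k = m + 1 ∧ 1 ≤ ℓ ∧ ℓ + 1 ≤ k) := by omega
    have e3 : ¬ (k - 1 = m + 1 ∧ 1 ≤ ℓ ∧ ℓ + 1 ≤ k) := by omega
    simp only [e1, e2, e3, if_false, mul_zero, add_zero]

lemma tsum_spread_mul_jumpRate_of_notMem (P : PrimitiveProcess) (π : Policy) (w : ℕ → ℝ≥0∞)
    (b : ℕ × ℕ) (hb : b.2 ∉ Finset.Icc 1 b.1) :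
    ∑' c, spread w c * jumpRate P π (queued c) (queued b) = 0 := by
  rw [Finset.mem_Icc] at hb
  rw [tsum_spread_mul]
  simp only [queued, sum_jumpRate_queued]
  rw [ENNReal.tsum_eq_zero]
  intro k
  have e1 : ¬ (k + 1 = b.1 ∧ 1 ≤ b.2 ∧ b.2 ≤ k) := by omega
  have e2 : ¬ (k = b.1 ∧ 1 ≤ b.2 ∧ b.2 + 1 ≤ k) := by omega
  have e3 : ¬ (k - 1 = b.1 ∧ 1 ≤ b.2 ∧ b.2 + 1 ≤ k) := by omega
  simp only [e1, e2, e3, if_false, mul_zero, add_zero]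


/-! ### Little's law for feasible policies -/

lemma upRate_mul (P : PrimitiveProcess) {π : Policy} (he : π.EntryExitFeasible) (k : ℕ) (r : ℝ) :
    upRate P π k * ENNReal.ofReal r
      = ENNReal.ofReal (r * P.lam k * π.x k * (1 - π.zSum k)) := by
  have h1 := P.lam_nonneg k
  have h2 := (he.x_mem k).1
  have h3 := he.z_sum_le k
  rw [upRate, ← ENNReal.ofReal_mul (mul_nonneg (mul_nonneg h1 h2) (by linarith))]
  congr 1
  ring

lemma swapRate_eq (P : PrimitiveProcess) {π : Policy} (he : π.EntryExitFeasible) (k : ℕ) :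
    swapRate P π k = ENNReal.ofReal (P.lam k * π.x k * π.zSum k) := by
  have h1 := P.lam_nonneg k
  have h2 := (he.x_mem k).1
  rw [swapRate, ← ENNReal.ofReal_sum_of_nonneg
    (fun j hj => mul_nonneg (mul_nonneg h1 h2) (he.z_nonneg k j hj)), ← Finset.mul_sum]
  rfl

lemma downRate_eq {P : PrimitiveProcess} {π : Policy} (he : π.EntryExitFeasible)
    (hq : π.QueueingFeasible P) (k : ℕ) :
    downRate π k = ENNReal.ofReal (P.mu k + π.ySum k) := by
  have h : ∀ j ∈ Finset.Icc 1 k, ENNReal.ofReal (π.q k j) + ENNReal.ofReal (π.y k j)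
      = ENNReal.ofReal (π.q k j + π.y k j) := fun j hj =>
    (ENNReal.ofReal_add (hq.q_nonneg k j hj) (he.y_nonneg k j hj)).symm
  rw [downRate, Finset.sum_congr rfl h, ← ENNReal.ofReal_sum_of_nonneg
    (fun j hj => add_nonneg (hq.q_nonneg k j hj) (he.y_nonneg k j hj)),
    Finset.sum_add_distrib, hq.work_conserving]
  rfl

lemma Policy.EntryExitFeasible.ySum_nonneg {π : Policy} (he : π.EntryExitFeasible) (k : ℕ) :
    0 ≤ π.ySum k := Finset.sum_nonneg (he.y_nonneg k)

lemma Policy.EntryExitFeasible.zSum_nonneg {π : Policy} (he : π.EntryExitFeasible) (k : ℕ) :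
    0 ≤ π.zSum k := Finset.sum_nonneg (he.z_nonneg k)

lemma PrimitiveProcess.mu_nonneg (P : PrimitiveProcess) (k : ℕ) : 0 ≤ P.mu k :=
  P.mu_zero ▸ P.mu_mono (Nat.zero_le k)

lemma upRate_mul_balance {P : PrimitiveProcess} {π : Policy} {p : ℕ → ℝ}
    (he : π.EntryExitFeasible) (hq : π.QueueingFeasible P) (hp : IsInvariant P π p) (k : ℕ) :
    upRate P π k * ENNReal.ofReal (p k) = downRate π (k + 1) * ENNReal.ofReal (p (k + 1)) := by
  rw [upRate_mul P he, downRate_eq he hq, ← ENNReal.ofReal_mul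
    (add_nonneg (P.mu_nonneg _) (he.ySum_nonneg _)), ← hp.balance]
  congr 1
  ring

lemma entryFlow_zero (P : PrimitiveProcess) (π : Policy) (p : ℕ → ℝ) (ℓ : ℕ) :
    entryFlow P π p (0, ℓ) = 0 := by
  rw [entryFlow, ENNReal.tsum_eq_zero]
  intro i
  rcases i.eq_zero_or_pos with rfl | hi
  · simp [ind, Policy.zSum]
  · simp [ind, hi.ne']

lemma entryFlow_succ (P : PrimitiveProcess) (π : Policy) (p : ℕ → ℝ) (m ℓ : ℕ) :
    entryFlow P π p (m + 1, ℓ) = if ℓ = m + 1 then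
      ENNReal.ofReal (p m * P.lam m * π.x m * (1 - π.zSum m))
        + ENNReal.ofReal (p (m + 1) * P.lam (m + 1) * π.x (m + 1) * π.zSum (m + 1)) else 0 := by
  rw [entryFlow, ENNReal.tsum_add]
  have h1 : ∀ i, ind (i + 1, i + 1) (m + 1, ℓ) = ind i m * if ℓ = m + 1 then 1 else 0 := by
    intro i
    simp only [ind, Prod.mk.injEq, add_left_inj]
    split_ifs <;> first | omega | simp
  have h2 : ∀ i, ind (i, i) (m + 1, ℓ) = ind i (m + 1) * if ℓ = m + 1 then 1 else 0 := by
    intro i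
    simp only [ind, Prod.mk.injEq]
    split_ifs <;> first | omega | simp
  simp_rw [h1, h2, ← mul_assoc, ENNReal.tsum_mul_right, tsum_mul_ind]
  split_ifs <;> simp

/-- The measure with mass p_k at every position of a queue of length k is stationary for agents
entering at the back. Balance across the cuts m | m+1 and m+1 | m+2 reduces outflow to inflow. -/
lemma spread_mul_totalRate {P : PrimitiveProcess} {π : Policy} {p : ℕ → ℝ}
    (he : π.EntryExitFeasible) (hq : π.QueueingFeasible P) (hp : IsInvariant P π p) (b : ℕ × ℕ) :
    spread (fun k => ENNReal.ofReal (p k)) b * totalRate P π (queued b)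
      = entryFlow P π p b + ∑' c, spread (fun k => ENNReal.ofReal (p k)) c
          * jumpRate P π (queued c) (queued b) := by
  obtain ⟨k, ℓ⟩ := b
  by_cases hb : ℓ ∈ Finset.Icc 1 k
  · obtain ⟨m, rfl⟩ : ∃ m, k = m + 1 := by
      rw [Finset.mem_Icc] at hb
      exact ⟨k - 1, by omega⟩
    have hbal := upRate_mul_balance he hq hp m
    have hbal' := upRate_mul_balance he hq hp (m + 1)
    rw [tsum_spread_mul_jumpRate P π _ m ℓ hb, entryFlow_succ, totalRate_queued]
    have hsw : ENNReal.ofReal (p (m + 1) * P.lam (m + 1) * π.x (m + 1) * π.zSum (m + 1))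
        = ENNReal.ofReal (p (m + 1)) * swapRate P π (m + 1) := by
      rw [swapRate_eq P he, ← ENNReal.ofReal_mul (hp.nonneg _)]
      congr 1
      ring
    rw [hsw, ← upRate_mul P he m (p m)]
    simp only [spread, hb, if_true]
    rw [Finset.mem_Icc] at hb
    have hfin : ENNReal.ofReal (p (m + 1)) * (upRate P π (m + 1) + swapRate P π (m + 1)
          + downRate π (m + 1))
        = upRate P π m * ENNReal.ofReal (p m) + ENNReal.ofReal (p (m + 1)) * swapRate P π (m + 1)
          + ENNReal.ofReal (p (m + 2)) * downRate π (m + 2) := by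
      rw [hbal, mul_comm (ENNReal.ofReal (p (m + 2))), ← hbal']
      ring
    rw [hfin]
    by_cases hm : ℓ ≤ m
    · rw [if_neg (by omega), if_pos hm]
      ring
    · rw [if_pos (by omega), if_neg hm]
      ring
  · rw [tsum_spread_mul_jumpRate_of_notMem P π _ _ hb]
    have : entryFlow P π p (k, ℓ) = 0 := by
      cases k with
      | zero => exact entryFlow_zero P π p ℓ
      | succ m =>
        rw [entryFlow_succ, if_neg]
        rw [Finset.mem_Icc] at hb
        omega
    simp [this, spread, hb]

lemma totalRate_ne_zero {P : PrimitiveProcess} {π : Policy}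
    (he : π.EntryExitFeasible) (hq : π.QueueingFeasible P) (k ℓ : ℕ) :
    totalRate P π (queued (k + 1, ℓ)) ≠ 0 := by
  rw [totalRate_queued, downRate_eq he hq]
  have := P.mu_pos (k + 1) (by omega)
  have := he.ySum_nonneg (k + 1)
  simp only [ne_eq, add_eq_zero, ENNReal.ofReal_eq_zero]
  rintro ⟨-, h⟩
  linarith

/-- `spread p` solves the forward equation of which the occupation is the least supersolution. -/
lemma occupation_le_spread {P : PrimitiveProcess} {π : Policy} {p : ℕ → ℝ}
    (he : π.EntryExitFeasible) (hq : π.QueueingFeasible P) (hp : IsInvariant P π p) (b : ℕ × ℕ) :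
    occupation P π (entryFlow P π p) b ≤ spread (fun k => ENNReal.ofReal (p k)) b := by
  refine occupation_le P π _ _ (fun b => ?_) b
  rw [← spread_mul_totalRate he hq hp b]
  rw [mul_assoc]
  exact mul_le_of_le_one_right zero_le (ENNReal.mul_inv_le_one _)

/-- A bounded subinvariant function of a null flow vanishes: discrete form of recurrence. -/
lemma eq_zero_of_flux {p U d b : ℕ → ℝ} {Λ : ℝ} (hs : Summable p) (hU : ∀ k, 0 ≤ U k)
    (hUΛ : ∀ k, U k ≤ Λ) (hd : ∀ k, 0 < d (k + 1))
    (hbal : ∀ k, U k * p k = d (k + 1) * p (k + 1))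
    (hb0 : b 0 = 0) (hb : ∀ k, 0 ≤ b k) (hbp : ∀ k, b k ≤ p k)
    (hsub : ∀ k, (U (k + 1) + d (k + 1)) * b (k + 1) ≤ U k * b k + d (k + 2) * b (k + 2)) (k : ℕ) :
    b k = 0 := by
  -- `f k` is the net downward flux of `b` through the cut between k and k + 1. Subinvariance makes
  -- it nondecreasing in k, domination by `p` gives limit at most 0, and `b 0 = 0` makes it
  -- nonnegative at 0; so it vanishes, and `b` is zero by recursion.
  set f : ℕ → ℝ := fun k => d (k + 1) * b (k + 1) - U k * b k with hf
  have hmono : Monotone f := monotone_nat_of_le_succ fun k => by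
    have := hsub k
    simp only [hf]
    linarith
  have hp0 : ∀ k, 0 ≤ p k := fun k => (hb k).trans (hbp k)
  have hfle : ∀ k, f k ≤ Λ * p k := fun k => by
    have h1 : d (k + 1) * b (k + 1) ≤ d (k + 1) * p (k + 1) :=
      mul_le_mul_of_nonneg_left (hbp _) (hd k).le
    have h2 := mul_nonneg (hU k) (hb k)
    have h3 := mul_le_mul_of_nonneg_right (hUΛ k) (hp0 k)
    simp only [hf]
    linarith [hbal k]
  have hlim : Filter.Tendsto (fun k => Λ * p k) Filter.atTop (nhds 0) := by
    simpa using hs.tendsto_atTop_zero.const_mul Λ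
  have hf0 : ∀ k, f k ≤ 0 := fun k =>
    ge_of_tendsto hlim (Filter.eventually_atTop.2 ⟨k, fun n hn => (hmono hn).trans (hfle n)⟩)
  have hfz : ∀ k, f k = 0 := fun k => by
    refine le_antisymm (hf0 k) (le_trans ?_ (hmono (Nat.zero_le k)))
    simp only [hf, hb0, mul_zero, sub_zero]
    exact mul_nonneg (hd 0).le (hb 1)
  induction k with
  | zero => exact hb0
  | succ k ih =>
    have := hfz k
    simp only [hf, ih, mul_zero, sub_zero] at this
    exact (mul_eq_zero.1 this).resolve_left (hd k).ne'

/-- The defect `spread p - occupation` is an invariant measure without source, dominated by `p`. Its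
maximum over positions at each length is subinvariant for the birth and death chain of the length,
so `eq_zero_of_flux` kills it. Bounded arrival rates enter there. Equality, not just ≤, is needed
because the waiting time must be bounded from below by the mean length. -/
lemma occupation_eq_spread {P : PrimitiveProcess} {π : Policy} {p : ℕ → ℝ} {Λ : ℝ}
    (hΛ : ∀ k, P.lam k ≤ Λ)
    (he : π.EntryExitFeasible) (hq : π.QueueingFeasible P) (hp : IsInvariant P π p) (b : ℕ × ℕ) :
    occupation P π (entryFlow P π p) b = spread (fun k => ENNReal.ofReal (p k)) b := by
  set m := spread (fun k => ENNReal.ofReal (p k)) with hm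
  set Z := occupation P π (entryFlow P π p) with hZ
  have hle : ∀ b, Z b ≤ m b := occupation_le_spread he hq hp
  have hmtop : ∀ b, m b ≠ ⊤ := fun b => by
    simp only [hm, spread]
    split_ifs <;> simp
  set r : ℕ × ℕ → ℝ≥0∞ := fun b => m b - Z b with hr
  have hsum : ∀ b, Z b + r b = m b := fun b => add_tsub_cancel_of_le (hle b)
  set B : ℕ → ℝ≥0∞ := fun k => (Finset.Icc 1 k).sup fun ℓ => r (k, ℓ) with hB
  have hrB : ∀ c, r c ≤ spread B c := by
    rintro ⟨k, ℓ⟩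
    by_cases h : ℓ ∈ Finset.Icc 1 k
    · simp only [spread, h, if_true, hB]
      exact Finset.le_sup (f := fun ℓ => r (k, ℓ)) h
    · simp only [hr, hm, spread, h, if_false, zero_tsub, le_refl]
  have hBp : ∀ k, B k ≤ ENNReal.ofReal (p k) := fun k => by
    refine Finset.sup_le fun ℓ hℓ => tsub_le_self.trans ?_
    simp [hm, spread, hℓ]
  have hBtop : ∀ k, B k ≠ ⊤ := fun k => ne_top_of_le_ne_top ENNReal.ofReal_ne_top (hBp k)
  have hreq : ∀ k ℓ, r (k + 1, ℓ) * totalRate P π (queued (k + 1, ℓ))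
      = ∑' c, r c * jumpRate P π (queued c) (queued (k + 1, ℓ)) := by
    intro k ℓ
    have h1 := spread_mul_totalRate he hq hp (k + 1, ℓ)
    rw [← hm] at h1
    have h2 : Z (k + 1, ℓ) * totalRate P π (queued (k + 1, ℓ)) = entryFlow P π p (k + 1, ℓ)
        + ∑' c, Z c * jumpRate P π (queued c) (queued (k + 1, ℓ)) := by
      rw [hZ, occupation_eq, mul_assoc, ENNReal.inv_mul_cancel (totalRate_ne_zero he hq k ℓ)
        (totalRate_ne_top _ _ _), mul_one]
    simp_rw [← hsum, add_mul, ENNReal.tsum_add] at h1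
    rw [← add_assoc, ← h2] at h1
    refine (ENNReal.add_right_inj ?_).1 h1
    exact ENNReal.mul_ne_top (ne_top_of_le_ne_top (hmtop _) (hle _)) (totalRate_ne_top _ _ _)
  have hdown : ∀ k, 0 < (downRate π (k + 1)).toReal := fun k => by
    rw [downRate_eq he hq, ENNReal.toReal_ofReal]
    · linarith [P.mu_pos (k + 1) (by omega), he.ySum_nonneg (k + 1)]
    · linarith [P.mu_pos (k + 1) (by omega), he.ySum_nonneg (k + 1)]
  have hdtop : ∀ k, downRate π k ≠ ⊤ := fun k => by
    rw [downRate_eq he hq]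
    exact ENNReal.ofReal_ne_top
  have hswapTop : ∀ k, swapRate P π k ≠ ⊤ := fun k => by
    rw [swapRate_eq P he]
    exact ENNReal.ofReal_ne_top
  have hsubE : ∀ k, (upRate P π (k + 1) + downRate π (k + 1)) * B (k + 1)
      ≤ upRate P π k * B k + downRate π (k + 2) * B (k + 2) := by
    intro k
    -- Evaluate the invariance equation at the position where the maximum is attained and bound
    -- every other defect by the maximum at its length.
    obtain ⟨ℓ, hℓ, hmax⟩ := Finset.exists_mem_eq_sup (Finset.Icc 1 (k + 1)) ⟨1, by simp⟩
      (fun ℓ => r (k + 1, ℓ))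
    have h1 : B (k + 1) = r (k + 1, ℓ) := hmax
    have h2 := hreq k ℓ
    rw [← h1] at h2
    have h3 : ∑' c, r c * jumpRate P π (queued c) (queued (k + 1, ℓ))
        ≤ B k * upRate P π k + B (k + 1) * swapRate P π (k + 1) + B (k + 2) * downRate π (k + 2) :=
      calc _ ≤ ∑' c, spread B c * jumpRate P π (queued c) (queued (k + 1, ℓ)) :=
            ENNReal.tsum_le_tsum fun c => mul_le_mul_left (hrB c) _
        _ ≤ _ := by
            rw [tsum_spread_mul_jumpRate P π B k ℓ hℓ]
            gcongr
            split_ifs <;> simp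
    rw [← h2, totalRate_queued] at h3
    -- Swaps do not change the length, so their term is on both sides and can be cancelled, being
    -- finite.
    have h4 : B (k + 1) * swapRate P π (k + 1) ≠ ⊤ := ENNReal.mul_ne_top (hBtop _) (hswapTop _)
    rw [← ENNReal.add_le_add_iff_left h4]
    calc _ = B (k + 1) * (upRate P π (k + 1) + swapRate P π (k + 1) + downRate π (k + 1)) := by
          ring
      _ ≤ _ := h3
      _ = _ := by ring
  have hB0 : ∀ k, (B k).toReal = 0 := by
    refine eq_zero_of_flux (p := p) (U := fun k => (upRate P π k).toReal)
      (d := fun k => (downRate π k).toReal) (Λ := Λ) hp.hasSum_one.summable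
      (fun k => ENNReal.toReal_nonneg) (fun k => ?_) hdown (fun k => ?_) ?_
      (fun k => ENNReal.toReal_nonneg) (fun k => ?_) (fun k => ?_)
    · have h1 := he.x_mem k
      have h2 := he.zSum_nonneg k
      have h3 := he.z_sum_le k
      have h4 := P.lam_nonneg k
      refine ENNReal.toReal_le_of_le_ofReal (h4.trans (hΛ k)) (ENNReal.ofReal_le_ofReal ?_)
      refine le_trans ?_ (hΛ k)
      rw [mul_assoc]
      exact mul_le_of_le_one_right h4 (mul_le_one₀ h1.2 (by linarith) (by linarith))
    · have := congrArg ENNReal.toReal (upRate_mul_balance he hq hp k)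
      simpa [ENNReal.toReal_mul, ENNReal.toReal_ofReal (hp.nonneg _)] using this
    · simp [hB]
    · exact ENNReal.toReal_le_of_le_ofReal (hp.nonneg k) (hBp k)
    · have hup : ∀ k, upRate P π k ≠ ⊤ := fun k => ENNReal.ofReal_ne_top
      have := ENNReal.toReal_mono (ENNReal.add_ne_top.2
        ⟨ENNReal.mul_ne_top (hup k) (hBtop k), ENNReal.mul_ne_top (hdtop (k + 2)) (hBtop (k + 2))⟩)
        (hsubE k)
      rwa [ENNReal.toReal_mul, ENNReal.toReal_add (hup _) (hdtop _), ENNReal.toReal_add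
        (ENNReal.mul_ne_top (hup k) (hBtop k)) (ENNReal.mul_ne_top (hdtop (k + 2)) (hBtop (k + 2))),
        ENNReal.toReal_mul, ENNReal.toReal_mul] at this
  have hr0 : r b = 0 := by
    have h := hrB b
    have : spread B b = 0 := by
      simp only [spread]
      split_ifs
      · exact ((ENNReal.toReal_eq_zero_iff _).1 (hB0 _)).resolve_right (hBtop _)
      · rfl
    exact le_antisymm (this ▸ h) zero_le
  rw [← hsum b, hr0, add_zero]

/-- Little's law: the k positions at length k carry p_k each, hence k p_k together. -/
lemma tsum_entryFlow_mul_waitTime {P : PrimitiveProcess} {π : Policy} {p : ℕ → ℝ} {Λ : ℝ}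
    (hΛ : ∀ k, P.lam k ≤ Λ)
    (he : π.EntryExitFeasible) (hq : π.QueueingFeasible P) (hp : IsInvariant P π p) :
    ∑' s, entryFlow P π p s * waitTime P π s.1 s.2 = meanLength p := by
  rw [tsum_mul_waitTime]
  simp_rw [occupation_eq_spread hΛ he hq hp]
  have := tsum_spread_mul (fun k => ENNReal.ofReal (p k)) (fun _ => 1)
  simp only [mul_one] at this
  rw [this, meanLength]
  refine tsum_congr fun k => ?_
  rw [ENNReal.ofReal_mul (hp.nonneg k)]
  simp

/-- The service rates of the positions at length k add up to μ_k by work conservation. -/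
lemma tsum_entryFlow_mul_serviceProb_le {P : PrimitiveProcess} {π : Policy} {p : ℕ → ℝ}
    (he : π.EntryExitFeasible) (hq : π.QueueingFeasible P) (hp : IsInvariant P π p) :
    ∑' s, entryFlow P π p s * serviceProb P π s.1 s.2 ≤ serviceFlow P p := by
  refine (tsum_mul_serviceProb_le P π _).trans ?_
  calc _ ≤ ∑' b, spread (fun k => ENNReal.ofReal (p k)) b * jumpRate P π (queued b) .served :=
        ENNReal.tsum_le_tsum fun b => mul_le_mul_left (occupation_le_spread he hq hp b) _
    _ = serviceFlow P p := by
        rw [tsum_spread_mul, serviceFlow]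
        refine tsum_congr fun k => ?_
        rw [ENNReal.ofReal_mul (hp.nonneg k)]
        congr 1
        rw [← hq.work_conserving k, ENNReal.ofReal_sum_of_nonneg (hq.q_nonneg k)]
        refine Finset.sum_congr rfl fun i hi => ?_
        simp only [queued, jumpRate]
        rw [Finset.sum_eq_single i]
        · simp [ind, afterLeave]
        · intro j hj hji
          by_cases h : j < i <;> simp [ind, afterLeave, hji, h]
        · intro h
          exact absurd hi h

/-- Regularity telescopes: λ_k - μ_k is nonincreasing from k = 1 on, and μ is bounded. -/
lemma PrimitiveProcess.IsRegular.exists_lam_le {P : PrimitiveProcess} (h : P.IsRegular) :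
    ∃ Λ, ∀ k, P.lam k ≤ Λ := by
  obtain ⟨B, hB⟩ := P.mu_bounded
  have key : ∀ k, P.lam (k + 1) - P.mu (k + 1) ≤ P.lam 1 - P.mu 1 := by
    intro k
    induction k with
    | zero => rfl
    | succ k ih =>
      have := h.2 (k + 2) (by omega)
      simp only [show k + 2 - 1 = k + 1 by omega] at this
      linarith
  refine ⟨max (P.lam 0) (P.lam 1 - P.mu 1 + B), fun k => ?_⟩
  cases k with
  | zero => exact le_max_left _ _
  | succ k => exact le_max_of_le_right (by linarith [key k, hB (k + 1)])

/-- The participation constraint implied by obedience upon entry. -/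
lemma IsFeasible.meanLength_le {P : PrimitiveProcess} {w : Payoffs} {d : Design}
    (hreg : P.IsRegular) (hd : IsFeasible P w d) :
    ENNReal.ofReal w.C * meanLength d.p ≤ ENNReal.ofReal w.V * serviceFlow P d.p := by
  obtain ⟨Λ, hΛ⟩ := hreg.exists_lam_le
  have he := hd.entryExit
  have hq := hd.queueing
  have hp := hd.invariant
  -- No event can have occurred at time 0, so the agents at time 0 are the entrants.
  have hflow : ∀ s, stayFlow P d.π d.p 0 s = entryFlow P d.π d.p s := by
    intro s
    have h : ∀ a, entryFlow P d.π d.p a * ind (AgentState.inQueue a.1 a.2) (.inQueue s.1 s.2)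
        = entryFlow P d.π d.p a * ind a s := by
      intro a
      simp [ind, Prod.ext_iff]
    simp_rw [stayFlow, transProb_zero, h, tsum_mul_ind]
  rw [← tsum_entryFlow_mul_waitTime hΛ he hq hp]
  refine le_trans ?_ (mul_le_mul_right (tsum_entryFlow_mul_serviceProb_le he hq hp) _)
  -- If nobody joins, obedience is void, but then the entry flow and the left side vanish.
  rcases eq_or_ne (stayMass P d.π d.p 0) 0 with h0 | h0
  · have : ∀ s, entryFlow P d.π d.p s = 0 := by
      intro s
      rw [← hflow]
      exact ENNReal.tsum_eq_zero.1 h0 s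
    simp [this]
  have hmass : stayMass P d.π d.p 0 ≠ ⊤ := by
    have h1 : stayMass P d.π d.p 0 ≤ ∑' i, ENNReal.ofReal (2 * Λ * d.p i) := by
      simp_rw [stayMass, hflow, entryFlow]
      rw [ENNReal.tsum_comm]
      refine ENNReal.tsum_le_tsum fun i => ?_
      rw [ENNReal.tsum_add, ENNReal.tsum_mul_left, ENNReal.tsum_mul_left]
      have h2 : ∀ a : ℕ × ℕ, ∑' s, ind a s = 1 := fun a => by
        simpa using tsum_ind_mul a (fun _ => 1)
      rw [h2, h2, mul_one, mul_one]
      have hx := he.x_mem i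
      have hl := P.lam_nonneg i
      have hz := he.zSum_nonneg i
      have hz1 := he.z_sum_le i
      have hpi := hp.nonneg i
      have h3 : 0 ≤ d.p i * P.lam i * d.π.x i := mul_nonneg (mul_nonneg hpi hl) hx.1
      rw [← ENNReal.ofReal_add (mul_nonneg h3 (by linarith)) (mul_nonneg h3 hz)]
      refine ENNReal.ofReal_le_ofReal ?_
      have h4 : d.p i * P.lam i * d.π.x i ≤ d.p i * P.lam i :=
        mul_le_of_le_one_right (mul_nonneg hpi hl) hx.2
      have h5 : d.p i * P.lam i ≤ d.p i * Λ := mul_le_mul_of_nonneg_left (hΛ i) hpi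
      have h6 : 0 ≤ d.p i * Λ := (mul_nonneg hpi hl).trans h5
      nlinarith
    refine ne_top_of_le_ne_top ?_ h1
    exact ((hp.hasSum_one.summable.mul_left (2 * Λ))).tsum_ofReal_ne_top
  have hpos : 0 < stayMass P d.π d.p (0 : ℝ≥0) := by
    simpa using pos_iff_ne_zero.2 h0
  have hinfo := hd.info 0 hpos
  have hob := hd.obedience 0 hpos
  have hmeas : ∀ s, Measurable fun γ : Belief => γ.1 s := fun s =>
    (measurable_pi_apply s).comp measurable_subtype_coe
  -- Bayes plausibility: averaging a linear functional of the belief over `I 0` evaluates it at the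
  -- normalized entry flow.
  have hint : ∀ g : ℕ × ℕ → ℝ≥0∞, ∫⁻ γ : Belief, ∑' s, γ.1 s * g s ∂(d.I 0 : Measure Belief)
      = (stayMass P d.π d.p 0)⁻¹ * ∑' s, entryFlow P d.π d.p s * g s := by
    intro g
    rw [lintegral_tsum fun s => ((hmeas s).mul_const _).aemeasurable, ← ENNReal.tsum_mul_left]
    refine tsum_congr fun s => ?_
    rw [lintegral_mul_const _ (hmeas s), hinfo s, bayesBelief]
    simp only [NNReal.coe_zero, hflow, div_eq_mul_inv]
    ring
  -- The support has full measure, so pointwise obedience on it can be integrated over the beliefs.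
  have hae : ∀ᵐ γ ∂(d.I 0 : Measure Belief),
      ENNReal.ofReal w.C * ∑' s : ℕ × ℕ, γ.1 s * waitTime P d.π s.1 s.2
      ≤ ENNReal.ofReal w.V * ∑' s : ℕ × ℕ, γ.1 s * serviceProb P d.π s.1 s.2 := by
    filter_upwards [Measure.support_mem_ae (μ := (d.I 0 : Measure Belief))] with γ hγ
    exact hob γ hγ
  have h := lintegral_mono_ae hae
  have hm : ∀ g : ℕ × ℕ → ℝ≥0∞, Measurable fun γ : Belief => ∑' s, γ.1 s * g s := fun g =>
    Measurable.tsum fun s => (hmeas s).mul_const _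
  rw [lintegral_const_mul _ (hm _), lintegral_const_mul _ (hm _),
    hint (fun s => waitTime P d.π s.1 s.2), hint (fun s => serviceProb P d.π s.1 s.2),
    mul_left_comm, mul_left_comm (ENNReal.ofReal w.V)] at h
  exact (ENNReal.mul_le_mul_iff_right (ENNReal.inv_ne_zero.2 hmass) (ENNReal.inv_ne_top.2 h0)).1 h


/-! ### The backward equation: minimality and nonexplosion -/

/-- Expectation of `f` after time `t`, on the event that exactly `n` events have occurred. -/
noncomputable def transFn (P : PrimitiveProcess) (π : Policy) (f : AgentState → ℝ≥0∞) (n : ℕ)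
    (t : ℝ) (a : AgentState) : ℝ≥0∞ :=
  ∑' b, transProbN P π n t a b * f b

lemma measurable_transFn (P : PrimitiveProcess) (π : Policy) (f : AgentState → ℝ≥0∞) (n : ℕ)
    (a : AgentState) : Measurable fun t => transFn P π f n t a :=
  Measurable.tsum fun b => (measurable_transProbN P π n a b).mul_const _

lemma transFn_zero (P : PrimitiveProcess) (π : Policy) (f : AgentState → ℝ≥0∞) (t : ℝ)
    (a : AgentState) :
    transFn P π f 0 t a = ENNReal.ofReal (Real.exp (-(exitRate P π a * t))) * f a := by
  simp_rw [transFn, transProbN, mul_assoc, ENNReal.tsum_mul_left, tsum_ind_mul]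

lemma transFn_succ (P : PrimitiveProcess) (π : Policy) (f : AgentState → ℝ≥0∞) (n : ℕ) (t : ℝ)
    (a : AgentState) :
    transFn P π f (n + 1) t a = ∫⁻ u in Set.Ioc 0 t,
      ENNReal.ofReal (Real.exp (-(exitRate P π a * u)))
        * ∑' c, jumpRate P π a c * transFn P π f n (t - u) c := by
  have hm : ∀ b, Measurable fun u : ℝ => ENNReal.ofReal (Real.exp (-(exitRate P π a * u)))
        * ∑' c, jumpRate P π a c * transProbN P π n (t - u) c b := fun b =>
    (measurable_expFactor _).mul (Measurable.tsum fun c =>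
      ((measurable_transProbN P π n c b).comp (measurable_const.sub measurable_id)).const_mul _)
  simp_rw [transFn, transProbN]
  simp_rw [← lintegral_mul_const _ (hm _)]
  rw [← lintegral_tsum fun b => ((hm b).mul_const _).aemeasurable]
  refine lintegral_congr fun u => ?_
  simp_rw [mul_assoc, ENNReal.tsum_mul_left, ← ENNReal.tsum_mul_right, ← ENNReal.tsum_mul_left]
  rw [ENNReal.tsum_comm]
  refine tsum_congr fun c => tsum_congr fun d => ?_
  ring

/-- Expectation of `f` after time `t`, on the event that fewer than `N` events have occurred. -/
noncomputable def transSum (P : PrimitiveProcess) (π : Policy) (f : AgentState → ℝ≥0∞) (N : ℕ)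
    (t : ℝ) (a : AgentState) : ℝ≥0∞ :=
  ∑ n ∈ Finset.range N, transFn P π f n t a

lemma transSum_succ (P : PrimitiveProcess) (π : Policy) (f : AgentState → ℝ≥0∞) (N : ℕ) (t : ℝ)
    (a : AgentState) :
    transSum P π f (N + 1) t a = ENNReal.ofReal (Real.exp (-(exitRate P π a * t))) * f a
      + ∫⁻ u in Set.Ioc 0 t, ENNReal.ofReal (Real.exp (-(exitRate P π a * u)))
        * ∑' c, jumpRate P π a c * transSum P π f N (t - u) c := by
  rw [transSum, Finset.sum_range_succ', transFn_zero, add_comm]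
  congr 1
  simp_rw [transFn_succ]
  rw [← lintegral_finsetSum]
  · refine lintegral_congr fun u => ?_
    rw [← Finset.mul_sum, ← Summable.tsum_finsetSum fun _ _ => ENNReal.summable]
    simp_rw [← Finset.mul_sum]
    rfl
  · intro n _
    exact (measurable_expFactor _).mul (Measurable.tsum fun c =>
      ((measurable_transFn P π f n c).comp (measurable_const.sub measurable_id)).const_mul _)

lemma tsum_transProb_mul (P : PrimitiveProcess) (π : Policy) (f : AgentState → ℝ≥0∞) (t : ℝ)
    (a : AgentState) :
    ∑' b, transProb P π t a b * f b = ∑' n, transFn P π f n t a := by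
  simp_rw [transProb, transFn, ← ENNReal.tsum_mul_right]
  rw [ENNReal.tsum_comm]

/-- A set of situations which the process does not leave. -/
def IsClosedSet (P : PrimitiveProcess) (π : Policy) (A : Set AgentState) : Prop :=
  ∀ a ∈ A, ∀ c, jumpRate P π a c ≠ 0 → c ∈ A

lemma IsClosedSet.tsum_mul_le {P : PrimitiveProcess} {π : Policy} {A : Set AgentState}
    (hA : IsClosedSet P π A) {a : AgentState} (ha : a ∈ A) {g h : AgentState → ℝ≥0∞}
    (hgh : ∀ c ∈ A, g c ≤ h c) :
    ∑' c, jumpRate P π a c * g c ≤ ∑' c, jumpRate P π a c * h c := by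
  refine ENNReal.tsum_le_tsum fun c => ?_
  by_cases hc : jumpRate P π a c = 0
  · simp [hc]
  · exact mul_le_mul_right (hgh c (hA a ha c hc)) _

/-- The minimal transition function applied to `f` lies below every supersolution of the backward
integral equation; the induction is on the number of events allowed. -/
lemma tsum_transProb_mul_le {P : PrimitiveProcess} {π : Policy} {A : Set AgentState}
    (hA : IsClosedSet P π A) {f : AgentState → ℝ≥0∞} {u : ℝ → AgentState → ℝ≥0∞}
    (h : ∀ a ∈ A, ∀ t, 0 ≤ t → ENNReal.ofReal (Real.exp (-(exitRate P π a * t))) * f a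
      + ∫⁻ r in Set.Ioc 0 t, ENNReal.ofReal (Real.exp (-(exitRate P π a * r)))
        * ∑' c, jumpRate P π a c * u (t - r) c ≤ u t a)
    {a : AgentState} (ha : a ∈ A) {t : ℝ} (ht : 0 ≤ t) :
    ∑' b, transProb P π t a b * f b ≤ u t a := by
  rw [tsum_transProb_mul, ENNReal.tsum_eq_iSup_nat]
  refine iSup_le fun N => ?_
  change transSum P π f N t a ≤ u t a
  induction N generalizing a t with
  | zero => simp [transSum]
  | succ N ih =>
    rw [transSum_succ]
    refine le_trans ?_ (h a ha t ht)
    refine add_le_add le_rfl (setLIntegral_mono' measurableSet_Ioc fun r hr => ?_)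
    refine mul_le_mul_right ?_ _
    exact hA.tsum_mul_le ha fun c hc => ih hc (by linarith [hr.2])

/-- The recursion satisfied by the error term in the uniqueness argument that follows. -/
lemma lintegral_pow_div_factorial {Λ t : ℝ} (hΛ : 0 ≤ Λ) (ht : 0 ≤ t) (N : ℕ) :
    ∫⁻ r in Set.Ioc 0 t, ENNReal.ofReal (Λ * ((Λ * (t - r)) ^ N / N.factorial))
      = ENNReal.ofReal ((Λ * t) ^ (N + 1) / (N + 1).factorial) := by
  have hc : Continuous fun r : ℝ => Λ * ((Λ * (t - r)) ^ N / N.factorial) := by fun_prop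
  rw [← ofReal_integral_eq_lintegral_ofReal
    ((hc.integrableOn_Icc (a := 0) (b := t)).mono_set Set.Ioc_subset_Icc_self)]
  · rw [← intervalIntegral.integral_of_le ht]
    congr 1
    have hderiv : ∀ r ∈ Set.uIcc 0 t, HasDerivAt
        (fun r : ℝ => -((Λ * (t - r)) ^ (N + 1) / (N + 1).factorial))
        (Λ * ((Λ * (t - r)) ^ N / N.factorial)) r := by
      intro r _
      have h1 : HasDerivAt (fun r : ℝ => Λ * (t - r)) (Λ * (-1)) r :=
        ((hasDerivAt_id r).const_sub t).const_mul Λ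
      have h2 := ((h1.pow (N + 1)).div_const ((N + 1).factorial : ℝ)).neg
      refine h2.congr_deriv ?_
      rw [Nat.factorial_succ]
      have : (N.factorial : ℝ) ≠ 0 := by positivity
      push_cast
      field_simp
    rw [intervalIntegral.integral_eq_sub_of_hasDerivAt hderiv (hc.intervalIntegrable _ _)]
    simp
  · filter_upwards [ae_restrict_mem measurableSet_Ioc] with r hr
    have : 0 ≤ t - r := by linarith [hr.2]
    simp only [Pi.zero_apply]
    positivity

/-- With bounded rates a bounded subsolution of the backward equation cannot exceed the minimal
solution: N substitutions of the equation into itself leave an error at most (Λt)^N / N!, which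
tends to 0. -/
lemma le_tsum_transProb_mul {P : PrimitiveProcess} {π : Policy} {A : Set AgentState}
    (hA : IsClosedSet P π A) {Λ : ℝ} (hΛ : 0 ≤ Λ)
    (hAΛ : ∀ a ∈ A, totalRate P π a ≤ ENNReal.ofReal Λ)
    {f : AgentState → ℝ≥0∞} {u : ℝ → AgentState → ℝ≥0∞}
    (hu : ∀ a ∈ A, ∀ t, 0 ≤ t → u t a ≤ 1)
    (h : ∀ a ∈ A, ∀ t, 0 ≤ t → u t a ≤ ENNReal.ofReal (Real.exp (-(exitRate P π a * t))) * f a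
      + ∫⁻ r in Set.Ioc 0 t, ENNReal.ofReal (Real.exp (-(exitRate P π a * r)))
        * ∑' c, jumpRate P π a c * u (t - r) c)
    {a : AgentState} (ha : a ∈ A) {t : ℝ} (ht : 0 ≤ t) :
    u t a ≤ ∑' b, transProb P π t a b * f b := by
  have key : ∀ N : ℕ, u t a
      ≤ transSum P π f N t a + ENNReal.ofReal ((Λ * t) ^ N / N.factorial) := by
    intro N
    induction N generalizing a t with
    | zero => simpa [transSum] using hu a ha t ht
    | succ N ih =>
      refine (h a ha t ht).trans ?_
      rw [transSum_succ, add_assoc]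
      refine add_le_add le_rfl ?_
      rw [← lintegral_pow_div_factorial hΛ ht, ← lintegral_add_left]
      · refine setLIntegral_mono' measurableSet_Ioc fun r hr => ?_
        have htr : 0 ≤ t - r := by linarith [hr.2]
        have hexp : ENNReal.ofReal (Real.exp (-(exitRate P π a * r))) ≤ 1 := by
          rw [ENNReal.ofReal_le_one, Real.exp_le_one_iff]
          have := mul_nonneg (exitRate_nonneg P π a) hr.1.le
          linarith
        calc _ ≤ ENNReal.ofReal (Real.exp (-(exitRate P π a * r))) * ∑' c, jumpRate P π a c *
              (transSum P π f N (t - r) c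
                + ENNReal.ofReal ((Λ * (t - r)) ^ N / N.factorial)) := by
              refine mul_le_mul_right ?_ _
              exact hA.tsum_mul_le ha fun c hc => ih hc htr
          _ = ENNReal.ofReal (Real.exp (-(exitRate P π a * r)))
                * ∑' c, jumpRate P π a c * transSum P π f N (t - r) c
              + ENNReal.ofReal (Real.exp (-(exitRate P π a * r))) * (totalRate P π a
                * ENNReal.ofReal ((Λ * (t - r)) ^ N / N.factorial)) := by
              simp_rw [mul_add, ENNReal.tsum_add, ENNReal.tsum_mul_right]
              rw [mul_add]
              rfl
          _ ≤ _ := by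
              refine add_le_add le_rfl ?_
              rw [ENNReal.ofReal_mul hΛ]
              refine (mul_le_of_le_one_left zero_le hexp).trans ?_
              gcongr
              exact hAΛ a ha
      · refine (measurable_expFactor _).mul (Measurable.tsum fun c => Measurable.const_mul ?_ _)
        exact (Finset.measurable_fun_sum _ fun n _ => measurable_transFn P π f n c).comp
          (measurable_const.sub measurable_id)
  have hlim : Filter.Tendsto (fun N : ℕ => (∑' b, transProb P π t a b * f b)
      + ENNReal.ofReal ((Λ * t) ^ N / N.factorial)) Filter.atTop
      (nhds ((∑' b, transProb P π t a b * f b) + 0)) := by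
    refine tendsto_const_nhds.add ?_
    have := ENNReal.tendsto_ofReal (FloorSemiring.tendsto_pow_div_factorial_atTop (Λ * t))
    simpa using this
  rw [add_zero] at hlim
  refine ge_of_tendsto hlim (Filter.Eventually.of_forall fun N => (key N).trans ?_)
  gcongr
  rw [tsum_transProb_mul]
  exact ENNReal.sum_le_tsum _

/-- The exponential clock has either not rung by time `t` or has rung at some r ≤ t. Equivalently,
the constant 1 solves the backward equation. -/
lemma lintegral_exp_mul_totalRate (P : PrimitiveProcess) (π : Policy) (a : AgentState) {t : ℝ}
    (ht : 0 ≤ t) :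
    ENNReal.ofReal (Real.exp (-(exitRate P π a * t)))
      + ∫⁻ r in Set.Ioc 0 t, ENNReal.ofReal (Real.exp (-(exitRate P π a * r)))
        * totalRate P π a = 1 := by
  set x := exitRate P π a with hx
  have hx0 : 0 ≤ x := exitRate_nonneg P π a
  rw [← ofReal_exitRate, ← hx]
  simp_rw [← ENNReal.ofReal_mul (Real.exp_nonneg _)]
  have hc : Continuous fun r : ℝ => Real.exp (-(x * r)) * x := by fun_prop
  rw [← ofReal_integral_eq_lintegral_ofReal
    ((hc.integrableOn_Icc (a := 0) (b := t)).mono_set Set.Ioc_subset_Icc_self)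
    (by filter_upwards with r; positivity), ← intervalIntegral.integral_of_le ht]
  have hderiv : ∀ r ∈ Set.uIcc 0 t, HasDerivAt (fun r : ℝ => -Real.exp (-(x * r)))
      (Real.exp (-(x * r)) * x) r := by
    intro r _
    have h2 := ((((hasDerivAt_id r).const_mul x).neg).exp).neg
    refine h2.congr_deriv ?_
    simp
  rw [intervalIntegral.integral_eq_sub_of_hasDerivAt hderiv (hc.intervalIntegrable _ _),
    ← ENNReal.ofReal_add (Real.exp_nonneg _)]
  · simp
  · simp only [mul_zero, neg_zero, Real.exp_zero, sub_neg_eq_add]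
    have : Real.exp (-(x * t)) ≤ 1 := by
      rw [Real.exp_le_one_iff]
      have := mul_nonneg hx0 ht
      linarith
    linarith

/-- Nonexplosion: no mass is lost when the rates are bounded on the closed set. -/
lemma one_le_tsum_transProb {P : PrimitiveProcess} {π : Policy} {A : Set AgentState}
    (hA : IsClosedSet P π A) {Λ : ℝ} (hΛ : 0 ≤ Λ)
    (hAΛ : ∀ a ∈ A, totalRate P π a ≤ ENNReal.ofReal Λ)
    {a : AgentState} (ha : a ∈ A) {t : ℝ} (ht : 0 ≤ t) :
    1 ≤ ∑' b, transProb P π t a b := by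
  have := le_tsum_transProb_mul hA hΛ hAΛ (f := fun _ => 1) (u := fun _ _ => 1)
    (fun _ _ _ _ => le_rfl) (fun a _ t ht => ?_) ha ht
  · simpa using this
  · simp only [mul_one]
    exact (lintegral_exp_mul_totalRate P π a ht).ge

/-- A Lyapunov bound: if φ dominates one expected holding time plus its own mean after the next
event, it dominates the total over any number of events. -/
lemma waitTime_le {P : PrimitiveProcess} {π : Policy} {A : Set AgentState}
    (hA : IsClosedSet P π A) {φ : AgentState → ℝ≥0∞}
    (h : ∀ k ℓ, .inQueue k ℓ ∈ A → (totalRate P π (.inQueue k ℓ))⁻¹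
      * (1 + ∑' c, jumpRate P π (.inQueue k ℓ) c * φ c) ≤ φ (.inQueue k ℓ))
    {k ℓ : ℕ} (hk : .inQueue k ℓ ∈ A) :
    waitTime P π k ℓ ≤ φ (.inQueue k ℓ) := by
  rw [waitTime_eq, ENNReal.tsum_eq_iSup_nat]
  refine iSup_le fun N => ?_
  induction N generalizing k ℓ with
  | zero => simp
  | succ N ih =>
    rw [Finset.sum_range_succ']
    simp_rw [greenN_succ_queued, greenN_zero, ENNReal.tsum_mul_left]
    have h1 : ∑' s, ind (AgentState.inQueue k ℓ) (queued s) = 1 := by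
      have : ∀ s : ℕ × ℕ, ind (AgentState.inQueue k ℓ) (queued s) = ind (k, ℓ) s * 1 := by
        intro s
        simp [ind, queued, Prod.ext_iff]
      simp_rw [this, tsum_ind_mul]
    rw [h1, ← Finset.mul_sum, ← mul_add, add_comm]
    refine le_trans ?_ (h k ℓ hk)
    refine mul_le_mul_right (add_le_add le_rfl ?_) _
    calc _ = ∑' c, jumpRate P π (.inQueue k ℓ) (queued c)
          * ∑ n ∈ Finset.range N, ∑' s, greenN P π n (queued c) (queued s) := by
          simp_rw [Finset.mul_sum]
          rw [Summable.tsum_finsetSum fun _ _ => ENNReal.summable]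
          refine Finset.sum_congr rfl fun n _ => ?_
          rw [ENNReal.tsum_comm]
          simp_rw [ENNReal.tsum_mul_left]
      _ ≤ ∑' c, jumpRate P π (.inQueue k ℓ) (queued c) * φ (queued c) := by
          refine ENNReal.tsum_le_tsum fun c => ?_
          by_cases hc : jumpRate P π (.inQueue k ℓ) (queued c) = 0
          · simp [hc]
          · gcongr
            exact ih (hA _ hk _ hc)
      _ ≤ _ := ENNReal.tsum_comp_le_tsum_of_injective queued_injective
            (fun c => jumpRate P π (.inQueue k ℓ) c * φ c)


/-! ### Exponential series of a bounded sequence -/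

/-- The exponential generating function `∑ t^j / j! c_j`. -/
noncomputable def expSeries (c : ℕ → ℝ) (t : ℝ) : ℝ := ∑' j, t ^ j / j.factorial * c j

lemma summable_expSeries {c : ℕ → ℝ} {M : ℝ} (hc : ∀ j, |c j| ≤ M) (t : ℝ) :
    Summable fun j : ℕ => t ^ j / j.factorial * c j := by
  refine Summable.of_norm_bounded
    (g := fun j : ℕ => |t| ^ j / j.factorial * M)
    ((Real.summable_pow_div_factorial |t|).mul_right M) fun j => ?_
  rw [Real.norm_eq_abs, abs_mul, abs_div, abs_pow, Nat.abs_cast]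
  gcongr
  exact hc j

/-- Termwise differentiation, with a summable bound on the derivatives that is uniform on the ball
of radius |t| + 1. -/
lemma hasDerivAt_expSeries {c : ℕ → ℝ} {M : ℝ} (hc : ∀ j, |c j| ≤ M) (t : ℝ) :
    HasDerivAt (expSeries c) (expSeries (fun j => c (j + 1)) t) t := by
  have hM : 0 ≤ M := (abs_nonneg _).trans (hc 0)
  have h := hasDerivAt_tsum_of_isPreconnected (𝕜 := ℝ)
    (u := fun j : ℕ => (j : ℝ) * (|t| + 1) ^ (j - 1) / j.factorial * M)
    (g := fun j (x : ℝ) => x ^ j / j.factorial * c j)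
    (g' := fun j (x : ℝ) => (j : ℝ) * x ^ (j - 1) / j.factorial * c j)
    (t := Metric.ball 0 (|t| + 1)) (y₀ := t) (y := t) ?_ Metric.isOpen_ball
    (convex_ball _ _).isPreconnected ?_ ?_ ?_ (summable_expSeries hc t) ?_
  · refine h.congr_deriv ?_
    rw [tsum_eq_zero_add']
    · simp only [expSeries, Nat.cast_zero, zero_mul, zero_div, zero_add, add_tsub_cancel_right]
      refine tsum_congr fun j => ?_
      rw [Nat.factorial_succ]
      have : (j.factorial : ℝ) ≠ 0 := by positivity
      push_cast
      field_simp
    · refine (summable_expSeries (c := fun j => c (j + 1)) (fun j => hc (j + 1)) t).congr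
        fun j => ?_
      rw [Nat.factorial_succ]
      have : (j.factorial : ℝ) ≠ 0 := by positivity
      simp only [add_tsub_cancel_right]
      push_cast
      field_simp
  · rw [← summable_nat_add_iff 1]
    refine ((Real.summable_pow_div_factorial (|t| + 1)).mul_right M).congr fun j => ?_
    rw [Nat.factorial_succ]
    have : (j.factorial : ℝ) ≠ 0 := by positivity
    simp only [add_tsub_cancel_right]
    push_cast
    field_simp
  · intro j y _
    exact ((hasDerivAt_pow j y).div_const _).mul_const _
  · intro j y hy
    rw [Metric.mem_ball, dist_zero_right, Real.norm_eq_abs] at hy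
    rw [Real.norm_eq_abs, abs_mul, abs_div, abs_mul, abs_pow, Nat.abs_cast, Nat.abs_cast]
    gcongr
    exact hc j
  · simp only [Metric.mem_ball, dist_zero_right, Real.norm_eq_abs]
    linarith
  · simp only [Metric.mem_ball, dist_zero_right, Real.norm_eq_abs]
    linarith

/-- Variation of constants for `y' = -x y + g`. -/
lemma ofReal_eq_add_lintegral {x : ℝ} {y g : ℝ → ℝ} (hg : Continuous g)
    (hg0 : ∀ s, 0 ≤ s → 0 ≤ g s) (hy0 : 0 ≤ y 0)
    (hy : ∀ s, HasDerivAt y (-(x * y s) + g s) s) {t : ℝ} (ht : 0 ≤ t) :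
    ENNReal.ofReal (y t) = ENNReal.ofReal (Real.exp (-(x * t))) * ENNReal.ofReal (y 0)
      + ∫⁻ r in Set.Ioc 0 t, ENNReal.ofReal (Real.exp (-(x * r))) * ENNReal.ofReal (g (t - r)) := by
  simp_rw [← ENNReal.ofReal_mul (Real.exp_nonneg _)]
  have hc : Continuous fun r : ℝ => Real.exp (-(x * r)) * g (t - r) := by fun_prop
  have hpos : ∀ r ∈ Set.Ioc 0 t, 0 ≤ Real.exp (-(x * r)) * g (t - r) := fun r hr =>
    mul_nonneg (Real.exp_nonneg _) (hg0 _ (by linarith [hr.2]))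
  rw [← ofReal_integral_eq_lintegral_ofReal
    ((hc.integrableOn_Icc (a := 0) (b := t)).mono_set Set.Ioc_subset_Icc_self)
    (by filter_upwards [ae_restrict_mem measurableSet_Ioc] with r hr using hpos r hr),
    ← ENNReal.ofReal_add (mul_nonneg (Real.exp_nonneg _) hy0)
      (setIntegral_nonneg measurableSet_Ioc hpos), ← intervalIntegral.integral_of_le ht]
  congr 1
  have hderiv : ∀ r ∈ Set.uIcc 0 t, HasDerivAt (fun r : ℝ => -(Real.exp (-(x * r)) * y (t - r)))
      (Real.exp (-(x * r)) * g (t - r)) r := by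
    intro r _
    have h1 := (((hasDerivAt_id r).const_mul x).neg).exp
    have h2 : HasDerivAt (fun r : ℝ => y (t - r)) ((-(x * y (t - r)) + g (t - r)) * (-1)) r :=
      (hy (t - r)).comp r ((hasDerivAt_id r).const_sub t)
    refine ((h1.mul h2).neg).congr_deriv ?_
    simp only [id_eq, mul_one, Pi.neg_apply]
    ring
  rw [intervalIntegral.integral_eq_sub_of_hasDerivAt hderiv (hc.intervalIntegrable _ _)]
  simp

/-! ### The position of an agent under first come, first served

Under first come, first served, the position `i + 1` of an agent is a pure death process with
rates `μ_i` (a step ahead) and `μ_{i+1} - μ_i` (service). The constant `Λ` bounds all `μ_i`. -/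

/-- Coefficients of the uniformization of the position process: `n`-th iterate of its one-step
operator on `f`. -/
noncomputable def iterPos (P : PrimitiveProcess) (Λ : ℝ) (f : ℕ → ℝ) : ℕ → ℕ → ℝ
  | 0, i => f i
  -- At i = 0 the truncated index i - 1 is harmless, since its coefficient μ_0 is 0.
  | n + 1, i => (1 - P.mu (i + 1) / Λ) * iterPos P Λ f n i
      + P.mu i / Λ * iterPos P Λ f n (i - 1)

lemma iterPos_nonneg {P : PrimitiveProcess} {Λ : ℝ} (hΛ : 0 < Λ) (hμ : ∀ k, P.mu k ≤ Λ)
    {f : ℕ → ℝ} (hf : ∀ i, 0 ≤ f i) (n i : ℕ) : 0 ≤ iterPos P Λ f n i := by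
  induction n generalizing i with
  | zero => exact hf i
  | succ n ih =>
    have h1 : P.mu (i + 1) / Λ ≤ 1 := (div_le_one hΛ).2 (hμ _)
    have h2 : 0 ≤ P.mu i / Λ := div_nonneg (P.mu_nonneg i) hΛ.le
    exact add_nonneg (mul_nonneg (by linarith) (ih i)) (mul_nonneg h2 (ih _))

/-- A step never moves the agent back and may lose her to service, so a nonnegative increasing `f`
can only decrease. -/
lemma iterPos_le {P : PrimitiveProcess} {Λ : ℝ} (hΛ : 0 < Λ) (hμ : ∀ k, P.mu k ≤ Λ)
    {f : ℕ → ℝ} (hf : ∀ i, 0 ≤ f i) (hm : Monotone f) (n i : ℕ) : iterPos P Λ f n i ≤ f i := by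
  induction n generalizing i with
  | zero => exact le_rfl
  | succ n ih =>
    have h1 : P.mu (i + 1) / Λ ≤ 1 := (div_le_one hΛ).2 (hμ _)
    have h2 : 0 ≤ P.mu i / Λ := div_nonneg (P.mu_nonneg i) hΛ.le
    have h3 : P.mu i / Λ ≤ P.mu (i + 1) / Λ :=
      div_le_div_of_nonneg_right (P.mu_mono (Nat.le_succ i)) hΛ.le
    have h4 := (ih (i - 1)).trans (hm (Nat.sub_le i 1))
    simp only [iterPos]
    have h5 := mul_le_mul_of_nonneg_left (ih i) (sub_nonneg.2 h1)
    have h6 := mul_le_mul_of_nonneg_left h4 h2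
    have h7 := mul_le_mul_of_nonneg_right h3 (hf i)
    linarith

/-- Expectation of `f` at the position of the agent after time `t`, if she is still in the
queue. -/
noncomputable def posSemigroup (P : PrimitiveProcess) (Λ : ℝ) (f : ℕ → ℝ) (t : ℝ) (i : ℕ) : ℝ :=
  Real.exp (-(Λ * t)) * expSeries (fun n => iterPos P Λ f n i) (Λ * t)

section

variable {P : PrimitiveProcess} {Λ : ℝ} {f : ℕ → ℝ}

lemma abs_iterPos_le (hΛ : 0 < Λ) (hμ : ∀ k, P.mu k ≤ Λ)
    (hf : ∀ i, 0 ≤ f i) (hm : Monotone f) (i n : ℕ) : |iterPos P Λ f n i| ≤ f i := by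
  rw [abs_of_nonneg (iterPos_nonneg hΛ hμ hf n i)]
  exact iterPos_le hΛ hμ hf hm n i

/-- The backward equation of the position chain; the uniformization rate Λ cancels. -/
lemma hasDerivAt_posSemigroup (hΛ : 0 < Λ) (hμ : ∀ k, P.mu k ≤ Λ)
    (hf : ∀ i, 0 ≤ f i) (hm : Monotone f) (t : ℝ) (i : ℕ) :
    HasDerivAt (fun t => posSemigroup P Λ f t i)
      (-(P.mu (i + 1) * posSemigroup P Λ f t i) + P.mu i * posSemigroup P Λ f t (i - 1)) t := by
  have hb := abs_iterPos_le (P := P) hΛ hμ hf hm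
  have h1 : HasDerivAt (fun t : ℝ => Λ * t) Λ t := by
    simpa using (hasDerivAt_id t).const_mul Λ
  have h2 : HasDerivAt (fun t : ℝ => Real.exp (-(Λ * t))) (Real.exp (-(Λ * t)) * -Λ) t :=
    (h1.neg).exp
  have h3 : HasDerivAt (fun t : ℝ => expSeries (fun n => iterPos P Λ f n i) (Λ * t))
      (expSeries (fun n => iterPos P Λ f (n + 1) i) (Λ * t) * Λ) t :=
    (hasDerivAt_expSeries (hb i) (Λ * t)).comp t h1
  refine (h2.mul h3).congr_deriv ?_
  have h4 : expSeries (fun n => iterPos P Λ f (n + 1) i) (Λ * t)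
      = (1 - P.mu (i + 1) / Λ) * expSeries (fun n => iterPos P Λ f n i) (Λ * t)
        + P.mu i / Λ * expSeries (fun n => iterPos P Λ f n (i - 1)) (Λ * t) := by
    simp only [expSeries, iterPos]
    rw [← tsum_mul_left, ← tsum_mul_left, ← Summable.tsum_add
      ((summable_expSeries (hb i) (Λ * t)).mul_left _)
      ((summable_expSeries (hb (i - 1)) (Λ * t)).mul_left _)]
    refine tsum_congr fun j => ?_
    ring
  rw [h4]
  simp only [posSemigroup]
  field_simp
  ring

lemma posSemigroup_zero (i : ℕ) : posSemigroup P Λ f 0 i = f i := by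
  simp only [posSemigroup, expSeries, mul_zero, neg_zero, Real.exp_zero, one_mul]
  rw [tsum_eq_single 0 (fun j hj => by simp [hj])]
  simp [iterPos]

lemma posSemigroup_nonneg (hΛ : 0 < Λ) (hμ : ∀ k, P.mu k ≤ Λ)
    (hf : ∀ i, 0 ≤ f i) {t : ℝ} (ht : 0 ≤ t) (i : ℕ) : 0 ≤ posSemigroup P Λ f t i := by
  refine mul_nonneg (Real.exp_nonneg _) (tsum_nonneg fun j => mul_nonneg ?_ ?_)
  · positivity
  · exact iterPos_nonneg hΛ hμ hf j i

lemma ofReal_posSemigroup (hΛ : 0 < Λ) (hμ : ∀ k, P.mu k ≤ Λ)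
    (hf : ∀ i, 0 ≤ f i) (hm : Monotone f) {t : ℝ} (ht : 0 ≤ t) (i : ℕ) :
    ENNReal.ofReal (posSemigroup P Λ f t i)
      = ∑' n : ℕ, ENNReal.ofReal (Real.exp (-(Λ * t)) * ((Λ * t) ^ n / n.factorial))
        * ENNReal.ofReal (iterPos P Λ f n i) := by
  have h0 : ∀ n : ℕ, 0 ≤ (Λ * t) ^ n / n.factorial := fun n => by positivity
  rw [posSemigroup, ENNReal.ofReal_mul (Real.exp_nonneg _), expSeries,
    ENNReal.ofReal_tsum_of_nonneg (fun n => mul_nonneg (h0 n) (iterPos_nonneg hΛ hμ hf n i))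
      (summable_expSeries (abs_iterPos_le hΛ hμ hf hm i) (Λ * t)), ← ENNReal.tsum_mul_left]
  refine tsum_congr fun n => ?_
  rw [ENNReal.ofReal_mul (h0 n), ENNReal.ofReal_mul (Real.exp_nonneg _), mul_assoc]

/-- The integral form with an arbitrary clock rate x ≥ μ_{i+1}. It will be used with the exit rate
of the full chain, whose excess x - μ_{i+1} comes from entries and from departures behind the agent,
which leave her position unchanged. -/
lemma ofReal_posSemigroup_eq (hΛ : 0 < Λ) (hμ : ∀ k, P.mu k ≤ Λ)
    (hf : ∀ i, 0 ≤ f i) (hm : Monotone f) {x : ℝ} {i : ℕ} (hx : P.mu (i + 1) ≤ x)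
    {t : ℝ} (ht : 0 ≤ t) :
    ENNReal.ofReal (posSemigroup P Λ f t i)
      = ENNReal.ofReal (Real.exp (-(x * t))) * ENNReal.ofReal (f i)
      + ∫⁻ r in Set.Ioc 0 t, ENNReal.ofReal (Real.exp (-(x * r)))
        * (ENNReal.ofReal (x - P.mu (i + 1)) * ENNReal.ofReal (posSemigroup P Λ f (t - r) i)
          + ENNReal.ofReal (P.mu i) * ENNReal.ofReal (posSemigroup P Λ f (t - r) (i - 1))) := by
  have hc : ∀ i, Continuous fun t => posSemigroup P Λ f t i := fun i =>
    continuous_iff_continuousAt.2 fun t => (hasDerivAt_posSemigroup hΛ hμ hf hm t i).continuousAt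
  have h := ofReal_eq_add_lintegral (x := x) (y := fun t => posSemigroup P Λ f t i)
    (g := fun t => (x - P.mu (i + 1)) * posSemigroup P Λ f t i
      + P.mu i * posSemigroup P Λ f t (i - 1))
    (((hc i).const_mul _).add ((hc (i - 1)).const_mul _))
    (fun s hs => add_nonneg (mul_nonneg (sub_nonneg.2 hx) (posSemigroup_nonneg hΛ hμ hf hs i))
      (mul_nonneg (P.mu_nonneg i) (posSemigroup_nonneg hΛ hμ hf hs _)))
    (posSemigroup_nonneg hΛ hμ hf le_rfl i)
    (fun s => (hasDerivAt_posSemigroup hΛ hμ hf hm s i).congr_deriv (by ring)) ht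
  rw [posSemigroup_zero] at h
  rw [h]
  congr 1
  refine setLIntegral_congr_fun measurableSet_Ioc fun r hr => ?_
  have htr : 0 ≤ t - r := by linarith [hr.2]
  rw [ENNReal.ofReal_add (mul_nonneg (sub_nonneg.2 hx) (posSemigroup_nonneg hΛ hμ hf htr i))
      (mul_nonneg (P.mu_nonneg i) (posSemigroup_nonneg hΛ hμ hf htr _)),
    ENNReal.ofReal_mul (sub_nonneg.2 hx), ENNReal.ofReal_mul (P.mu_nonneg i)]

end

/-! ### Duality: the likelihood ratio of positions decreases with the time in the queue -/

lemma ennreal_mul_add_mul_le {a b c d : ℝ≥0∞} (hab : a ≤ b) (hcd : c ≤ d) :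
    b * c + a * d ≤ a * c + b * d := by
  obtain ⟨x, rfl⟩ := exists_add_of_le hab
  obtain ⟨y, rfl⟩ := exists_add_of_le hcd
  calc (a + x) * c + a * (c + y) ≤ (a + x) * c + a * (c + y) + x * y := le_self_add
    _ = a * c + (a + x) * (c + y) := by ring

/-- Rearrangement inequality for a weight that decreases and a cost that increases. -/
lemma tsum_mul_le_of_antitone {e w φ : ℕ → ℝ≥0∞} {C V : ℝ≥0∞} (hw : Antitone w)
    (hφ : Monotone φ) (hwtop : w 0 ≠ ⊤) (he : ∑' i, e i ≠ ⊤) (hV : V ≠ ⊤)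
    (h : C * ∑' i, e i * φ i ≤ V * ∑' i, e i) :
    C * ∑' i, e i * w i * φ i ≤ V * ∑' i, e i * w i := by
  by_cases hall : ∀ i, C * φ i ≤ V
  · rw [← ENNReal.tsum_mul_left, ← ENNReal.tsum_mul_left]
    refine ENNReal.tsum_le_tsum fun i => ?_
    calc C * (e i * w i * φ i) = (C * φ i) * (e i * w i) := by ring
      _ ≤ V * (e i * w i) := mul_le_mul_left (hall i) _
  · push Not at hall
    classical
    set m := Nat.find hall with hm
    have hm1 : ∀ i, m ≤ i → V ≤ C * φ i := fun i hi =>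
      (Nat.find_spec hall).le.trans (mul_le_mul_right (hφ hi) C)
    have hm2 : ∀ i, i < m → C * φ i ≤ V := fun i hi => not_lt.1 (Nat.find_min hall hi)
    have key : ∀ i, C * φ i * w i + V * w m ≤ V * w i + C * φ i * w m := by
      intro i
      rcases lt_or_ge i m with hi | hi
      · rw [add_comm, add_comm (V * w i)]
        exact ennreal_mul_add_mul_le (hm2 i hi) (hw hi.le)
      · exact ennreal_mul_add_mul_le (hm1 i hi) (hw hi)
    have hfin : w m * V * ∑' i, e i ≠ ⊤ := ENNReal.mul_ne_top
      (ENNReal.mul_ne_top (ne_top_of_le_ne_top hwtop (hw (Nat.zero_le m))) hV) he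
    refine (ENNReal.add_le_add_iff_right hfin).1 ?_
    calc C * ∑' i, e i * w i * φ i + w m * V * ∑' i, e i
        = ∑' i, e i * (C * φ i * w i + V * w m) := by
          simp_rw [mul_add, ENNReal.tsum_add, ← ENNReal.tsum_mul_left]
          congr 1 <;> exact tsum_congr fun i => by ring
      _ ≤ ∑' i, e i * (V * w i + C * φ i * w m) :=
          ENNReal.tsum_le_tsum fun i => mul_le_mul_right (key i) _
      _ = V * ∑' i, e i * w i + w m * (C * ∑' i, e i * φ i) := by
          simp_rw [mul_add, ENNReal.tsum_add, ← ENNReal.tsum_mul_left]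
          congr 1 <;> exact tsum_congr fun i => by ring
      _ ≤ V * ∑' i, e i * w i + w m * (V * ∑' i, e i) := by gcongr
      _ = _ := by rw [mul_assoc]

section

variable {P : PrimitiveProcess} {Λ : ℝ} {e : ℕ → ℝ≥0∞} {l : ℕ → ℝ}

/-- The dual of the one-step operator of the position process, with respect to the entry flow. -/
noncomputable def dualStep (P : PrimitiveProcess) (Λ : ℝ) (l : ℕ → ℝ) (w : ℕ → ℝ≥0∞) (i : ℕ) :
    ℝ≥0∞ :=
  ENNReal.ofReal (1 - P.mu (i + 1) / Λ) * w i + ENNReal.ofReal (l (i + 1) / Λ) * w (i + 1)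

/-- Between i and i + 1 both steps are compared with the common value w (i + 1). What remains is the
total coefficient 1 + (l_{i+1} - μ_{i+1})/Λ, which is nonincreasing in i exactly by `hreg`. -/
lemma antitone_dualStep (hΛ : 0 < Λ) (hμ : ∀ k, P.mu k ≤ Λ) (hl : ∀ k, 0 ≤ l k)
    (hreg : ∀ i, l (i + 2) - P.mu (i + 2) ≤ l (i + 1) - P.mu (i + 1))
    {w : ℕ → ℝ≥0∞} (hw : Antitone w) : Antitone (dualStep P Λ l w) := by
  refine antitone_nat_of_succ_le fun i => ?_
  have h1 : ∀ i, 0 ≤ 1 - P.mu i / Λ := fun i => sub_nonneg.2 ((div_le_one hΛ).2 (hμ i))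
  have h2 : ∀ i, 0 ≤ l i / Λ := fun i => div_nonneg (hl i) hΛ.le
  calc dualStep P Λ l w (i + 1)
      ≤ ENNReal.ofReal (1 - P.mu (i + 2) / Λ) * w (i + 1)
        + ENNReal.ofReal (l (i + 2) / Λ) * w (i + 1) := by
        simp only [dualStep]
        gcongr
        exact hw (Nat.le_succ _)
    _ = ENNReal.ofReal (1 - P.mu (i + 2) / Λ + l (i + 2) / Λ) * w (i + 1) := by
        rw [ENNReal.ofReal_add (h1 _) (h2 _), add_mul]
    _ ≤ ENNReal.ofReal (1 - P.mu (i + 1) / Λ + l (i + 1) / Λ) * w (i + 1) := by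
        gcongr ENNReal.ofReal ?_ * _
        have := div_le_div_of_nonneg_right (hreg i) hΛ.le
        rw [sub_div, sub_div] at this
        linarith
    _ = ENNReal.ofReal (1 - P.mu (i + 1) / Λ) * w (i + 1)
        + ENNReal.ofReal (l (i + 1) / Λ) * w (i + 1) := by
        rw [ENNReal.ofReal_add (h1 _) (h2 _), add_mul]
    _ ≤ dualStep P Λ l w i := by
        simp only [dualStep]
        gcongr
        exact hw (Nat.le_succ _)

/-- Summation by parts: the relation `he` between successive entry flows moves the step ahead from
the function to the density. -/
lemma tsum_mul_iterPos_succ (hΛ : 0 < Λ) (hμ : ∀ k, P.mu k ≤ Λ)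
    (he : ∀ i, e (i + 1) * ENNReal.ofReal (P.mu (i + 1)) = e i * ENNReal.ofReal (l (i + 1)))
    {f : ℕ → ℝ} (hf : ∀ i, 0 ≤ f i) (w : ℕ → ℝ≥0∞) (n : ℕ) :
    ∑' i, e i * w i * ENNReal.ofReal (iterPos P Λ f (n + 1) i)
      = ∑' i, e i * dualStep P Λ l w i * ENNReal.ofReal (iterPos P Λ f n i) := by
  have h1 : ∀ i, 0 ≤ 1 - P.mu i / Λ := fun i => sub_nonneg.2 ((div_le_one hΛ).2 (hμ i))
  have h2 : ∀ i, 0 ≤ P.mu i / Λ := fun i => div_nonneg (P.mu_nonneg i) hΛ.le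
  have h3 := iterPos_nonneg hΛ hμ hf n
  have h4 : ∀ i, ENNReal.ofReal (iterPos P Λ f (n + 1) i)
      = ENNReal.ofReal (1 - P.mu (i + 1) / Λ) * ENNReal.ofReal (iterPos P Λ f n i)
        + ENNReal.ofReal (P.mu i / Λ) * ENNReal.ofReal (iterPos P Λ f n (i - 1)) := fun i => by
    rw [iterPos, ENNReal.ofReal_add (mul_nonneg (h1 _) (h3 _)) (mul_nonneg (h2 _) (h3 _)),
      ENNReal.ofReal_mul (h1 _), ENNReal.ofReal_mul (h2 _)]
  simp_rw [h4, dualStep, mul_add, add_mul, ENNReal.tsum_add]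
  congr 1
  · exact tsum_congr fun i => by ring
  · rw [tsum_eq_zero_add' ENNReal.summable]
    simp only [P.mu_zero, zero_div, ENNReal.ofReal_zero, zero_mul, mul_zero, zero_add,
      add_tsub_cancel_right]
    refine tsum_congr fun i => ?_
    rw [ENNReal.ofReal_div_of_pos hΛ, ENNReal.ofReal_div_of_pos hΛ, div_eq_mul_inv, div_eq_mul_inv]
    calc _ = (e (i + 1) * ENNReal.ofReal (P.mu (i + 1))) * (w (i + 1) * (ENNReal.ofReal Λ)⁻¹
          * ENNReal.ofReal (iterPos P Λ f n i)) := by ring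
      _ = _ := by
        rw [he]
        ring

/-- The statement must hold for all antitone densities `w`, because each step of the induction
replaces `w` by its dual; at n = 0 it is the rearrangement inequality. -/
lemma tsum_mul_iterPos_le (hΛ : 0 < Λ) (hμ : ∀ k, P.mu k ≤ Λ) (hl : ∀ k, 0 ≤ l k)
    (hreg : ∀ i, l (i + 2) - P.mu (i + 2) ≤ l (i + 1) - P.mu (i + 1))
    (he : ∀ i, e (i + 1) * ENNReal.ofReal (P.mu (i + 1)) = e i * ENNReal.ofReal (l (i + 1)))
    (hetop : ∑' i, e i ≠ ⊤) {φ : ℕ → ℝ} (hφ : ∀ i, 0 ≤ φ i) (hφm : Monotone φ)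
    {C V : ℝ≥0∞} (hV : V ≠ ⊤) (h : C * ∑' i, e i * ENNReal.ofReal (φ i) ≤ V * ∑' i, e i)
    (n : ℕ) {w : ℕ → ℝ≥0∞} (hw : Antitone w) (hwtop : w 0 ≠ ⊤) :
    C * ∑' i, e i * w i * ENNReal.ofReal (iterPos P Λ φ n i)
      ≤ V * ∑' i, e i * w i * ENNReal.ofReal (iterPos P Λ (fun _ => 1) n i) := by
  induction n generalizing w with
  | zero =>
    simp only [iterPos, ENNReal.ofReal_one, mul_one]
    exact tsum_mul_le_of_antitone hw (fun i j hij => ENNReal.ofReal_le_ofReal (hφm hij)) hwtop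
      hetop hV h
  | succ n ih =>
    rw [tsum_mul_iterPos_succ hΛ hμ he hφ, tsum_mul_iterPos_succ hΛ hμ he (fun _ => zero_le_one)]
    refine ih (antitone_dualStep hΛ hμ hl hreg hw) ?_
    refine ENNReal.add_ne_top.2 ⟨ENNReal.mul_ne_top ENNReal.ofReal_ne_top hwtop,
      ENNReal.mul_ne_top ENNReal.ofReal_ne_top ?_⟩
    exact ne_top_of_le_ne_top hwtop (hw (Nat.zero_le _))

/-- If the entrants' expected cost does not exceed their expected benefit, then the same holds
for those who are still in the queue after time `t`. -/
lemma tsum_mul_posSemigroup_le (hΛ : 0 < Λ) (hμ : ∀ k, P.mu k ≤ Λ) (hl : ∀ k, 0 ≤ l k)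
    (hreg : ∀ i, l (i + 2) - P.mu (i + 2) ≤ l (i + 1) - P.mu (i + 1))
    (he : ∀ i, e (i + 1) * ENNReal.ofReal (P.mu (i + 1)) = e i * ENNReal.ofReal (l (i + 1)))
    (hetop : ∑' i, e i ≠ ⊤) {φ : ℕ → ℝ} (hφ : ∀ i, 0 ≤ φ i) (hφm : Monotone φ)
    {C V : ℝ≥0∞} (hV : V ≠ ⊤) (h : C * ∑' i, e i * ENNReal.ofReal (φ i) ≤ V * ∑' i, e i)
    {t : ℝ} (ht : 0 ≤ t) :
    C * ∑' i, e i * ENNReal.ofReal (posSemigroup P Λ φ t i)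
      ≤ V * ∑' i, e i * ENNReal.ofReal (posSemigroup P Λ (fun _ => 1) t i) := by
  have hswap : ∀ (D : ℝ≥0∞) (f : ℕ → ℝ), (∀ i, 0 ≤ f i) → Monotone f →
      D * ∑' i, e i * ENNReal.ofReal (posSemigroup P Λ f t i)
        = ∑' n : ℕ, ENNReal.ofReal (Real.exp (-(Λ * t)) * ((Λ * t) ^ n / n.factorial))
          * (D * ∑' i, e i * 1 * ENNReal.ofReal (iterPos P Λ f n i)) := by
    intro D f hf hfm
    simp_rw [ofReal_posSemigroup hΛ hμ hf hfm ht, ← ENNReal.tsum_mul_left]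
    rw [ENNReal.tsum_comm]
    exact tsum_congr fun n => tsum_congr fun i => by ring
  rw [hswap C φ hφ hφm, hswap V _ (fun _ => zero_le_one) monotone_const]
  refine ENNReal.tsum_le_tsum fun n => mul_le_mul_right ?_ _
  exact tsum_mul_iterPos_le (w := fun _ => 1) hΛ hμ hl hreg he hetop hφ hφm hV h n
    antitone_const ENNReal.one_ne_top

end


/-! ### First come, first served -/

/-- First come, first served with entry rule `x` and without removals. -/
def fcfsPolicy (P : PrimitiveProcess) (x : ℕ → ℝ) : Policy where
  x := x
  y := fun _ _ => 0
  z := fun _ _ => 0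
  q := fun _ ℓ => P.mu ℓ - P.mu (ℓ - 1)

section

variable {P : PrimitiveProcess} {x : ℕ → ℝ}

lemma fcfsPolicy_zSum (k : ℕ) : (fcfsPolicy P x).zSum k = 0 := by
  simp [Policy.zSum, fcfsPolicy]

lemma fcfsPolicy_ySum (k : ℕ) : (fcfsPolicy P x).ySum k = 0 := by
  simp [Policy.ySum, fcfsPolicy]

lemma fcfsPolicy_entryExitFeasible (hx : ∀ k, x k ∈ Set.Icc (0 : ℝ) 1) :
    (fcfsPolicy P x).EntryExitFeasible where
  x_mem := hx
  y_nonneg := fun _ _ _ => le_rfl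
  z_nonneg := fun _ _ _ => le_rfl
  z_sum_le := fun k => by simp [fcfsPolicy_zSum]

lemma PrimitiveProcess.increment_nonneg (P : PrimitiveProcess) (ℓ : ℕ) :
    0 ≤ P.mu ℓ - P.mu (ℓ - 1) := sub_nonneg.2 (P.mu_mono (Nat.sub_le ℓ 1))

lemma sum_increments (P : PrimitiveProcess) (k : ℕ) :
    ∑ ℓ ∈ Finset.Icc 1 k, (P.mu ℓ - P.mu (ℓ - 1)) = P.mu k := by
  induction k with
  | zero => simp [P.mu_zero]
  | succ k ih =>
    rw [Finset.sum_Icc_succ_top (by omega), ih]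
    simp

lemma PrimitiveProcess.ServiceRegular.antitone_increment (h : P.ServiceRegular) :
    Antitone fun k => P.mu (k + 1) - P.mu k := antitone_nat_of_succ_le h

/-- By concavity any set of positions receives at most the rate of the first |S| positions. Adding
the largest element `a` last, one has |s| ≤ a - 1, so its increment is at most the increment of μ at
|s|. -/
lemma fcfsPolicy_queueingFeasible (h : P.ServiceRegular) :
    (fcfsPolicy P x).QueueingFeasible P where
  q_nonneg := fun _ ℓ _ => P.increment_nonneg ℓ
  capacity := by
    intro k S hS
    have hpos : ∀ ℓ ∈ S, 1 ≤ ℓ := fun ℓ hℓ => (Finset.mem_Icc.1 (hS hℓ)).1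
    clear hS
    simp only [fcfsPolicy]
    induction S using Finset.induction_on_max with
    | empty => simp [P.mu_zero]
    | insert a s hmax ih =>
      have ha : a ∉ s := fun h => lt_irrefl _ (hmax a h)
      rw [Finset.sum_insert ha, Finset.card_insert_of_notMem ha]
      have h1 := ih fun ℓ hℓ => hpos ℓ (Finset.mem_insert_of_mem hℓ)
      have ha1 : 1 ≤ a := hpos a (Finset.mem_insert_self _ _)
      have hcard : s.card ≤ a - 1 := by
        have hsub : s ⊆ Finset.Icc 1 (a - 1) := fun ℓ hℓ => by
          have := hmax ℓ hℓ
          have := hpos ℓ (Finset.mem_insert_of_mem hℓ)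
          rw [Finset.mem_Icc]
          omega
        simpa using Finset.card_le_card hsub
      have h2 := h.antitone_increment hcard
      simp only [Nat.sub_add_cancel ha1] at h2
      linarith
  work_conserving := fun k => sum_increments P k

/-- A function of the agent's situation that depends only on her position. -/
def posFn (v : ℕ → ℝ≥0∞) (s : ℝ≥0∞) : AgentState → ℝ≥0∞
  | .inQueue _ ℓ => v (ℓ - 1)
  | .served => s
  | .removed => 0

/-- Departures ahead of position i + 1 have total rate μ_i, those behind it μ_k - μ_{i+1}, where `d`
counts the agents behind. -/
lemma sum_increments_mul (P : PrimitiveProcess) (i d : ℕ) (s v v' : ℝ≥0∞) :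
    ∑ j ∈ Finset.Icc 1 (i + 1 + d), ENNReal.ofReal (P.mu j - P.mu (j - 1))
        * (if j = i + 1 then s else if j < i + 1 then v' else v)
      = ENNReal.ofReal (P.mu i) * v' + ENNReal.ofReal (P.mu (i + 1) - P.mu i) * s
        + ENNReal.ofReal (P.mu (i + 1 + d) - P.mu (i + 1)) * v := by
  induction d with
  | zero =>
    rw [add_zero, Finset.sum_Icc_succ_top (by omega)]
    simp only [if_true, add_tsub_cancel_right, sub_self, ENNReal.ofReal_zero, zero_mul, add_zero]
    congr 1
    rw [← sum_increments P i, ENNReal.ofReal_sum_of_nonneg (fun j _ => P.increment_nonneg j),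
      Finset.sum_mul]
    refine Finset.sum_congr rfl fun j hj => ?_
    rw [Finset.mem_Icc] at hj
    rw [if_neg (by omega), if_pos (by omega)]
  | succ d ih =>
    rw [← add_assoc, Finset.sum_Icc_succ_top (by omega), ih, if_neg (by omega), if_neg (by omega),
      add_assoc _ (_ * v), ← add_mul, add_tsub_cancel_right, ← ENNReal.ofReal_add]
    · congr 3
      ring
    · exact sub_nonneg.2 (P.mu_mono (by omega))
    · exact sub_nonneg.2 (P.mu_mono (by omega))

lemma tsum_jumpRate_fcfs (P : PrimitiveProcess) (x : ℕ → ℝ) (i d : ℕ) (v : ℕ → ℝ≥0∞)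
    (s : ℝ≥0∞) :
    ∑' c, jumpRate P (fcfsPolicy P x) (.inQueue (i + 1 + d) (i + 1)) c * posFn v s c
      = ENNReal.ofReal (P.lam (i + 1 + d) * x (i + 1 + d)) * v i
        + (ENNReal.ofReal (P.mu i) * v (i - 1) + ENNReal.ofReal (P.mu (i + 1) - P.mu i) * s
          + ENNReal.ofReal (P.mu (i + 1 + d) - P.mu (i + 1)) * v i) := by
  rw [tsum_jumpRate_mul, fcfsPolicy_zSum, ← sum_increments_mul P i d s (v i) (v (i - 1))]
  simp only [sub_zero, mul_one, posFn, add_tsub_cancel_right]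
  congr 1
  refine Finset.sum_congr rfl fun j _ => ?_
  simp only [fcfsPolicy, mul_zero, ENNReal.ofReal_zero, zero_mul, zero_add, add_zero]
  congr 1
  rcases lt_trichotomy j (i + 1) with h | h | h
  · simp [afterLeave, h, h.ne]
  · simp [afterLeave, h]
  · simp [afterLeave, h.ne', h.not_gt]

variable (hx : ∀ k, 0 ≤ x k)

include hx in
lemma totalRate_fcfs (k ℓ : ℕ) :
    totalRate P (fcfsPolicy P x) (.inQueue k ℓ) = ENNReal.ofReal (P.lam k * x k + P.mu k) := by
  rw [totalRate_inQueue, fcfsPolicy_zSum, ENNReal.ofReal_add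
    (mul_nonneg (P.lam_nonneg k) (hx k)) (P.mu_nonneg k)]
  simp only [fcfsPolicy, sub_zero, mul_one, mul_zero, ENNReal.ofReal_zero, zero_add, add_zero]
  rw [← ENNReal.ofReal_sum_of_nonneg fun j _ => P.increment_nonneg j, sum_increments]

include hx in
lemma exitRate_fcfs (k ℓ : ℕ) :
    exitRate P (fcfsPolicy P x) (.inQueue k ℓ) = P.lam k * x k + P.mu k := by
  change (totalRate P (fcfsPolicy P x) (.inQueue k ℓ)).toReal = _
  rw [totalRate_fcfs hx, ENNReal.toReal_ofReal
    (add_nonneg (mul_nonneg (P.lam_nonneg k) (hx k)) (P.mu_nonneg k))]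

/-- The situations that agents can be in when nobody is ever removed. -/
def regularStates : Set AgentState :=
  {a | a = .served ∨ ∃ i d : ℕ, a = .inQueue (i + 1 + d) (i + 1)}

/-- Tested on the indicator of the complement: the generator gives it rate zero. -/
lemma isClosedSet_regularStates : IsClosedSet P (fcfsPolicy P x) regularStates := by
  classical
  rintro a ha c hc
  rcases ha with rfl | ⟨i, d, rfl⟩
  · exact absurd rfl hc
  by_contra hcA
  have h : ∑' c, jumpRate P (fcfsPolicy P x) (.inQueue (i + 1 + d) (i + 1)) c
      * (if c ∈ regularStates then 0 else 1) = 0 := by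
    rw [tsum_jumpRate_mul, fcfsPolicy_zSum]
    have h1 : AgentState.inQueue (i + 1 + d + 1) (i + 1) ∈ regularStates :=
      Or.inr ⟨i, d + 1, rfl⟩
    rw [if_pos h1, mul_zero, zero_add]
    refine Finset.sum_eq_zero fun j hj => ?_
    rw [Finset.mem_Icc] at hj
    simp only [fcfsPolicy, mul_zero, ENNReal.ofReal_zero, zero_mul, zero_add, add_zero]
    have h2 : afterLeave (i + 1 + d - 1) (i + 1) j .served ∈ regularStates := by
      rcases lt_trichotomy j (i + 1) with h | h | h
      · refine Or.inr ⟨i - 1, d, ?_⟩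
        simp only [afterLeave, h, h.ne, if_true, if_false, AgentState.inQueue.injEq]
        omega
      · left
        simp [afterLeave, h]
      · refine Or.inr ⟨i, d - 1, ?_⟩
        simp only [afterLeave, h.ne', h.not_gt, if_false, AgentState.inQueue.injEq, and_true]
        omega
    rw [if_pos h2, mul_zero]
  have h1 := ENNReal.tsum_eq_zero.1 h c
  rw [if_neg hcA, mul_one] at h1
  exact hc h1

lemma transProb_eq_zero_of_notMem {a b : AgentState} (ha : a ∈ regularStates)
    (hb : b ∉ regularStates) {t : ℝ} (ht : 0 ≤ t) :
    transProb P (fcfsPolicy P x) t a b = 0 := by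
  classical
  have h := tsum_transProb_mul_le (P := P) (π := fcfsPolicy P x) isClosedSet_regularStates
    (f := fun c => if c ∈ regularStates then 0 else 1)
    (u := fun _ c => if c ∈ regularStates then 0 else 1) (fun a ha t _ => ?_) ha ht
  · rw [if_pos ha] at h
    have := ENNReal.tsum_eq_zero.1 (le_antisymm h zero_le) b
    simpa [hb] using this
  · rw [if_pos ha, mul_zero, zero_add]
    have h0 : ∑' c, jumpRate P (fcfsPolicy P x) a c
        * (if c ∈ regularStates then (0 : ℝ≥0∞) else 1) = 0 := by
      rw [ENNReal.tsum_eq_zero]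
      intro c
      by_cases hc : c ∈ regularStates
      · simp [hc]
      · have : jumpRate P (fcfsPolicy P x) a c = 0 := by
          by_contra h
          exact hc (isClosedSet_regularStates a ha c h)
        simp [this]
    simp only [h0, mul_zero, lintegral_zero, le_refl]

lemma posSemigroup_one_le {Λ : ℝ} (hΛ : 0 < Λ) (hμ : ∀ k, P.mu k ≤ Λ) {t : ℝ} (ht : 0 ≤ t)
    (i : ℕ) : posSemigroup P Λ (fun _ => 1) t i ≤ 1 := by
  have h1 : expSeries (fun n => iterPos P Λ (fun _ => 1) n i) (Λ * t) ≤ Real.exp (Λ * t) := by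
    rw [Real.exp_eq_exp_ℝ, NormedSpace.exp_eq_tsum_div, expSeries]
    refine Summable.tsum_le_tsum (fun n => ?_) (summable_expSeries
      (abs_iterPos_le hΛ hμ (fun _ => zero_le_one) monotone_const i) _)
      (Real.summable_pow_div_factorial _)
    refine mul_le_of_le_one_right (by positivity) ?_
    exact iterPos_le hΛ hμ (fun _ => zero_le_one) monotone_const n i
  calc posSemigroup P Λ (fun _ => 1) t i ≤ Real.exp (-(Λ * t)) * Real.exp (Λ * t) :=
        mul_le_mul_of_nonneg_left h1 (Real.exp_nonneg _)
    _ = 1 := by rw [← Real.exp_add]; simp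

-- Events behind the agent return the same value, so a function of the position alone solves the
-- backward equation of the full chain, whatever the queue length.
include hx in
lemma posSemigroup_backward {Λ : ℝ} (hΛ : 0 < Λ) (hμ : ∀ k, P.mu k ≤ Λ)
    {f : ℕ → ℝ} (hf : ∀ i, 0 ≤ f i) (hm : Monotone f) {a : AgentState} (ha : a ∈ regularStates)
    {t : ℝ} (ht : 0 ≤ t) :
    posFn (fun i => ENNReal.ofReal (posSemigroup P Λ f t i)) 0 a
      = ENNReal.ofReal (Real.exp (-(exitRate P (fcfsPolicy P x) a * t)))
          * posFn (fun i => ENNReal.ofReal (f i)) 0 a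
        + ∫⁻ r in Set.Ioc 0 t, ENNReal.ofReal (Real.exp (-(exitRate P (fcfsPolicy P x) a * r)))
          * ∑' c, jumpRate P (fcfsPolicy P x) a c
            * posFn (fun i => ENNReal.ofReal (posSemigroup P Λ f (t - r) i)) 0 c := by
  rcases ha with rfl | ⟨i, d, rfl⟩
  · simp [posFn, jumpRate]
  · have h1 : 0 ≤ P.lam (i + 1 + d) * x (i + 1 + d) := mul_nonneg (P.lam_nonneg _) (hx _)
    have h2 : P.mu (i + 1) ≤ P.mu (i + 1 + d) := P.mu_mono (by omega)
    rw [exitRate_fcfs hx]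
    simp only [tsum_jumpRate_fcfs]
    simp only [posFn, add_tsub_cancel_right]
    rw [ofReal_posSemigroup_eq hΛ hμ hf hm
      (x := P.lam (i + 1 + d) * x (i + 1 + d) + P.mu (i + 1 + d)) (by linarith) ht]
    congr 1
    refine lintegral_congr fun r => ?_
    congr 1
    rw [add_sub_assoc, ENNReal.ofReal_add h1 (by linarith)]
    ring

include hx in
lemma tsum_transProb_mul_posFn_le {Λ : ℝ} (hΛ : 0 < Λ) (hμ : ∀ k, P.mu k ≤ Λ)
    {f : ℕ → ℝ} (hf : ∀ i, 0 ≤ f i) (hm : Monotone f) (i d : ℕ) {t : ℝ} (ht : 0 ≤ t) :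
    ∑' b, transProb P (fcfsPolicy P x) t (.inQueue (i + 1 + d) (i + 1)) b
        * posFn (fun i => ENNReal.ofReal (f i)) 0 b
      ≤ ENNReal.ofReal (posSemigroup P Λ f t i) :=
  tsum_transProb_mul_le isClosedSet_regularStates
    (u := fun t => posFn (fun i => ENNReal.ofReal (posSemigroup P Λ f t i)) 0)
    (fun _ ha _ ht => (posSemigroup_backward hx hΛ hμ hf hm ha ht).ge)
    (Or.inr ⟨i, d, rfl⟩) ht

variable {L : ℝ} (hL : ∀ k, P.lam k * x k ≤ L)

include hx hL in
lemma totalRate_fcfs_le {Λ : ℝ} (hμ : ∀ k, P.mu k ≤ Λ) {a : AgentState}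
    (ha : a ∈ regularStates) : totalRate P (fcfsPolicy P x) a ≤ ENNReal.ofReal (L + Λ) := by
  rcases ha with rfl | ⟨i, d, rfl⟩
  · simp [totalRate, jumpRate]
  · rw [totalRate_fcfs hx]
    exact ENNReal.ofReal_le_ofReal (add_le_add (hL _) (hμ _))

-- The converse bound for f = 1. Together with minimality, uniqueness under bounded rates identifies
-- the survival probability with that of the position chain.
include hx hL in
lemma le_tsum_transProb_mul_posFn {Λ : ℝ} (hΛ : 0 < Λ) (hμ : ∀ k, P.mu k ≤ Λ)
    (i d : ℕ) {t : ℝ} (ht : 0 ≤ t) :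
    ENNReal.ofReal (posSemigroup P Λ (fun _ => 1) t i)
      ≤ ∑' s, transProb P (fcfsPolicy P x) t (.inQueue (i + 1 + d) (i + 1)) (queued s) := by
  have hL0 : 0 ≤ L := (mul_nonneg (P.lam_nonneg 0) (hx 0)).trans (hL 0)
  have h := le_tsum_transProb_mul (P := P) (π := fcfsPolicy P x) isClosedSet_regularStates
    (Λ := L + Λ) (by linarith) (fun a ha => totalRate_fcfs_le hx hL hμ ha)
    (u := fun t => posFn (fun i => ENNReal.ofReal (posSemigroup P Λ (fun _ => 1) t i)) 0)
    (fun a ha t ht => ?_)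
    (fun _ ha _ ht => (posSemigroup_backward hx hΛ hμ (fun _ => zero_le_one)
      monotone_const ha ht).le) (a := .inQueue (i + 1 + d) (i + 1)) (Or.inr ⟨i, d, rfl⟩) ht
  · rw [tsum_eq_tsum_queued (by simp [posFn]) (by simp [posFn])] at h
    simpa [posFn, queued] using h
  · rcases ha with rfl | ⟨i, d, rfl⟩
    · simp [posFn]
    · simpa [posFn] using posSemigroup_one_le hΛ hμ ht i

/-- Expected remaining time in the queue under first come, first served. -/
noncomputable def fcfsWait (P : PrimitiveProcess) (i : ℕ) : ℝ := (i + 1) / P.mu (i + 1)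

lemma fcfsWait_nonneg (i : ℕ) : 0 ≤ fcfsWait P i :=
  div_nonneg (by positivity) (P.mu_nonneg _)

/-- For a concave μ with μ_0 = 0 the next increment is at most the average of the earlier ones;
hence k/μ_k is nondecreasing. -/
lemma PrimitiveProcess.ServiceRegular.increment_le (h : P.ServiceRegular) (i : ℕ) :
    (i + 1) * (P.mu (i + 2) - P.mu (i + 1)) ≤ P.mu (i + 1) := by
  induction i with
  | zero =>
    have := h 0
    simp only [P.mu_zero] at this
    simp only [Nat.cast_zero, zero_add, one_mul] at *
    linarith
  | succ i ih =>
    have h1 := h (i + 1)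
    push_cast
    nlinarith [h1, ih, mul_le_mul_of_nonneg_left h1 (by positivity : (0 : ℝ) ≤ (i : ℝ) + 2)]

lemma monotone_fcfsWait (h : P.ServiceRegular) : Monotone (fcfsWait P) := by
  refine monotone_nat_of_le_succ fun i => ?_
  have h1 := h.increment_le i
  have h2 := P.mu_pos (i + 1) (by omega)
  have h3 := P.mu_pos (i + 2) (by omega)
  simp only [fcfsWait]
  rw [div_le_div_iff₀ h2 h3]
  push_cast
  linarith

-- The candidate solves μ_{i+1} φ_i = 1 + μ_i φ_{i-1}, that is μ_{i+1} φ_i = i + 1; events behind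
-- the agent drop out.
include hx in
lemma waitTime_fcfs_le (i d : ℕ) :
    waitTime P (fcfsPolicy P x) (i + 1 + d) (i + 1) ≤ ENNReal.ofReal (fcfsWait P i) := by
  have h := waitTime_le (P := P) (π := fcfsPolicy P x) isClosedSet_regularStates
    (φ := posFn (fun i => ENNReal.ofReal (fcfsWait P i)) 0) ?_
    (k := i + 1 + d) (ℓ := i + 1) (Or.inr ⟨i, d, rfl⟩)
  · simpa [posFn] using h
  · rintro k ℓ (h | ⟨i, d, h⟩)
    · simp at h
    · rw [h, tsum_jumpRate_fcfs, totalRate_fcfs hx]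
      simp only [posFn, add_tsub_cancel_right, mul_zero, add_zero]
      have h0 := P.mu_pos (i + 1 + d) (by omega)
      have h0' := P.mu_pos (i + 1) (by omega)
      have h1 : 0 ≤ P.lam (i + 1 + d) * x (i + 1 + d) := mul_nonneg (P.lam_nonneg _) (hx _)
      have h2 : 0 ≤ P.mu (i + 1 + d) - P.mu (i + 1) := sub_nonneg.2 (P.mu_mono (by omega))
      have h3 := fcfsWait_nonneg (P := P)
      have h4 := P.mu_nonneg i
      rw [← ENNReal.ofReal_mul h1, ← ENNReal.ofReal_mul h2, ← ENNReal.ofReal_mul h4,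
        ← ENNReal.ofReal_add (mul_nonneg h4 (h3 _)) (mul_nonneg h2 (h3 _)),
        ← ENNReal.ofReal_add (mul_nonneg h1 (h3 _))
          (add_nonneg (mul_nonneg h4 (h3 _)) (mul_nonneg h2 (h3 _))), ← ENNReal.ofReal_one,
        ← ENNReal.ofReal_add zero_le_one (add_nonneg (mul_nonneg h1 (h3 _))
          (add_nonneg (mul_nonneg h4 (h3 _)) (mul_nonneg h2 (h3 _)))),
        ← ENNReal.ofReal_inv_of_pos (by linarith), ← ENNReal.ofReal_mul
          (inv_nonneg.2 (by linarith))]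
      refine ENNReal.ofReal_le_ofReal ?_
      rw [inv_mul_le_iff₀ (by linarith)]
      have h5 : P.mu i * fcfsWait P (i - 1) = i := by
        cases i with
        | zero => simp [P.mu_zero]
        | succ j =>
          have := (P.mu_pos (j + 1) (by omega)).ne'
          simp only [fcfsWait, add_tsub_cancel_right]
          push_cast
          field_simp
      have h6 : P.mu (i + 1) * fcfsWait P i = i + 1 := by
        simp only [fcfsWait]
        field_simp
      rw [h5]
      linarith

include hx hL in
lemma one_le_serviceProb_fcfs {Λ : ℝ} (hΛ : 0 < Λ) (hμ : ∀ k, P.mu k ≤ Λ) (i d : ℕ) :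
    1 ≤ serviceProb P (fcfsPolicy P x) (i + 1 + d) (i + 1) := by
  set a := AgentState.inQueue (i + 1 + d) (i + 1) with ha
  have haA : a ∈ regularStates := Or.inr ⟨i, d, rfl⟩
  have hL0 : 0 ≤ L := (mul_nonneg (P.lam_nonneg 0) (hx 0)).trans (hL 0)
  by_contra hlt
  rw [not_le] at hlt
  set σ := serviceProb P (fcfsPolicy P x) (i + 1 + d) (i + 1) with hσ
  have hW : ∀ t : ℝ, 0 ≤ t → 1 - σ ≤ ∑' s, transProb P (fcfsPolicy P x) t a (queued s) := by
    intro t ht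
    have h1 := one_le_tsum_transProb (P := P) (π := fcfsPolicy P x) isClosedSet_regularStates
      (Λ := L + Λ) (by linarith) (fun a ha => totalRate_fcfs_le hx hL hμ ha) haA ht
    -- Split the mass at time `t` into served, removed and still in the queue.
    have h2 : ∀ b, transProb P (fcfsPolicy P x) t a b
        = transProb P (fcfsPolicy P x) t a b * ind b .served
          + (transProb P (fcfsPolicy P x) t a b * ind b .removed
          + transProb P (fcfsPolicy P x) t a b * posFn (fun _ => 1) 0 b) := by
      intro b
      cases b <;> simp [ind, posFn]
    have h3 : transProb P (fcfsPolicy P x) t a .removed = 0 :=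
      transProb_eq_zero_of_notMem haA (by simp [regularStates]) ht
    rw [tsum_congr h2, ENNReal.tsum_add, ENNReal.tsum_add, tsum_mul_ind, tsum_mul_ind, h3,
      zero_add, tsum_eq_tsum_queued (by simp [posFn]) (by simp [posFn])] at h1
    simp only [posFn, queued, mul_one] at h1
    rw [tsub_le_iff_left]
    refine h1.trans (add_le_add ?_ le_rfl)
    exact le_iSup (fun t : ℝ≥0 => transProb P (fcfsPolicy P x) t a .served) ⟨t, ht⟩
  have h4 := waitTime_fcfs_le (P := P) hx i d
  have h5 : ∫⁻ _ in Set.Ioi (0 : ℝ), (1 - σ) ≤ waitTime P (fcfsPolicy P x) (i + 1 + d) (i + 1) :=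
    setLIntegral_mono' measurableSet_Ioi fun t ht => hW t (le_of_lt ht)
  rw [lintegral_const, Measure.restrict_apply MeasurableSet.univ, Set.univ_inter, Real.volume_Ioi,
    ENNReal.mul_top (tsub_pos_of_lt hlt).ne', top_le_iff] at h5
  rw [h5, top_le_iff] at h4
  exact ENNReal.ofReal_ne_top h4

end


/-! ### Feasibility of first come, first served without information -/

section

variable {P : PrimitiveProcess} {x p : ℕ → ℝ}

/-- Balance under first come, first served, with the flow of entries on both sides. -/
structure IsFCFSInvariant (P : PrimitiveProcess) (x p : ℕ → ℝ) : Prop where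
  nonneg : ∀ k, 0 ≤ p k
  hasSum_one : HasSum p 1
  balance : ∀ k, P.lam k * x k * p k = P.mu (k + 1) * p (k + 1)

lemma IsFCFSInvariant.isInvariant (hp : IsFCFSInvariant P x p) :
    IsInvariant P (fcfsPolicy P x) p where
  nonneg := hp.nonneg
  hasSum_one := hp.hasSum_one
  balance := fun k => by
    rw [fcfsPolicy_zSum, fcfsPolicy_ySum, sub_zero, mul_one, add_zero]
    exact hp.balance k

/-- Flow of agents who start at position `i + 1`. -/
noncomputable def entryAt (P : PrimitiveProcess) (p : ℕ → ℝ) (i : ℕ) : ℝ≥0∞ :=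
  ENNReal.ofReal (p (i + 1) * P.mu (i + 1))

lemma tsum_entryFlow_mul (hp : IsFCFSInvariant P x p) (g : ℕ × ℕ → ℝ≥0∞) :
    ∑' s, entryFlow P (fcfsPolicy P x) p s * g s = ∑' i, entryAt P p i * g (i + 1, i + 1) := by
  have h : ∀ s, entryFlow P (fcfsPolicy P x) p s
      = ∑' i, entryAt P p i * ind (i + 1, i + 1) s := by
    intro s
    refine tsum_congr fun i => ?_
    rw [fcfsPolicy_zSum, entryAt, mul_comm (p (i + 1)), ← hp.balance]
    simp only [sub_zero, mul_one, mul_zero, ENNReal.ofReal_zero, zero_mul, add_zero]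
    congr 2
    simp only [fcfsPolicy]
    ring
  simp_rw [h, ← ENNReal.tsum_mul_right]
  rw [ENNReal.tsum_comm]
  refine tsum_congr fun i => ?_
  simp_rw [mul_assoc, ENNReal.tsum_mul_left, tsum_ind_mul]

lemma stayFlow_fcfs (hp : IsFCFSInvariant P x p) (t : ℝ) (s : ℕ × ℕ) :
    stayFlow P (fcfsPolicy P x) p t s = ∑' i, entryAt P p i
      * transProb P (fcfsPolicy P x) t (.inQueue (i + 1) (i + 1)) (queued s) :=
  tsum_entryFlow_mul hp fun s₀ => transProb P (fcfsPolicy P x) t (.inQueue s₀.1 s₀.2) (queued s)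

lemma tsum_stayFlow_mul (hp : IsFCFSInvariant P x p) (t : ℝ) (g : ℕ × ℕ → ℝ≥0∞) :
    ∑' s, stayFlow P (fcfsPolicy P x) p t s * g s = ∑' i, entryAt P p i
      * ∑' s, transProb P (fcfsPolicy P x) t (.inQueue (i + 1) (i + 1)) (queued s) * g s := by
  simp_rw [stayFlow_fcfs hp, ← ENNReal.tsum_mul_right]
  rw [ENNReal.tsum_comm]
  simp_rw [← ENNReal.tsum_mul_left, mul_assoc]

lemma stayFlow_eq_zero (hp : IsFCFSInvariant P x p) {t : ℝ} (ht : 0 ≤ t) {s : ℕ × ℕ}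
    (hs : queued s ∉ regularStates) : stayFlow P (fcfsPolicy P x) p t s = 0 := by
  rw [stayFlow_fcfs hp, ENNReal.tsum_eq_zero]
  intro i
  rw [transProb_eq_zero_of_notMem (Or.inr ⟨i, 0, rfl⟩) hs ht, mul_zero]

lemma tsum_entryAt (P : PrimitiveProcess) (p : ℕ → ℝ) :
    ∑' i, entryAt P p i = serviceFlow P p := by
  have h := tsum_eq_zero_add' (f := fun k => ENNReal.ofReal (p k * P.mu k)) ENNReal.summable
  rw [P.mu_zero, mul_zero, ENNReal.ofReal_zero, zero_add] at h
  exact h.symm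

lemma serviceFlow_ne_top (hp : Summable p) (hp0 : ∀ k, 0 ≤ p k) : serviceFlow P p ≠ ⊤ := by
  obtain ⟨B, hB⟩ := P.mu_bounded
  refine Summable.tsum_ofReal_ne_top ?_
  exact Summable.of_nonneg_of_le (fun k => mul_nonneg (hp0 k) (P.mu_nonneg k))
    (fun k => mul_le_mul_of_nonneg_left (hB k) (hp0 k)) (hp.mul_right B)

/-- The service rate cancels: p_{i+1} μ_{i+1} · (i+1)/μ_{i+1} = (i+1) p_{i+1}. The constraint of the
relaxed problem therefore has the form of the duality hypothesis at t = 0. -/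
lemma tsum_entryAt_mul_fcfsWait (hp : ∀ k, 0 ≤ p k) :
    ∑' i, entryAt P p i * ENNReal.ofReal (fcfsWait P i) = meanLength p := by
  have hs := tsum_eq_zero_add' (f := fun k : ℕ => ENNReal.ofReal (p k * k)) ENNReal.summable
  rw [Nat.cast_zero, mul_zero, ENNReal.ofReal_zero, zero_add] at hs
  rw [meanLength, hs]
  refine tsum_congr fun i => ?_
  have h := P.mu_pos (i + 1) (by omega)
  rw [entryAt, ← ENNReal.ofReal_mul (mul_nonneg (hp _) h.le), fcfsWait]
  congr 1
  push_cast
  field_simp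

lemma stayMass_le (hp : IsFCFSInvariant P x p) {A : ℝ≥0∞} {t : ℝ}
    (h : ∀ i, ∑' s, transProb P (fcfsPolicy P x) t (.inQueue (i + 1) (i + 1)) (queued s) ≤ A) :
    stayMass P (fcfsPolicy P x) p t ≤ serviceFlow P p * A := by
  have := tsum_stayFlow_mul hp t (fun _ => 1)
  simp only [mul_one] at this
  rw [stayMass, this, ← tsum_entryAt, ← ENNReal.tsum_mul_right]
  exact ENNReal.tsum_le_tsum fun i => mul_le_mul_right (h i) _

lemma stayMass_ne_top (hx : ∀ k, 0 ≤ x k) (hp : IsFCFSInvariant P x p) {t : ℝ} (ht : 0 ≤ t) :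
    stayMass P (fcfsPolicy P x) p t ≠ ⊤ := by
  obtain ⟨B, hB⟩ := P.mu_bounded
  have hB0 : 0 < B := (P.mu_pos 1 le_rfl).trans_le (hB 1)
  refine ne_top_of_le_ne_top (ENNReal.mul_ne_top
    (serviceFlow_ne_top hp.hasSum_one.summable hp.nonneg) ENNReal.one_ne_top)
    (stayMass_le (A := 1) hp fun i => ?_)
  have h := tsum_transProb_mul_posFn_le hx hB0 hB (fun _ => zero_le_one) monotone_const i 0 ht
  rw [tsum_eq_tsum_queued (by simp [posFn]) (by simp [posFn])] at h
  simp only [posFn, queued, add_zero, ENNReal.ofReal_one, mul_one] at h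
  refine h.trans ?_
  rw [ENNReal.ofReal_le_one]
  exact posSemigroup_one_le hB0 hB ht i

/-- Obedience of agents who have spent time `t` in the queue and know nothing else. -/
lemma tsum_stayFlow_mul_waitTime_le (hreg : P.ServiceRegular) (hx : ∀ k, 0 ≤ x k)
    {L : ℝ} (hL : ∀ k, P.lam k * x k ≤ L)
    (hdec : ∀ i, P.lam (i + 2) * x (i + 2) - P.mu (i + 2)
      ≤ P.lam (i + 1) * x (i + 1) - P.mu (i + 1))
    (hp : IsFCFSInvariant P x p) {C V : ℝ≥0∞} (hV : V ≠ ⊤)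
    (h : C * meanLength p ≤ V * serviceFlow P p) {t : ℝ} (ht : 0 ≤ t) :
    C * ∑' s, stayFlow P (fcfsPolicy P x) p t s * waitTime P (fcfsPolicy P x) s.1 s.2
      ≤ V * ∑' s, stayFlow P (fcfsPolicy P x) p t s
        * serviceProb P (fcfsPolicy P x) s.1 s.2 := by
  obtain ⟨B, hB⟩ := P.mu_bounded
  have hB0 : 0 < B := (P.mu_pos 1 le_rfl).trans_le (hB 1)
  have h1 : ∑' s, stayFlow P (fcfsPolicy P x) p t s * waitTime P (fcfsPolicy P x) s.1 s.2
      ≤ ∑' i, entryAt P p i * ENNReal.ofReal (posSemigroup P B (fcfsWait P) t i) := by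
    calc _ ≤ ∑' s, stayFlow P (fcfsPolicy P x) p t s
          * posFn (fun i => ENNReal.ofReal (fcfsWait P i)) 0 (queued s) := by
          refine ENNReal.tsum_le_tsum fun s => ?_
          by_cases hs : queued s ∈ regularStates
          · refine mul_le_mul_right ?_ _
            rcases hs with hs | ⟨i, d, hs⟩
            · simp [queued] at hs
            · obtain ⟨k, ℓ⟩ := s
              simp only [queued, AgentState.inQueue.injEq] at hs
              obtain ⟨rfl, rfl⟩ := hs
              simpa [posFn, queued] using waitTime_fcfs_le hx i d
          · rw [stayFlow_eq_zero hp ht hs, zero_mul, zero_mul]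
      _ ≤ _ := by
          rw [tsum_stayFlow_mul hp]
          refine ENNReal.tsum_le_tsum fun i => mul_le_mul_right ?_ _
          rw [← tsum_eq_tsum_queued (g := fun b => transProb P (fcfsPolicy P x) t
            (.inQueue (i + 1) (i + 1)) b * posFn (fun i => ENNReal.ofReal (fcfsWait P i)) 0 b)
            (by simp [posFn]) (by simp [posFn])]
          exact tsum_transProb_mul_posFn_le hx hB0 hB fcfsWait_nonneg (monotone_fcfsWait hreg)
            i 0 ht
  -- Benefit side, bounded from below: everyone still in the queue is served with probability 1.
  have h2 : ∑' i, entryAt P p i * ENNReal.ofReal (posSemigroup P B (fun _ => 1) t i)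
      ≤ ∑' s, stayFlow P (fcfsPolicy P x) p t s * serviceProb P (fcfsPolicy P x) s.1 s.2 := by
    calc _ ≤ ∑' s, stayFlow P (fcfsPolicy P x) p t s * 1 := by
          rw [tsum_stayFlow_mul hp]
          refine ENNReal.tsum_le_tsum fun i => mul_le_mul_right ?_ _
          simpa using le_tsum_transProb_mul_posFn hx hL hB0 hB i 0 ht
      _ ≤ _ := by
          refine ENNReal.tsum_le_tsum fun s => ?_
          by_cases hs : queued s ∈ regularStates
          · refine mul_le_mul_right ?_ _
            rcases hs with hs | ⟨i, d, hs⟩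
            · simp [queued] at hs
            · obtain ⟨k, ℓ⟩ := s
              simp only [queued, AgentState.inQueue.injEq] at hs
              obtain ⟨rfl, rfl⟩ := hs
              exact one_le_serviceProb_fcfs hx hL hB0 hB i d
          · rw [stayFlow_eq_zero hp ht hs, zero_mul, zero_mul]
  refine (mul_le_mul_right h1 C).trans (le_trans ?_ (mul_le_mul_right h2 V))
  refine tsum_mul_posSemigroup_le (l := fun k => P.lam k * x k) hB0 hB
    (fun k => mul_nonneg (P.lam_nonneg k) (hx k)) hdec (fun i => ?_) ?_ fcfsWait_nonneg
    (monotone_fcfsWait hreg) hV ?_ ht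
  · have h3 := hp.nonneg
    have h4 := P.mu_nonneg
    rw [entryAt, entryAt, ← ENNReal.ofReal_mul (mul_nonneg (h3 _) (h4 _)),
      ← ENNReal.ofReal_mul (mul_nonneg (h3 _) (h4 _)), mul_comm (p (i + 1 + 1)), ← hp.balance]
    congr 1
    ring
  · rw [tsum_entryAt]
    exact serviceFlow_ne_top hp.hasSum_one.summable hp.nonneg
  · rwa [tsum_entryAt_mul_fcfsWait hp.nonneg, tsum_entryAt]

/-- The belief of an agent who is sure to be alone in the queue. -/
noncomputable def firstBelief : Belief :=
  ⟨ind (1, 1), by simpa using tsum_ind_mul ((1, 1) : ℕ × ℕ) (fun _ => 1)⟩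

lemma tsum_bayesBelief (π : Policy) {t : ℝ} (h0 : 0 < stayMass P π p t)
    (htop : stayMass P π p t ≠ ⊤) : ∑' s, bayesBelief P π p t s = 1 := by
  simp only [bayesBelief, div_eq_mul_inv]
  rw [ENNReal.tsum_mul_right]
  exact ENNReal.mul_inv_cancel h0.ne' htop

open Classical in
/-- The no-information rule. -/
noncomputable def noInfo (P : PrimitiveProcess) (π : Policy) (p : ℕ → ℝ) : InfoRule := fun t =>
  ⟨Measure.dirac (if h : ∑' s, bayesBelief P π p t s = 1 then ⟨bayesBelief P π p t, h⟩
    else firstBelief), Measure.dirac.isProbabilityMeasure⟩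

lemma exists_noInfo_feasible (hreg : P.ServiceRegular) (w : Payoffs)
    (hx : ∀ k, x k ∈ Set.Icc (0 : ℝ) 1)
    {L : ℝ} (hL : ∀ k, P.lam k ≤ L)
    (hdec : ∀ i, P.lam (i + 2) * x (i + 2) - P.mu (i + 2)
      ≤ P.lam (i + 1) * x (i + 1) - P.mu (i + 1))
    (hp : IsFCFSInvariant P x p)
    (h : ENNReal.ofReal w.C * meanLength p ≤ ENNReal.ofReal w.V * serviceFlow P p) :
    ∃ I, IsFeasible P w ⟨p, fcfsPolicy P x, I⟩ ∧ IsNoInformation P (fcfsPolicy P x) p I := by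
  have hx0 : ∀ k, 0 ≤ x k := fun k => (hx k).1
  set π := fcfsPolicy P x with hπ
  -- When somebody is still in the queue the mass is positive and finite, so the Bayes belief is
  -- normalized and `noInfo` does not take its default value.
  have hI : ∀ t : ℝ≥0, 0 < stayMass P π p t → ∃ γ : Belief, (∀ s, γ.1 s = bayesBelief P π p t s) ∧
      (noInfo P π p t : Measure Belief) = Measure.dirac γ := by
    intro t ht
    have h1 := tsum_bayesBelief π ht (stayMass_ne_top hx0 hp t.2)
    refine ⟨⟨bayesBelief P π p t, h1⟩, fun s => rfl, ?_⟩
    simp only [noInfo, h1, dif_pos, ProbabilityMeasure.coe_mk]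
  refine ⟨noInfo P π p, ⟨fcfsPolicy_entryExitFeasible hx, fcfsPolicy_queueingFeasible hreg,
    hp.isInvariant, ?_, ?_⟩, hI⟩
  · intro t ht s
    obtain ⟨γ, hγ, hd⟩ := hI t ht
    change ∫⁻ γ : Belief, γ.1 s ∂(noInfo P π p t : Measure Belief) = _
    rw [hd, lintegral_dirac' _ ((measurable_pi_apply s).comp measurable_subtype_coe)]
    exact hγ s
  · intro t ht γ' hγ'
    obtain ⟨γ, hγ, hd⟩ := hI t ht
    change γ' ∈ (noInfo P π p t : Measure Belief).support at hγ'
    rw [hd] at hγ'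
    have hγγ : γ' = γ := by
      have hsub := Measure.support_subset_of_isClosed (μ := Measure.dirac γ) (t := {γ})
        isClosed_singleton (by rw [mem_ae_dirac_iff (measurableSet_singleton γ)]; rfl)
      exact hsub hγ'
    subst hγγ
    have hL' : ∀ k, P.lam k * x k ≤ L := fun k =>
      (mul_le_of_le_one_right (P.lam_nonneg k) (hx k).2).trans (hL k)
    have key := tsum_stayFlow_mul_waitTime_le hreg hx0 hL' hdec hp ENNReal.ofReal_ne_top h t.2
    have hsum : ∀ g : ℕ × ℕ → ℝ≥0∞, ∑' s, γ'.1 s * g s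
        = (∑' s, stayFlow P π p t s * g s) * (stayMass P π p t)⁻¹ := by
      intro g
      rw [← ENNReal.tsum_mul_right]
      refine tsum_congr fun s => ?_
      rw [hγ, bayesBelief, div_eq_mul_inv]
      ring
    change ENNReal.ofReal w.C * ∑' s : ℕ × ℕ, γ'.1 s * waitTime P π s.1 s.2
      ≤ ENNReal.ofReal w.V * ∑' s : ℕ × ℕ, γ'.1 s * serviceProb P π s.1 s.2
    rw [hsum fun s => waitTime P π s.1 s.2, hsum fun s => serviceProb P π s.1 s.2, ← mul_assoc,
      ← mul_assoc]
    exact mul_le_mul_left key _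

end


/-! ### The relaxed linear program -/

/-! ### Concavity of the service process and single crossing -/

section Concavity

variable {P : PrimitiveProcess}

lemma PrimitiveProcess.ServiceRegular.mul_increment_le (h : P.ServiceRegular) {i j : ℕ}
    (hij : i ≤ j) : ((j : ℝ) - i) * (P.mu (j + 1) - P.mu j) ≤ P.mu j - P.mu i := by
  induction j, hij using Nat.le_induction with
  | base => simp
  | succ j hij ih =>
    have h1 := h j
    have h2 : (0 : ℝ) ≤ (j : ℝ) - i := sub_nonneg.2 (by exact_mod_cast hij)
    have h3 := mul_le_mul_of_nonneg_left h1 (by linarith : (0 : ℝ) ≤ (j : ℝ) - i + 1)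
    push_cast
    have h4 : (j : ℝ) + 1 - i = (j : ℝ) - i + 1 := by ring
    rw [h4]
    linarith

lemma PrimitiveProcess.ServiceRegular.sub_le_mul_increment (h : P.ServiceRegular) {j k : ℕ}
    (hjk : j ≤ k) : P.mu k - P.mu j ≤ ((k : ℝ) - j) * (P.mu (j + 1) - P.mu j) := by
  induction k, hjk using Nat.le_induction with
  | base => simp
  | succ k hjk ih =>
    have h1 := h.antitone_increment hjk
    simp only at h1
    push_cast
    linarith

/-- Slopes of chords of the service process decrease. -/
lemma PrimitiveProcess.ServiceRegular.chord_le (h : P.ServiceRegular) {i j k : ℕ}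
    (hij : i ≤ j) (hjk : j ≤ k) :
    (P.mu k - P.mu j) * ((j : ℝ) - i) ≤ (P.mu j - P.mu i) * ((k : ℝ) - j) := by
  have h1 := h.mul_increment_le hij
  have h2 := h.sub_le_mul_increment hjk
  have h3 : (0 : ℝ) ≤ (j : ℝ) - i := sub_nonneg.2 (by exact_mod_cast hij)
  have h4 : (0 : ℝ) ≤ (k : ℝ) - j := sub_nonneg.2 (by exact_mod_cast hjk)
  nlinarith [mul_le_mul_of_nonneg_right h2 h3, mul_le_mul_of_nonneg_right h1 h4]

/-- A signed measure that is positive, then negative, then positive, and does not change mass and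
mean service rate, does not decrease the mean queue length. -/
lemma mean_nonneg_of_crossing (hreg : P.ServiceRegular) {D : ℕ → ℝ} {Δ : ℝ} {n : ℕ}
    (h0 : HasSum D 0) (hμ : HasSum (fun k => D k * P.mu k) 0)
    (hk : HasSum (fun k => D k * (k : ℝ)) Δ)
    (hright : ∀ k, n + 2 ≤ k → 0 ≤ D k)
    (hcross : ∀ j k, j ≤ k → k ≤ n → D j < 0 → D k ≤ 0)
    (hzero : D 0 ≤ 0 → ∀ k ≤ n, D k ≤ 0) : 0 ≤ Δ := by
  -- Without a positive start only the sign change at n + 1 is left, and k - (n + 1) is a test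
  -- function of the same sign as `D`.
  rcases le_or_gt (D 0) 0 with hD0 | hD0
  · have h1 : HasSum (fun k => D k * ((k : ℝ) - (n + 1))) Δ := by
      have := hk.sub (h0.mul_right ((n : ℝ) + 1))
      simp only [zero_mul, sub_zero] at this
      simpa only [mul_sub] using this
    refine h1.nonneg fun k => ?_
    rcases lt_trichotomy k (n + 1) with h | h | h
    · have h2 : (k : ℝ) ≤ n := by exact_mod_cast (by omega : k ≤ n)
      exact mul_nonneg_of_nonpos_of_nonpos (hzero hD0 k (by omega)) (by linarith)
    · simp [h]
    · have h2 : (n : ℝ) + 1 ≤ k := by exact_mod_cast h.le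
      exact mul_nonneg (hright k (by omega)) (by linarith)
  · have hex : ∃ k, D k < 0 := by
      by_contra! hall
      exact absurd (le_hasSum h0 0 fun k _ => hall k) (not_le.2 hD0)
    classical
    obtain ⟨m, hm, hmin⟩ : ∃ m, D m < 0 ∧ ∀ k < m, 0 ≤ D k :=
      ⟨Nat.find hex, Nat.find_spec hex, fun k hk => not_lt.1 (Nat.find_min hex hk)⟩
    obtain ⟨a, rfl⟩ : ∃ a, m = a + 1 := Nat.exists_eq_succ_of_ne_zero (by
      rintro rfl
      linarith)
    have han : a + 1 ≤ n + 1 := by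
      by_contra! h
      linarith [hright (a + 1) (by omega)]
    -- `a` is the last index before `D` turns negative and `b` is the index where its sign is
    -- unknown. The test function is linear in k minus a multiple of μ, vanishes at `a` and `b`, and
    -- by concavity has signs +, -, + around them, matching `D`. Its sum against `D` is Δ(μ_b -
    -- μ_a).
    set b := n + 1 with hb
    have hab : (0 : ℝ) < (b : ℝ) - a := sub_pos.2 (by exact_mod_cast (by omega : a < b))
    have hμab : P.mu a ≤ P.mu b := P.mu_mono (by omega)
    have hleft : ∀ k, k ≤ a → 0 ≤ ((k : ℝ) - a) * (P.mu b - P.mu a)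
        - ((b : ℝ) - a) * (P.mu k - P.mu a) := fun k hka => by
      have := hreg.chord_le hka (by omega : a ≤ b)
      linarith
    have hmid : ∀ k, a ≤ k → k ≤ b → ((k : ℝ) - a) * (P.mu b - P.mu a)
        - ((b : ℝ) - a) * (P.mu k - P.mu a) ≤ 0 := fun k hak hkb => by
      have := hreg.chord_le hak hkb
      linarith
    have hrt : ∀ k, b ≤ k → 0 ≤ ((k : ℝ) - a) * (P.mu b - P.mu a)
        - ((b : ℝ) - a) * (P.mu k - P.mu a) := fun k hbk => by
      have := hreg.chord_le (by omega : a ≤ b) hbk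
      linarith
    have hsum : HasSum (fun k => D k * (((k : ℝ) - a) * (P.mu b - P.mu a)
        - ((b : ℝ) - a) * (P.mu k - P.mu a))) (Δ * (P.mu b - P.mu a)) := by
      have h1 := (hk.sub (h0.mul_right (a : ℝ))).mul_right (P.mu b - P.mu a)
      have h2 := (hμ.sub (h0.mul_right (P.mu a))).mul_right ((b : ℝ) - a)
      have h3 := h1.sub h2
      simp only [zero_mul, sub_zero] at h3
      exact h3.congr_fun fun k => by ring
    have hnn : 0 ≤ Δ * (P.mu b - P.mu a) := by
      refine hsum.nonneg fun k => ?_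
      rcases le_or_gt k a with h | h
      · exact mul_nonneg (hmin k (by omega)) (hleft k h)
      · rcases lt_trichotomy k b with h' | h' | h'
        · exact mul_nonneg_of_nonpos_of_nonpos (hcross (a + 1) k h (by omega) hm)
            (hmid k h.le h'.le)
        · rw [h']
          apply le_of_eq
          ring
        · exact mul_nonneg (hright k (by omega)) (hrt k h'.le)
    rcases hμab.eq_or_lt with heq | hlt
    -- If μ is flat between `a` and `b` it is constant beyond `a`, and D_k(μ_a - μ_k) is
    -- nonnegative, positive at 0 and of sum zero, which is impossible.
    · exfalso
      have hconst : ∀ k, a ≤ k → P.mu k = P.mu a := fun k hak => by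
        refine le_antisymm ?_ (P.mu_mono hak)
        rcases le_total k b with h | h
        · exact heq ▸ P.mu_mono h
        · have := hrt k h
          rw [heq, sub_self, mul_zero, zero_sub, neg_nonneg] at this
          have := nonpos_of_mul_nonpos_right this hab
          linarith
      have h1 : HasSum (fun k => D k * (P.mu a - P.mu k)) 0 := by
        have := (h0.mul_right (P.mu a)).sub hμ
        simp only [zero_mul, sub_zero] at this
        simpa only [mul_sub] using this
      have h2 := le_hasSum h1 0 fun k _ => by
        rcases le_or_gt k a with h | h
        · exact mul_nonneg (hmin k (by omega)) (sub_nonneg.2 (P.mu_mono h))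
        · rw [hconst k h.le, sub_self, mul_zero]
      rw [P.mu_zero, sub_zero] at h2
      have h3 : 0 < P.mu a := heq ▸ P.mu_pos b (by omega)
      linarith [mul_pos hD0 h3]
    · exact nonneg_of_mul_nonneg_left hnn (sub_pos.2 hlt)

end Concavity

/-! ### Steady states of cutoff policies and their limit -/

section Weights

/-- Stationary weights when all agents join. -/
noncomputable def weight (P : PrimitiveProcess) : ℕ → ℝ
  | 0 => 1
  | k + 1 => weight P k * P.lam k / P.mu (k + 1)

/-- Stationary weights when all agents join up to length `n`, where they join with
probability `s`. -/
noncomputable def cutWeight (P : PrimitiveProcess) (n : ℕ) (s : ℝ) (k : ℕ) : ℝ :=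
  if k ≤ n then weight P k else if k = n + 1 then s * weight P (n + 1) else 0

/-- Sum of `a` against the stationary weights of a cutoff policy. -/
noncomputable def cutSum (P : PrimitiveProcess) (a : ℕ → ℝ) (n : ℕ) (s : ℝ) : ℝ :=
  ∑ k ∈ Finset.range (n + 1), weight P k * a k + s * (weight P (n + 1) * a (n + 1))

/-- Mean of `a` in the steady state of a cutoff policy. -/
noncomputable def cutMean (P : PrimitiveProcess) (a : ℕ → ℝ) (n : ℕ) (s : ℝ) : ℝ :=
  cutSum P a n s / cutSum P (fun _ => 1) n s

variable {P : PrimitiveProcess}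

lemma weight_nonneg (k : ℕ) : 0 ≤ weight P k := by
  induction k with
  | zero => exact zero_le_one
  | succ k ih => exact div_nonneg (mul_nonneg ih (P.lam_nonneg k)) (P.mu_nonneg _)

lemma mu_mul_weight (k : ℕ) : P.mu (k + 1) * weight P (k + 1) = P.lam k * weight P k := by
  have := (P.mu_pos (k + 1) (by omega)).ne'
  rw [weight]
  field_simp

lemma one_le_cutSum (n : ℕ) {s : ℝ} (hs : 0 ≤ s) : 1 ≤ cutSum P (fun _ => 1) n s := by
  have h1 : weight P 0 * 1 ≤ ∑ k ∈ Finset.range (n + 1), weight P k * 1 :=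
    Finset.single_le_sum (f := fun k => weight P k * 1)
      (fun k _ => mul_nonneg (weight_nonneg k) zero_le_one) (by simp)
  have h2 := mul_nonneg hs (mul_nonneg (weight_nonneg (P := P) (n + 1)) zero_le_one)
  simp only [cutSum]
  rw [weight] at h1
  linarith

lemma cutSum_pos (n : ℕ) {s : ℝ} (hs : 0 ≤ s) : 0 < cutSum P (fun _ => 1) n s :=
  zero_lt_one.trans_le (one_le_cutSum n hs)

lemma hasSum_cutWeight (a : ℕ → ℝ) (n : ℕ) (s : ℝ) :
    HasSum (fun k => cutWeight P n s k * a k) (cutSum P a n s) := by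
  have h : HasSum (fun k => cutWeight P n s k * a k)
      (∑ k ∈ Finset.range (n + 2), cutWeight P n s k * a k) :=
    hasSum_sum_of_ne_finset_zero fun k hk => by
      rw [Finset.mem_range] at hk
      rw [cutWeight, if_neg (by omega), if_neg (by omega), zero_mul]
  convert h using 1
  rw [Finset.sum_range_succ, cutSum]
  congr 1
  · refine Finset.sum_congr rfl fun k hk => ?_
    rw [Finset.mem_range] at hk
    rw [cutWeight, if_pos (by omega)]
  · rw [cutWeight, if_neg (by omega), if_pos rfl, mul_assoc]

lemma cutSum_add_one (a : ℕ → ℝ) (n : ℕ) : cutSum P a n 1 = cutSum P a (n + 1) 0 := by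
  simp [cutSum, Finset.sum_range_succ]

/-- Admitting surely at length n is admitting with probability 0 at length n + 1, so the cutoffs
form one continuous path. -/
lemma cutMean_one (a : ℕ → ℝ) (n : ℕ) : cutMean P a n 1 = cutMean P a (n + 1) 0 := by
  rw [cutMean, cutMean, cutSum_add_one, cutSum_add_one]

lemma cutSum_zero (a : ℕ → ℝ) (n : ℕ) :
    cutSum P a n 0 = ∑ k ∈ Finset.range (n + 1), weight P k * a k := by
  simp [cutSum]

lemma cutMean_add (a b : ℕ → ℝ) (n : ℕ) (s : ℝ) :
    cutMean P (fun k => a k + b k) n s = cutMean P a n s + cutMean P b n s := by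
  rw [cutMean, cutMean, cutMean, ← add_div]
  congr 1
  simp only [cutSum, mul_add, Finset.sum_add_distrib]
  ring

lemma cutMean_mul (c : ℝ) (a : ℕ → ℝ) (n : ℕ) (s : ℝ) :
    cutMean P (fun k => c * a k) n s = c * cutMean P a n s := by
  rw [cutMean, cutMean, ← mul_div_assoc]
  congr 1
  simp only [cutSum, mul_add, Finset.mul_sum]
  congr 1
  · exact Finset.sum_congr rfl fun k _ => by ring
  · ring

lemma continuousOn_cutMean (a : ℕ → ℝ) (n : ℕ) :
    ContinuousOn (fun s => cutMean P a n s) (Set.Icc 0 1) := by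
  refine ContinuousOn.div ?_ ?_ fun s hs => (cutSum_pos n hs.1).ne'
  · unfold cutSum
    fun_prop
  · unfold cutSum
    fun_prop

/-- Numerator and denominator are affine in s, so the mean lies between its values at s = 0 and s =
1. -/
lemma cutMean_le_max (a : ℕ → ℝ) (n : ℕ) {s : ℝ} (hs : s ∈ Set.Icc (0 : ℝ) 1) {c : ℝ}
    (h0 : cutMean P a n 0 < c) (h1 : cutMean P a (n + 1) 0 < c) : cutMean P a n s < c := by
  rw [← cutMean_one] at h1
  rw [cutMean, div_lt_iff₀ (cutSum_pos n le_rfl)] at h0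
  rw [cutMean, div_lt_iff₀ (cutSum_pos n zero_le_one)] at h1
  rw [cutMean, div_lt_iff₀ (cutSum_pos n hs.1)]
  simp only [cutSum, zero_mul, add_zero, one_mul] at h0 h1 ⊢
  rcases hs.1.eq_or_lt with h | h
  · rw [← h]
    simpa using h0
  · nlinarith [mul_lt_mul_of_pos_left h1 h,
      mul_le_mul_of_nonneg_left h0.le (sub_nonneg.2 hs.2)]

lemma cutMean_mono {a b : ℕ → ℝ} (h : ∀ k, a k ≤ b k) (n : ℕ) {s : ℝ} (hs : 0 ≤ s) :
    cutMean P a n s ≤ cutMean P b n s := by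
  refine div_le_div_of_nonneg_right ?_ (cutSum_pos n hs).le
  simp only [cutSum]
  gcongr with k _
  · exact weight_nonneg k
  · exact h k
  · exact weight_nonneg _
  · exact h _

lemma cutMean_const (c : ℝ) (n : ℕ) {s : ℝ} (hs : 0 ≤ s) : cutMean P (fun _ => c) n s = c := by
  have := cutMean_mul (P := P) c (fun _ => 1) n s
  simp only [mul_one] at this
  rw [this, cutMean, div_self (cutSum_pos n hs).ne', mul_one]

/-- If the weights are not summable, means are eventually above any value below the supremum. -/
lemma eventually_lt_cutMean (hW : ¬ Summable (weight P)) {a : ℕ → ℝ} (ha : Monotone a)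
    (ha0 : ∀ k, 0 ≤ a k) {c : ℝ} {J : ℕ} (hc : c < a J) :
    ∀ᶠ n in atTop, c < cutMean P a n 0 := by
  have h1 : Tendsto (fun n => ∑ k ∈ Finset.range (n + 1), weight P k) atTop atTop :=
    ((not_summable_iff_tendsto_nat_atTop_of_nonneg weight_nonneg).1 hW).comp
      (tendsto_add_atTop_nat 1)
  have h2 := h1.eventually_gt_atTop (a J * (∑ k ∈ Finset.range J, weight P k) / (a J - c))
  filter_upwards [h2, eventually_ge_atTop J] with n hn hJ
  rw [div_lt_iff₀ (sub_pos.2 hc)] at hn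
  rw [cutMean, lt_div_iff₀ (cutSum_pos n le_rfl), cutSum_zero, cutSum_zero]
  simp only [mul_one]
  have hsplit : ∀ f : ℕ → ℝ, ∑ k ∈ Finset.range (n + 1), f k
      = ∑ k ∈ Finset.range J, f k + ∑ k ∈ Finset.Ico J (n + 1), f k := fun f =>
    (Finset.sum_range_add_sum_Ico f (by omega)).symm
  have h3 : (∑ k ∈ Finset.Ico J (n + 1), weight P k) * a J
      ≤ ∑ k ∈ Finset.Ico J (n + 1), weight P k * a k := by
    rw [Finset.sum_mul]
    refine Finset.sum_le_sum fun k hk => mul_le_mul_of_nonneg_left ?_ (weight_nonneg k)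
    exact ha (Finset.mem_Ico.1 hk).1
  have h4 : 0 ≤ ∑ k ∈ Finset.range J, weight P k * a k :=
    Finset.sum_nonneg fun k _ => mul_nonneg (weight_nonneg k) (ha0 k)
  rw [hsplit fun k => weight P k * a k]
  have h5 := hsplit (weight P)
  have h6 : ∑ k ∈ Finset.Ico J (n + 1), weight P k
      = ∑ k ∈ Finset.range (n + 1), weight P k - ∑ k ∈ Finset.range J, weight P k := by linarith
  rw [h6] at h3
  linarith

lemma summable_weight_of_mul (h : Summable fun k => weight P k * (k : ℝ)) :
    Summable (weight P) := by
  rw [← summable_nat_add_iff 1] at h ⊢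
  refine h.of_nonneg_of_le (fun k => weight_nonneg _) fun k => ?_
  refine le_mul_of_one_le_right (weight_nonneg _) ?_
  push_cast
  linarith [Nat.cast_nonneg (α := ℝ) k]

/-- Either the weights are summable and only the numerator diverges, or they are not and the mass
escapes to large lengths. -/
lemma eventually_lt_cutMean_id (h : ¬ Summable fun k => weight P k * (k : ℝ)) (c : ℝ) :
    ∀ᶠ n in atTop, c < cutMean P (fun k => (k : ℝ)) n 0 := by
  by_cases hW : Summable (weight P)
  · have hS : 0 < ∑' k, weight P k :=
      hW.tsum_pos weight_nonneg 0 (by rw [weight]; exact zero_lt_one)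
    have h1 : Tendsto (fun n => ∑ k ∈ Finset.range (n + 1), weight P k * (k : ℝ)) atTop atTop :=
      ((not_summable_iff_tendsto_nat_atTop_of_nonneg fun k =>
        mul_nonneg (weight_nonneg k) (Nat.cast_nonneg k)).1 h).comp (tendsto_add_atTop_nat 1)
    filter_upwards [h1.eventually_gt_atTop (|c| * ∑' k, weight P k)] with n hn
    rw [cutMean, lt_div_iff₀ (cutSum_pos n le_rfl), cutSum_zero, cutSum_zero]
    refine lt_of_le_of_lt ?_ hn
    simp only [mul_one]
    refine mul_le_mul (le_abs_self c) (hW.sum_le_tsum _ fun k _ => weight_nonneg k)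
      (Finset.sum_nonneg fun k _ => weight_nonneg k) (abs_nonneg c)
  · obtain ⟨J, hJ⟩ := exists_nat_gt c
    exact eventually_lt_cutMean hW Nat.mono_cast (fun k => Nat.cast_nonneg k) hJ

/-- Mean of `a` when all agents join. -/
noncomputable def fullMean (P : PrimitiveProcess) (a : ℕ → ℝ) : ℝ :=
  (∑' k, weight P k * a k) / ∑' k, weight P k

lemma tsum_weight_pos (hW : Summable (weight P)) : 0 < ∑' k, weight P k :=
  hW.tsum_pos weight_nonneg 0 (by rw [weight]; exact zero_lt_one)

lemma tendsto_cutMean (hW : Summable (weight P)) {a : ℕ → ℝ}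
    (ha : Summable fun k => weight P k * a k) :
    Tendsto (fun n => cutMean P a n 0) atTop (𝓝 (fullMean P a)) := by
  have h1 := (ha.hasSum.tendsto_sum_nat).comp (tendsto_add_atTop_nat 1)
  have h2 := (hW.hasSum.tendsto_sum_nat).comp (tendsto_add_atTop_nat 1)
  refine (h1.div h2 (tsum_weight_pos hW).ne').congr fun n => ?_
  simp [cutMean, cutSum_zero]

lemma summable_weight_mul_mu (hW : Summable (weight P)) :
    Summable fun k => weight P k * P.mu k := by
  obtain ⟨B, hB⟩ := P.mu_bounded
  exact (hW.mul_right B).of_nonneg_of_le (fun k => mul_nonneg (weight_nonneg k) (P.mu_nonneg k))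
    fun k => mul_le_mul_of_nonneg_left (hB k) (weight_nonneg k)

end Weights


/-! ### Domination by cutoff policies -/

/-- A distribution of queue lengths that some entry/exit rule generates. -/
structure IsAttainable (P : PrimitiveProcess) (p : ℕ → ℝ) : Prop where
  nonneg : ∀ k, 0 ≤ p k
  hasSum_one : HasSum p 1
  flow_le : ∀ k, P.mu (k + 1) * p (k + 1) ≤ P.lam k * p k

section

variable {P : PrimitiveProcess} {p : ℕ → ℝ}

lemma IsInvariant.isAttainable {π : Policy} (he : π.EntryExitFeasible)
    (hp : IsInvariant P π p) : IsAttainable P p where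
  nonneg := hp.nonneg
  hasSum_one := hp.hasSum_one
  flow_le := fun k => by
    have h1 := hp.balance k
    have h2 := mul_nonneg (he.ySum_nonneg (k + 1)) (hp.nonneg (k + 1))
    have h3 := P.lam_nonneg k
    have h4 : π.x k * (1 - π.zSum k) ≤ 1 :=
      mul_le_one₀ (he.x_mem k).2 (by linarith [he.z_sum_le k]) (by linarith [he.zSum_nonneg k])
    have h5 := mul_le_mul_of_nonneg_left h4 (mul_nonneg h3 (hp.nonneg k))
    nlinarith

namespace IsAttainable

variable (hp : IsAttainable P p)

include hp

/-- The ratio of `p` to the full-entry weights is nonincreasing, cross-multiplied because weights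
vanish beyond an arrival rate 0. -/
lemma mul_weight_le {k j : ℕ} (hkj : k ≤ j) : p j * weight P k ≤ p k * weight P j := by
  induction j, hkj using Nat.le_induction with
  | base => exact le_rfl
  | succ j _ ih =>
    have hμ := P.mu_pos (j + 1) (by omega)
    refine le_of_mul_le_mul_left ?_ hμ
    calc P.mu (j + 1) * (p (j + 1) * weight P k)
        = P.mu (j + 1) * p (j + 1) * weight P k := by ring
      _ ≤ P.lam j * p j * weight P k :=
          mul_le_mul_of_nonneg_right (hp.flow_le j) (weight_nonneg k)
      _ = P.lam j * (p j * weight P k) := by ring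
      _ ≤ P.lam j * (p k * weight P j) := mul_le_mul_of_nonneg_left ih (P.lam_nonneg j)
      _ = p k * (P.mu (j + 1) * weight P (j + 1)) := by rw [mu_mul_weight]; ring
      _ = _ := by ring

lemma zero_pos : 0 < p 0 := by
  refine (hp.nonneg 0).lt_of_ne fun h => ?_
  have hz : ∀ k, p k = 0 := fun k => by
    have h1 := hp.mul_weight_le (Nat.zero_le k)
    rw [← h, zero_mul, weight, mul_one] at h1
    exact le_antisymm h1 (hp.nonneg k)
  have h2 := hp.hasSum_one
  rw [funext hz] at h2
  exact zero_ne_one (hasSum_zero.unique h2)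

lemma summable_mul_mu : Summable fun k => p k * P.mu k := by
  obtain ⟨B, hB⟩ := P.mu_bounded
  exact (hp.hasSum_one.summable.mul_right B).of_nonneg_of_le
    (fun k => mul_nonneg (hp.nonneg k) (P.mu_nonneg k))
    fun k => mul_le_mul_of_nonneg_left (hB k) (hp.nonneg k)

/-- The length 0 has positive probability and no service, so the mean rate stays strictly below the
supremum of μ. -/
lemma tsum_mul_mu_lt : ∃ J, ∑' k, p k * P.mu k < P.mu J := by
  by_contra! hall
  set F := ∑' k, p k * P.mu k with hF
  have h1 : HasSum (fun k => p k * (F - P.mu k)) 0 := by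
    have := (hp.hasSum_one.mul_right F).sub hp.summable_mul_mu.hasSum
    rw [← hF, one_mul, sub_self] at this
    simpa only [mul_sub] using this
  have h2 := le_hasSum h1 0 fun k _ => mul_nonneg (hp.nonneg k) (sub_nonneg.2 (hall k))
  rw [P.mu_zero, sub_zero] at h2
  linarith [mul_pos hp.zero_pos ((P.mu_pos 1 le_rfl).trans_le (hall 1))]

/-- Up to n the cutoff law is proportional to the weights, so once `p` falls below it, it stays
below; from n + 2 on the cutoff law vanishes. At n + 1 randomized entry leaves the sign open, which
the crossing lemma tolerates. -/
lemma cutMean_id_le (hreg : P.ServiceRegular) (hk : Summable fun k => p k * (k : ℝ))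
    {n : ℕ} {s : ℝ} (hs : 0 ≤ s) (h : cutMean P P.mu n s = ∑' k, p k * P.mu k) :
    cutMean P (fun k => (k : ℝ)) n s ≤ ∑' k, p k * (k : ℝ) := by
  set S := cutSum P (fun _ => 1) n s with hS
  have hS0 : 0 < S := cutSum_pos n hs
  set q : ℕ → ℝ := fun k => cutWeight P n s k / S with hq
  have hqsum : ∀ a : ℕ → ℝ, HasSum (fun k => q k * a k) (cutMean P a n s) := fun a => by
    refine ((hasSum_cutWeight (P := P) a n s).div_const S).congr_fun fun k => ?_
    simp only [hq]
    ring
  have hq1 : HasSum q 1 := by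
    have := hqsum fun _ => 1
    rw [cutMean_const _ _ hs] at this
    simpa using this
  have hle : ∀ k, k ≤ n → q k = weight P k / S := fun k hk => by simp [hq, cutWeight, hk]
  have hcross : ∀ j k, j ≤ k → k ≤ n → p k * q j ≤ p j * q k := fun j k hjk hkn => by
    rw [hle j (hjk.trans hkn), hle k hkn, ← mul_div_assoc, ← mul_div_assoc]
    exact div_le_div_of_nonneg_right (hp.mul_weight_le hjk) hS0.le
  have hq0 : ∀ k, k ≤ n → 0 ≤ q k := fun k hk => by
    rw [hle k hk]
    exact div_nonneg (weight_nonneg k) hS0.le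
  have key : ∀ j k, j ≤ k → k ≤ n → p j - q j ≤ 0 → 0 < q j → p k - q k ≤ 0 :=
    fun j k hjk hkn h1 h2 => by
      have h3 := hcross j k hjk hkn
      have h4 := mul_le_mul_of_nonneg_right (sub_nonpos.1 h1) (hq0 k hkn)
      have h5 : p k * q j ≤ q k * q j := by linarith
      linarith [le_of_mul_le_mul_right h5 h2]
  have hfin : 0 ≤ ∑' k, p k * (k : ℝ) - cutMean P (fun k => (k : ℝ)) n s := by
    refine mean_nonneg_of_crossing hreg (D := fun k => p k - q k) (n := n) ?_ ?_ ?_ ?_ ?_ ?_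
    · simpa using hp.hasSum_one.sub hq1
    · have := hp.summable_mul_mu.hasSum.sub (hqsum P.mu)
      rw [h, sub_self] at this
      simpa only [sub_mul] using this
    · simpa only [sub_mul] using hk.hasSum.sub (hqsum fun k => (k : ℝ))
    · intro k hk
      have : q k = 0 := by
        simp only [hq, cutWeight]
        rw [if_neg (by omega), if_neg (by omega), zero_div]
      simp [this, hp.nonneg k]
    · intro j k hjk hkn hj
      exact key j k hjk hkn hj.le (by linarith [hp.nonneg j])
    · intro h0 k hk
      refine key 0 k (Nat.zero_le k) hk h0 ?_
      rw [hle 0 (Nat.zero_le n), weight]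
      positivity
  linarith

/-- Full entry stochastically maximizes the queue and hence the service flow. If p - weight/S starts
positive, it has a single change of sign at `m`, and testing with μ_m - μ_k would make the full flow
strictly larger; otherwise all differences are ≤ 0 with sum 0. -/
lemma eq_weight_div (hW : Summable (weight P)) (h : fullMean P P.mu ≤ ∑' k, p k * P.mu k)
    (k : ℕ) : p k = weight P k / ∑' k, weight P k := by
  set S := ∑' k, weight P k with hS
  have hS0 : 0 < S := tsum_weight_pos hW
  set D : ℕ → ℝ := fun k => p k - weight P k / S with hD
  have hD0 : HasSum D 0 := by
    have := hp.hasSum_one.sub (hW.hasSum.div_const S)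
    rwa [← hS, div_self hS0.ne', sub_self] at this
  have key : ∀ j k, j ≤ k → D j ≤ 0 → 0 < weight P j → D k ≤ 0 := fun j k hjk h1 h2 => by
    have h3 := hp.mul_weight_le hjk
    have h4 : p j * S ≤ weight P j := by
      rw [← le_div_iff₀ hS0]
      exact sub_nonpos.1 h1
    have h5 : p k * S * weight P j ≤ weight P k * weight P j := by
      nlinarith [mul_le_mul_of_nonneg_right h4 (weight_nonneg (P := P) k),
        mul_le_mul_of_nonneg_right h3 hS0.le]
    refine sub_nonpos.2 ((le_div_iff₀ hS0).2 ?_)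
    exact le_of_mul_le_mul_right h5 h2
  rcases le_or_gt (D 0) 0 with h0 | h0
  · have hneg : ∀ k, D k ≤ 0 := fun k =>
      key 0 k (Nat.zero_le k) h0 (by rw [weight]; exact zero_lt_one)
    have h1 := le_hasSum (by simpa using hD0.neg) k fun j _ => by
      simpa using hneg j
    have h2 : D k = 0 := le_antisymm (hneg k) (by simpa using h1)
    simp only [hD] at h2
    linarith
  · exfalso
    have hex : ∃ k, D k < 0 := by
      by_contra! hall
      exact absurd (le_hasSum hD0 0 fun k _ => hall k) (not_le.2 h0)
    classical
    obtain ⟨m, hm, hmin⟩ : ∃ m, D m < 0 ∧ ∀ k < m, 0 ≤ D k :=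
      ⟨Nat.find hex, Nat.find_spec hex, fun k hk => not_lt.1 (Nat.find_min hex hk)⟩
    have hm0 : m ≠ 0 := by
      rintro rfl
      linarith
    have hwm : 0 < weight P m := by
      have : 0 < weight P m / S := by
        simp only [hD] at hm
        linarith [hp.nonneg m]
      exact (div_pos_iff_of_pos_right hS0).1 this
    have h1 : HasSum (fun k => D k * (P.mu m - P.mu k))
        (fullMean P P.mu - ∑' k, p k * P.mu k) := by
      have h2 := (summable_weight_mul_mu hW).hasSum.div_const S
      have h3 := (hD0.mul_right (P.mu m)).sub (hp.summable_mul_mu.hasSum.sub h2)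
      rw [zero_mul, zero_sub, neg_sub] at h3
      refine h3.congr_fun fun k => ?_
      simp only [hD]
      ring
    have h4 := le_hasSum h1 0 fun k _ => by
      rcases lt_or_ge k m with hk | hk
      · exact mul_nonneg (hmin k hk) (sub_nonneg.2 (P.mu_mono hk.le))
      · exact mul_nonneg_of_nonpos_of_nonpos (key m k hk hm.le hwm)
          (sub_nonpos.2 (P.mu_mono hk))
    rw [P.mu_zero, sub_zero] at h4
    linarith [mul_pos h0 (P.mu_pos m (by omega))]

/-- Some cutoff policy generates the same service flow, unless all agents join already. -/
lemma exists_cutMean_eq :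
    (∃ n, ∃ s ∈ Set.Icc (0 : ℝ) 1, cutMean P P.mu n s = ∑' k, p k * P.mu k) ∨
      (Summable (weight P) ∧ ∀ k, p k = weight P k / ∑' k, weight P k) := by
  set F := ∑' k, p k * P.mu k with hF
  by_cases hex : ∃ n, F ≤ cutMean P P.mu n 0
  · left
    classical
    -- At the first deterministic cutoff whose flow reaches F, the preceding one is still below F;
    -- randomizing between the two hits F exactly.
    obtain ⟨n, hn, hmin⟩ : ∃ n, F ≤ cutMean P P.mu n 0 ∧ ∀ k < n, cutMean P P.mu k 0 < F :=
      ⟨Nat.find hex, Nat.find_spec hex, fun k hk => not_le.1 (Nat.find_min hex hk)⟩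
    cases n with
    | zero =>
      refine ⟨0, 0, by simp, le_antisymm ?_ hn⟩
      have h1 : cutMean P P.mu 0 0 = 0 := by simp [cutMean, cutSum, P.mu_zero]
      rw [h1]
      exact tsum_nonneg fun k => mul_nonneg (hp.nonneg k) (P.mu_nonneg k)
    | succ m =>
      rw [← cutMean_one] at hn
      obtain ⟨s, hs, h⟩ := intermediate_value_Icc zero_le_one (continuousOn_cutMean P.mu m)
        ⟨(hmin m (Nat.lt_succ_self m)).le, hn⟩
      exact ⟨m, s, hs, h⟩
  · right
    push Not at hex
    -- Nonsummable weights would push the cutoff flows above some μ_J > F.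
    have hW : Summable (weight P) := by
      by_contra hW
      obtain ⟨J, hJ⟩ := hp.tsum_mul_mu_lt
      obtain ⟨n, hn⟩ := (eventually_lt_cutMean hW P.mu_mono P.mu_nonneg hJ).exists
      exact lt_asymm hn (hex n)
    refine ⟨hW, hp.eq_weight_div hW ?_⟩
    exact le_of_tendsto (tendsto_cutMean hW (summable_weight_mul_mu hW))
      (Eventually.of_forall fun n => (hex n).le)

end IsAttainable

/-! ### Existence of an optimal cutoff -/

/-- A cutoff is admissible if the mean of `h` is nonnegative in its steady state. -/
def cutoffs (P : PrimitiveProcess) (h : ℕ → ℝ) : Set (ℕ × ℝ) :=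
  {c | c.2 ∈ Set.Icc (0 : ℝ) 1 ∧ 0 ≤ cutMean P h c.1 c.2}

/-- Only cutoffs up to M, or up to that of `c₀`, can matter: finitely many slices, each compact in
the entry probability. -/
lemma exists_max_cutoffs {h o : ℕ → ℝ} {M : ℕ} {c₀ : ℕ × ℝ} (hc₀ : c₀ ∈ cutoffs P h)
    (hM : ∀ c ∈ cutoffs P h, M < c.1 → cutMean P o c.1 c.2 ≤ cutMean P o c₀.1 c₀.2) :
    ∃ c ∈ cutoffs P h, ∀ c' ∈ cutoffs P h, cutMean P o c'.1 c'.2 ≤ cutMean P o c.1 c.2 := by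
  have hne : ∀ n, (∃ s, (n, s) ∈ cutoffs P h) → ∃ s, (n, s) ∈ cutoffs P h ∧
      ∀ s', (n, s') ∈ cutoffs P h → cutMean P o n s' ≤ cutMean P o n s := by
    rintro n ⟨s₀, hs₀⟩
    have hclosed : IsCompact {s | (n, s) ∈ cutoffs P h} := by
      have : {s | (n, s) ∈ cutoffs P h}
          = Set.Icc 0 1 ∩ (fun s => cutMean P h n s) ⁻¹' Set.Ici 0 := rfl
      rw [this]
      exact isCompact_Icc.of_isClosed_subset
        ((continuousOn_cutMean h n).preimage_isClosed_of_isClosed isClosed_Icc isClosed_Ici)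
        Set.inter_subset_left
    obtain ⟨s, hs, hmax⟩ := hclosed.exists_isMaxOn ⟨s₀, hs₀⟩
      ((continuousOn_cutMean o n).mono fun s hs => hs.1)
    exact ⟨s, hs, fun s' hs' => hmax hs'⟩
  choose! b hb hbmax using hne
  classical
  set T := (Finset.range (max M c₀.1 + 1)).filter fun n => ∃ s, (n, s) ∈ cutoffs P h with hT
  have hc₀T : c₀.1 ∈ T := by
    rw [hT, Finset.mem_filter, Finset.mem_range]
    exact ⟨by omega, c₀.2, hc₀⟩
  obtain ⟨n, hn, hmax⟩ := T.exists_max_image (fun n => cutMean P o n (b n)) ⟨_, hc₀T⟩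
  have hn' := (Finset.mem_filter.1 hn).2
  have h0 : cutMean P o c₀.1 c₀.2 ≤ cutMean P o n (b n) :=
    (hbmax c₀.1 ⟨_, hc₀⟩ _ hc₀).trans (hmax _ hc₀T)
  refine ⟨(n, b n), hb n hn', fun c' hc' => ?_⟩
  by_cases hlt : M < c'.1
  · exact (hM c' hc' hlt).trans h0
  · refine (hbmax c'.1 ⟨_, hc'⟩ _ hc').trans (hmax _ ?_)
    rw [hT, Finset.mem_filter, Finset.mem_range]
    exact ⟨by omega, c'.2, hc'⟩

/-- The policy under which all agents join generates a finite mean queue length and a nonnegative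
mean of `h`. -/
def FullAdmissible (P : PrimitiveProcess) (h : ℕ → ℝ) : Prop :=
  (Summable fun k => weight P k * (k : ℝ)) ∧ 0 ≤ fullMean P h

/-- If full entry is admissible but beaten by some cutoff, large cutoffs, whose payoffs converge to
that of full entry, are beaten too. If it is inadmissible, large cutoffs are inadmissible, and the
empty queue serves as the starting candidate. -/
lemma exists_optimal_cutoff {h o : ℕ → ℝ} (h0 : h 0 = 0)
    (hsum : (Summable fun k => weight P k * (k : ℝ)) → Summable fun k => weight P k * h k)
    (osum : (Summable fun k => weight P k * (k : ℝ)) → Summable fun k => weight P k * o k)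
    (hneg : (¬ Summable fun k => weight P k * (k : ℝ)) →
      ∀ᶠ n in atTop, cutMean P h n 0 < 0) :
    (FullAdmissible P h ∧ ∀ c ∈ cutoffs P h, cutMean P o c.1 c.2 ≤ fullMean P o) ∨
    ∃ c ∈ cutoffs P h, (∀ c' ∈ cutoffs P h, cutMean P o c'.1 c'.2 ≤ cutMean P o c.1 c.2) ∧
      (FullAdmissible P h → fullMean P o ≤ cutMean P o c.1 c.2) := by
  have hexpand : ∀ (a : ℕ → ℝ) (v : ℝ), (∀ᶠ n in atTop, cutMean P a n 0 < v) →
      ∃ M, ∀ n s, s ∈ Set.Icc (0 : ℝ) 1 → M < n → cutMean P a n s < v := fun a v hev => by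
    obtain ⟨M, hM⟩ := eventually_atTop.1 hev
    exact ⟨M, fun n s hs hn => cutMean_le_max a n hs (hM n hn.le) (hM (n + 1) (by omega))⟩
  by_cases hfull : FullAdmissible P h
  · by_cases hall : ∀ c ∈ cutoffs P h, cutMean P o c.1 c.2 ≤ fullMean P o
    · exact Or.inl ⟨hfull, hall⟩
    · right
      push Not at hall
      obtain ⟨c₀, hc₀, hlt⟩ := hall
      obtain ⟨M, hM⟩ := hexpand o _ ((tendsto_cutMean (summable_weight_of_mul hfull.1)
        (osum hfull.1)).eventually_lt_const hlt)
      obtain ⟨c, hc, hmax⟩ := exists_max_cutoffs hc₀ fun c hc hMc => (hM _ _ hc.1 hMc).le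
      exact ⟨c, hc, hmax, fun _ => hlt.le.trans (hmax c₀ hc₀)⟩
  · right
    have hev : ∀ᶠ n in atTop, cutMean P h n 0 < 0 := by
      by_cases hs : Summable fun k => weight P k * (k : ℝ)
      · refine (tendsto_cutMean (summable_weight_of_mul hs) (hsum hs)).eventually_lt_const ?_
        by_contra! hle
        exact hfull ⟨hs, hle⟩
      · exact hneg hs
    obtain ⟨M, hM⟩ := hexpand h 0 hev
    have hc₀ : ((0, 0) : ℕ × ℝ) ∈ cutoffs P h := ⟨by simp, by simp [cutMean, cutSum, h0]⟩
    obtain ⟨c, hc, hmax⟩ := exists_max_cutoffs (o := o) hc₀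
      fun c hc hMc => absurd (hM _ _ hc.1 hMc) (not_lt.2 hc.2)
    exact ⟨c, hc, hmax, fun hf => absurd hf hfull⟩

end


/-! ### Optimality of first come, first served with a cutoff -/

section

variable {P : PrimitiveProcess} {w : Payoffs} {p : ℕ → ℝ}

/-- Total surplus of the agents in a queue of length `k`, per unit of time. -/
def agentSurplus (P : PrimitiveProcess) (w : Payoffs) (k : ℕ) : ℝ := w.V * P.mu k - w.C * k

/-- The designer's payoff in a queue of length `k`, per unit of time. -/
def flowPayoff (P : PrimitiveProcess) (w : Payoffs) (k : ℕ) : ℝ :=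
  (1 - w.α) * w.R * P.mu k + w.α * agentSurplus P w k

lemma serviceFlow_eq_ofReal (hp : IsAttainable P p) :
    serviceFlow P p = ENNReal.ofReal (∑' k, p k * P.mu k) :=
  (ENNReal.ofReal_tsum_of_nonneg (fun k => mul_nonneg (hp.nonneg k) (P.mu_nonneg k))
    hp.summable_mul_mu).symm

lemma meanLength_eq_ofReal (hp : IsAttainable P p) (hk : Summable fun k => p k * (k : ℝ)) :
    meanLength p = ENNReal.ofReal (∑' k, p k * (k : ℝ)) :=
  (ENNReal.ofReal_tsum_of_nonneg (fun k => mul_nonneg (hp.nonneg k) (Nat.cast_nonneg k)) hk).symm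

lemma tsum_mul_mu_nonneg (hp : IsAttainable P p) : 0 ≤ ∑' k, p k * P.mu k :=
  tsum_nonneg fun k => mul_nonneg (hp.nonneg k) (P.mu_nonneg k)

lemma tsum_mul_id_nonneg (hp : IsAttainable P p) : 0 ≤ ∑' k, p k * (k : ℝ) :=
  tsum_nonneg fun k => mul_nonneg (hp.nonneg k) (Nat.cast_nonneg k)

lemma hasSum_mul_agentSurplus (hp : IsAttainable P p) (hk : Summable fun k => p k * (k : ℝ)) :
    HasSum (fun k => p k * agentSurplus P w k)
      (w.V * ∑' k, p k * P.mu k - w.C * ∑' k, p k * (k : ℝ)) :=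
  ((hp.summable_mul_mu.hasSum.mul_left w.V).sub (hk.hasSum.mul_left w.C)).congr_fun
    fun k => by rw [agentSurplus]; ring

lemma hasSum_mul_flowPayoff (hp : IsAttainable P p) (hk : Summable fun k => p k * (k : ℝ)) :
    HasSum (fun k => p k * flowPayoff P w k)
      ((1 - w.α) * w.R * ∑' k, p k * P.mu k
        + w.α * (w.V * ∑' k, p k * P.mu k - w.C * ∑' k, p k * (k : ℝ))) :=
  ((hp.summable_mul_mu.hasSum.mul_left ((1 - w.α) * w.R)).add
    ((hasSum_mul_agentSurplus hp hk).mul_left w.α)).congr_fun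
    fun k => by rw [flowPayoff]; ring

lemma objective_eq (hp : IsAttainable P p) (hk : Summable fun k => p k * (k : ℝ)) :
    objective P w p = ((∑' k, p k * flowPayoff P w k : ℝ) : EReal) := by
  rw [(hasSum_mul_flowPayoff hp hk).tsum_eq, objective, serviceFlow_eq_ofReal hp,
    meanLength_eq_ofReal hp hk, EReal.coe_ennreal_ofReal, EReal.coe_ennreal_ofReal,
    max_eq_left (tsum_mul_mu_nonneg hp), max_eq_left (tsum_mul_id_nonneg hp)]
  push_cast
  rfl

lemma participation_iff (hp : IsAttainable P p) (hk : Summable fun k => p k * (k : ℝ)) :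
    ENNReal.ofReal w.C * meanLength p ≤ ENNReal.ofReal w.V * serviceFlow P p
      ↔ 0 ≤ ∑' k, p k * agentSurplus P w k := by
  rw [(hasSum_mul_agentSurplus hp hk).tsum_eq, serviceFlow_eq_ofReal hp,
    meanLength_eq_ofReal hp hk, ← ENNReal.ofReal_mul w.C_pos.le, ← ENNReal.ofReal_mul w.V_pos.le,
    ENNReal.ofReal_le_ofReal_iff (mul_nonneg w.V_pos.le (tsum_mul_mu_nonneg hp)), sub_nonneg]

lemma summable_mul_id_of_participation (hp : IsAttainable P p)
    (h : ENNReal.ofReal w.C * meanLength p ≤ ENNReal.ofReal w.V * serviceFlow P p) :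
    Summable fun k => p k * (k : ℝ) := by
  have h1 : meanLength p ≠ ⊤ := fun htop => by
    rw [htop, ENNReal.mul_top (by simpa using w.C_pos), top_le_iff] at h
    exact ENNReal.mul_ne_top ENNReal.ofReal_ne_top
      (serviceFlow_ne_top hp.hasSum_one.summable hp.nonneg) h
  have h2 := ENNReal.summable_toReal h1
  refine h2.congr fun k => ENNReal.toReal_ofReal (mul_nonneg (hp.nonneg k) (Nat.cast_nonneg k))

lemma cutMean_agentSurplus (n : ℕ) (s : ℝ) : cutMean P (agentSurplus P w) n s
    = w.V * cutMean P P.mu n s - w.C * cutMean P (fun k => (k : ℝ)) n s := by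
  have h : agentSurplus P w = fun k => w.V * P.mu k + -w.C * (k : ℝ) := by
    funext k
    rw [agentSurplus]
    ring
  rw [h, cutMean_add, cutMean_mul, cutMean_mul (-w.C) fun k => (k : ℝ)]
  ring

lemma cutMean_flowPayoff (n : ℕ) (s : ℝ) : cutMean P (flowPayoff P w) n s
    = (1 - w.α) * w.R * cutMean P P.mu n s + w.α * cutMean P (agentSurplus P w) n s := by
  change cutMean P (fun k => (1 - w.α) * w.R * P.mu k + w.α * agentSurplus P w k) n s = _
  rw [cutMean_add, cutMean_mul, cutMean_mul]

/-- Every distribution that leaves the agents a nonnegative surplus does no better than some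
admissible cutoff, or than letting all agents join. -/
lemma IsAttainable.tsum_flowPayoff_le (hp : IsAttainable P p) (hreg : P.ServiceRegular)
    (hk : Summable fun k => p k * (k : ℝ)) (h : 0 ≤ ∑' k, p k * agentSurplus P w k) :
    (∃ c ∈ cutoffs P (agentSurplus P w),
      ∑' k, p k * flowPayoff P w k ≤ cutMean P (flowPayoff P w) c.1 c.2) ∨
    (FullAdmissible P (agentSurplus P w) ∧
      ∑' k, p k * flowPayoff P w k = fullMean P (flowPayoff P w)) := by
  rcases hp.exists_cutMean_eq with ⟨n, s, hs, hF⟩ | ⟨hW, hpw⟩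
  · left
    -- Same service flow and shorter queue: the agents' surplus rises, so the constraint survives
    -- and, as α ≥ 0, the payoff does not fall.
    have h1 := mul_le_mul_of_nonneg_left (hp.cutMean_id_le hreg hk hs.1 hF) w.C_pos.le
    rw [(hasSum_mul_agentSurplus hp hk).tsum_eq] at h
    have h2 : w.V * ∑' k, p k * P.mu k - w.C * ∑' k, p k * (k : ℝ)
        ≤ cutMean P (agentSurplus P w) n s := by
      rw [cutMean_agentSurplus, hF]
      linarith
    refine ⟨(n, s), ⟨hs, h.trans h2⟩, ?_⟩
    rw [(hasSum_mul_flowPayoff hp hk).tsum_eq, cutMean_flowPayoff, hF]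
    have h3 := mul_le_mul_of_nonneg_left h2 w.α_nonneg
    simp only
    linarith
  · right
    have hS := tsum_weight_pos hW
    have hmean : ∀ a : ℕ → ℝ, ∑' k, p k * a k = fullMean P a := fun a => by
      rw [fullMean, ← tsum_div_const]
      refine tsum_congr fun k => ?_
      rw [hpw]
      ring
    refine ⟨⟨?_, by rwa [← hmean]⟩, hmean _⟩
    refine (hk.mul_left (∑' k, weight P k)).congr fun k => ?_
    rw [hpw]
    field_simp

lemma IsFCFSInvariant.isAttainable {x : ℕ → ℝ} (hx : ∀ k, x k ∈ Set.Icc (0 : ℝ) 1)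
    (hp : IsFCFSInvariant P x p) : IsAttainable P p where
  nonneg := hp.nonneg
  hasSum_one := hp.hasSum_one
  flow_le := fun k => by
    rw [← hp.balance]
    exact mul_le_mul_of_nonneg_right
      (mul_le_of_le_one_right (P.lam_nonneg k) (hx k).2) (hp.nonneg k)

lemma isFCFSInvariant_full (hW : Summable (weight P)) :
    IsFCFSInvariant P (fun _ => 1) fun k => weight P k / ∑' k, weight P k where
  nonneg := fun k => div_nonneg (weight_nonneg k) (tsum_weight_pos hW).le
  hasSum_one := by
    have := hW.hasSum.div_const (∑' k, weight P k)
    rwa [div_self (tsum_weight_pos hW).ne'] at this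
  balance := fun k => by
    rw [mul_one, ← mul_div_assoc, ← mul_div_assoc, mu_mul_weight]

/-- Entry up to length `n`, where agents join with probability `s`. -/
noncomputable def cutEntry (n : ℕ) (s : ℝ) (k : ℕ) : ℝ :=
  if k < n then 1 else if k = n then s else 0

lemma cutEntry_mem (n : ℕ) {s : ℝ} (hs : s ∈ Set.Icc (0 : ℝ) 1) (k : ℕ) :
    cutEntry n s k ∈ Set.Icc (0 : ℝ) 1 := by
  unfold cutEntry
  split_ifs
  exacts [by simp, hs, by simp]

lemma cutWeight_nonneg (n : ℕ) {s : ℝ} (hs : 0 ≤ s) (k : ℕ) : 0 ≤ cutWeight P n s k := by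
  unfold cutWeight
  split_ifs
  exacts [weight_nonneg k, mul_nonneg hs (weight_nonneg _), le_rfl]

lemma isFCFSInvariant_cut (n : ℕ) {s : ℝ} (hs : 0 ≤ s) :
    IsFCFSInvariant P (cutEntry n s) fun k => cutWeight P n s k / cutSum P (fun _ => 1) n s where
  nonneg := fun k => div_nonneg (cutWeight_nonneg n hs k) (cutSum_pos n hs).le
  hasSum_one := by
    have := (hasSum_cutWeight (P := P) (fun _ => 1) n s).div_const (cutSum P (fun _ => 1) n s)
    rw [div_self (cutSum_pos n hs).ne'] at this
    simpa using this
  balance := fun k => by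
    rw [← mul_div_assoc, ← mul_div_assoc]
    congr 1
    have h := mu_mul_weight (P := P) k
    unfold cutEntry cutWeight
    rcases lt_trichotomy k n with hk | hk | hk
    · rw [if_pos hk, if_pos hk.le, if_pos (by omega : k + 1 ≤ n), h, mul_one]
    · subst hk
      rw [if_neg (lt_irrefl k), if_pos rfl, if_pos le_rfl, if_neg (by omega), if_pos rfl]
      linear_combination (-s) * h
    · rw [if_neg (by omega : ¬ k < n), if_neg (by omega : ¬ k = n),
        if_neg (by omega : ¬ k + 1 ≤ n), if_neg (by omega : ¬ k + 1 = n + 1)]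
      ring

lemma hasSum_cut_mul (a : ℕ → ℝ) (n : ℕ) (s : ℝ) :
    HasSum (fun k => cutWeight P n s k / cutSum P (fun _ => 1) n s * a k) (cutMean P a n s) :=
  ((hasSum_cutWeight (P := P) a n s).div_const _).congr_fun fun k => by ring

/-- Below the cutoff x_{i+1} = 1 and regularity applies; from the cutoff on x_{i+2} = 0 and
monotonicity of μ suffices. -/
lemma cutEntry_drift_antitone (hreg : P.IsRegular) (n : ℕ) {s : ℝ} (hs : s ∈ Set.Icc (0 : ℝ) 1)
    (i : ℕ) : P.lam (i + 2) * cutEntry n s (i + 2) - P.mu (i + 2)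
      ≤ P.lam (i + 1) * cutEntry n s (i + 1) - P.mu (i + 1) := by
  have h1 := hreg.2 (i + 2) (by omega)
  have h2 : P.mu (i + 1) ≤ P.mu (i + 2) := P.mu_mono (by omega)
  simp only [show i + 2 - 1 = i + 1 by omega] at h1
  rcases lt_or_ge (i + 1) n with h | h
  · have h3 : cutEntry n s (i + 1) = 1 := if_pos h
    have h4 := mul_le_of_le_one_right (P.lam_nonneg (i + 2)) (cutEntry_mem n hs (i + 2)).2
    rw [h3, mul_one]
    linarith
  · have h3 : cutEntry n s (i + 2) = 0 := by
      rw [cutEntry, if_neg (by omega), if_neg (by omega)]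
    have h4 := mul_nonneg (P.lam_nonneg (i + 1)) (cutEntry_mem n hs (i + 1)).1
    rw [h3, mul_zero]
    linarith

lemma fcfsPolicy_cutEntry_isCutoff (n : ℕ) {s : ℝ} (hs : s ∈ Set.Icc (0 : ℝ) 1) :
    (fcfsPolicy P (cutEntry n s)).IsCutoff := by
  refine ⟨?_, fun k ℓ => ⟨rfl, rfl⟩⟩
  change ∃ K : ℕ∞, (∀ k : ℕ, (k : ℕ∞) + 1 < K → cutEntry n s k = 1) ∧
      (∀ k : ℕ, (k : ℕ∞) + 1 = K → 0 < cutEntry n s k ∧ cutEntry n s k ≤ 1) ∧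
      (∀ k : ℕ, K ≤ (k : ℕ∞) → cutEntry n s k = 0)
  -- The definition of a cutoff asks for positive entry at K - 1, so K is n when s = 0 and n + 1
  -- otherwise.
  rcases hs.1.eq_or_lt with h0 | h0
  · refine ⟨n, fun k hk => ?_, fun k hk => ?_, fun k hk => ?_⟩
    · have : k + 1 < n := by exact_mod_cast hk
      exact if_pos (by omega)
    · have : k + 1 = n := by exact_mod_cast hk
      rw [cutEntry, if_pos (by omega)]
      simp
    · have : n ≤ k := by exact_mod_cast hk
      rw [cutEntry, if_neg (by omega), ← h0, ite_self]
  · refine ⟨(n + 1 : ℕ), fun k hk => ?_, fun k hk => ?_, fun k hk => ?_⟩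
    · have : k + 1 < n + 1 := by exact_mod_cast hk
      exact if_pos (by omega)
    · have : k + 1 = n + 1 := by exact_mod_cast hk
      rw [cutEntry, if_neg (by omega), if_pos (by omega)]
      exact ⟨h0, hs.2⟩
    · have : n + 1 ≤ k := by exact_mod_cast hk
      rw [cutEntry, if_neg (by omega), if_neg (by omega)]

lemma fcfsPolicy_full_isCutoff : (fcfsPolicy P fun _ => 1).IsCutoff :=
  ⟨⟨⊤, fun _ _ => rfl, fun _ _ => ⟨zero_lt_one, le_rfl⟩,
    fun k hk => absurd (top_le_iff.1 hk) (ENat.natCast_ne_top k)⟩, fun _ _ => ⟨rfl, rfl⟩⟩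

lemma fcfsPolicy_isFCFS (x : ℕ → ℝ) : (fcfsPolicy P x).IsFCFS P := fun _ _ _ => rfl

/-- A distribution generated by a cutoff policy that beats all admissible distributions is part of
an optimal design. -/
lemma exists_isOptimal_fcfs (hreg : P.IsRegular) {x : ℕ → ℝ}
    (hx : ∀ k, x k ∈ Set.Icc (0 : ℝ) 1)
    (hdec : ∀ i, P.lam (i + 2) * x (i + 2) - P.mu (i + 2)
      ≤ P.lam (i + 1) * x (i + 1) - P.mu (i + 1))
    (hp : IsFCFSInvariant P x p) (hk : Summable fun k => p k * (k : ℝ))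
    (h : 0 ≤ ∑' k, p k * agentSurplus P w k)
    (hmax : ∀ p', IsAttainable P p' → (Summable fun k => p' k * (k : ℝ)) →
      0 ≤ ∑' k, p' k * agentSurplus P w k →
      ∑' k, p' k * flowPayoff P w k ≤ ∑' k, p k * flowPayoff P w k) :
    ∃ I, IsOptimal P w ⟨p, fcfsPolicy P x, I⟩ ∧ IsNoInformation P (fcfsPolicy P x) p I := by
  obtain ⟨L, hL⟩ := hreg.exists_lam_le
  have hpa := hp.isAttainable hx
  obtain ⟨I, hI, hno⟩ := exists_noInfo_feasible hreg.1 w hx hL hdec hp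
    ((participation_iff hpa hk).2 h)
  refine ⟨I, ⟨hI, fun d' hd' => ?_⟩, hno⟩
  have h1 := hd'.invariant.isAttainable hd'.entryExit
  have h2 := hd'.meanLength_le hreg
  have h3 := summable_mul_id_of_participation h1 h2
  rw [objective_eq h1 h3]
  change _ ≤ objective P w p
  rw [objective_eq hpa hk, EReal.coe_le_coe_iff]
  exact hmax _ h1 h3 ((participation_iff h1 h3).1 h2)

lemma summable_weight_mul_agentSurplus (h : Summable fun k => weight P k * (k : ℝ)) :
    Summable fun k => weight P k * agentSurplus P w k := by
  refine (((summable_weight_mul_mu (summable_weight_of_mul h)).mul_left w.V).sub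
    (h.mul_left w.C)).congr fun k => ?_
  rw [agentSurplus]
  ring

lemma summable_weight_mul_flowPayoff (h : Summable fun k => weight P k * (k : ℝ)) :
    Summable fun k => weight P k * flowPayoff P w k := by
  refine (((summable_weight_mul_mu (summable_weight_of_mul h)).mul_left ((1 - w.α) * w.R)).add
    ((summable_weight_mul_agentSurplus (w := w) h).mul_left w.α)).congr fun k => ?_
  rw [flowPayoff]
  ring

lemma eventually_cutMean_agentSurplus_neg (h : ¬ Summable fun k => weight P k * (k : ℝ)) :
    ∀ᶠ n in atTop, cutMean P (agentSurplus P w) n 0 < 0 := by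
  obtain ⟨B, hB⟩ := P.mu_bounded
  filter_upwards [eventually_lt_cutMean_id h (w.V * B / w.C)] with n hn
  rw [div_lt_iff₀ w.C_pos] at hn
  have h1 := cutMean_mono (P := P) hB n (le_refl (0 : ℝ))
  rw [cutMean_const _ _ le_rfl] at h1
  have h2 := mul_le_mul_of_nonneg_left h1 w.V_pos.le
  rw [cutMean_agentSurplus]
  linarith

end

end QueueDesign

theorem theorem1 (P : QueueDesign.PrimitiveProcess) (hreg : P.IsRegular)
    (w : QueueDesign.Payoffs) :
    ∃ d : QueueDesign.Design,
      QueueDesign.IsOptimal P w d ∧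
      d.π.IsCutoff ∧
      d.π.IsFCFS P ∧
      QueueDesign.IsNoInformation P d.π d.p d.I := by
  open QueueDesign in
  rcases exists_optimal_cutoff (P := P) (h := agentSurplus P w) (o := flowPayoff P w)
      (by simp [agentSurplus, P.mu_zero]) summable_weight_mul_agentSurplus
      summable_weight_mul_flowPayoff eventually_cutMean_agentSurplus_neg with
    ⟨⟨hk, hfull⟩, hmax⟩ | ⟨⟨n, s⟩, ⟨hs, hc⟩, hmax, hmaxf⟩
  · have hW := summable_weight_of_mul hk
    have hmean : ∀ a : ℕ → ℝ,
        ∑' k, weight P k / (∑' k, weight P k) * a k = fullMean P a := fun a => by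
      rw [fullMean, ← tsum_div_const]
      exact tsum_congr fun k => by ring
    obtain ⟨I, hI, hno⟩ := exists_isOptimal_fcfs (w := w) hreg (x := fun _ => 1)
      (fun _ => by simp) (fun i => by
        have := hreg.2 (i + 2) (by omega)
        simp only [show i + 2 - 1 = i + 1 by omega] at this
        linarith) (isFCFSInvariant_full hW)
      ((hk.div_const (∑' k, weight P k)).congr fun k => by ring)
      (by rw [hmean]; exact hfull) (fun p' hp' hk' h' => by
        rw [hmean]
        rcases hp'.tsum_flowPayoff_le hreg.1 hk' h' with ⟨c, hc, hle⟩ | ⟨_, heq⟩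
        exacts [hle.trans (hmax c hc), heq.le])
    exact ⟨_, hI, fcfsPolicy_full_isCutoff, fcfsPolicy_isFCFS _, hno⟩
  · obtain ⟨I, hI, hno⟩ := exists_isOptimal_fcfs (w := w) hreg (cutEntry_mem n hs)
      (cutEntry_drift_antitone hreg n hs) (isFCFSInvariant_cut n hs.1)
      (hasSum_cut_mul (fun k => (k : ℝ)) n s).summable
      (by rw [(hasSum_cut_mul _ n s).tsum_eq]; exact hc) (fun p' hp' hk' h' => by
        rw [(hasSum_cut_mul _ n s).tsum_eq]
        rcases hp'.tsum_flowPayoff_le hreg.1 hk' h' with ⟨c, hc', hle⟩ | ⟨hf, heq⟩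
        exacts [hle.trans (hmax c hc'), heq.le.trans (hmaxf hf)])
    exact ⟨_, hI, fcfsPolicy_cutEntry_isCutoff n hs, fcfsPolicy_isFCFS _, hno⟩
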